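/- **Theorem.** Let $P=(P_n)_{n\in\{0_\pm,1,2,\dots\}}$ be a subfactor planar algebra of modulus $\delta>1$ (a planar $*$-algebra with finite-dimensional spaces that is connected, spherical, positive and of modulus $\delta$), and let $Q\subseteq P$ be a $*$-planar subalgebra, i.e. a family of subspaces $Q_n\subseteq P_n$ closed under the action of all planar tangles and under $*$; thus $Q$ is itself a subfactor planar algebra of modulus $\delta$. Write $\tau$ for the normalised pictorial trace on $P_n$ ($\tau(1)=1$), which restricts to that of $Q_n$. Let $F_1(P)=\bigoplus_{n\ge 1}P_n$, with the product $\#$ whose component in $P_t$, for $a\in P_m$ and $b\in P_n$, is defined for $|m-n|+1\le t\le m+n-1$ (and is $0$ for all other $t$) and is obtained as follows. Draw $a$ and $b$ as boxes with $2m-2$, resp. $2n-2$, strings at the top, one string on the left and one on the right, the distinguished interval $*$ being at the top left corner; put $a$ to the left of $b$; join the right string of $a$ to the left string of $b$; join the last $m+n-1-t$ top strings of $a$, by nested arcs, to the first $m+n-1-t$ top strings of $b$; and connect all the remaining strings to an outer box with $2t-2$ strings at the top and one on each side. The unit of $F_1(P)$ is the unit of $P_1$; the involution is $a^\dagger=Z_{R}(a^*)$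 for $a\in P_m$, where $R=R_m$ is the rotation tangle that turns the picture by two marked points and so makes $\dagger$ the reflection of such boxes in a vertical line; and the trace is $t_1(a)=\tau(a_1)$, where $a_1\in P_1$ is the component of $a$ in $P_1$. Define $(F_1(Q),t_1)$ in the same way. A *finite pre-von Neumann algebra* is a unital complex $*$-algebra $A$ with a linear functional $t$ such that $t(1)=1$, $t(ab)=t(ba)$, $\langle a,b\rangle=t(b^*a)$ is an inner product on $A$, and every left multiplication is bounded for the norm of this inner product; a *compatible pair* $(A,t_A)\subseteq(B,t_B)$ consists of two such algebras with $A$ a unital $*$-subalgebra of $B$ and $t_B|_A=t_A$. Then $(F_1(Q),t_1)\subseteq(F_1(P),t_1)$ is a compatible pair of finite pre-von Neumann algebras, and there is a linear map $E:F_1(P)\to F_1(Q)$ such that, for all $y\in F_1(Q)$ and $x\in F_1(P)$, $$E(y)=y,\quad E(y\,\#\,x)=y\,\#\,E(x),\quad E(x\,\#\,y)=E(x)\,\#\,y,\quad E(x^\dagger)=E(x)^\dagger,\quad t_1(E(x))=t_1(x);$$ that is, $E$ is a $*$- and $t_1$-preserving $F_1(Q)$-$F_1(Q)$-bimodule retraction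 for the inclusion of $F_1(Q)$ into $F_1(P)$. Moreover $E$ is given componentwise: $E(x)_n=E_{Q_n}(x_n)$ for every $n\ge 1$, where $E_{Q_n}:P_n\to Q_n$ is the $\tau$-preserving conditional expectation (a linear, $*$- and $\tau$-preserving $Q_n$-$Q_n$-bimodule map that is the identity on $Q_n$). -/

import Mathlib

universe u

open scoped DirectSum

noncomputable section

/-! ## Colours, marked points and boundary arcs -/

/-- The colours `0₊ = 0, 0₋, 1, 2, 3, …`. A disc of colour `n` carries `2 n` marked points, a disc
of colour `0₋` carries none. -/
inductive Col : Type
  | nat (n : ℕ)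
  | zeroMinus

namespace Col

/-- Half of the number of marked points of a disc. -/
def size : Col → ℕ
  | nat n => n
  | zeroMinus => 0

/-- The two colours of size zero: `0₊` (unshaded boundary) and `0₋` (shaded boundary). -/
def zero : Bool → Col
  | false => nat 0
  | true => zeroMinus

/-- The marked points on the boundary of a disc, numbered clockwise, starting from the
distinguished boundary arc `*`. -/
abbrev Pt (c : Col) : Type := Fin (2 * c.size)

/-- The arcs into which the marked points divide the boundary circle, numbered clockwise. The arc
`0` is the distinguished one. The boundary of a disc without marked points is one single arc. -/
abbrev Arc (c : Col) : Type := Fin (max 1 (2 * c.size))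

/-- Arc number `a` is shaded iff this is `true`: the distinguished arc is unshaded (except for the
colour `0₋`), and the shading alternates. -/
def shade : Col → ℕ → Bool
  | nat _, a => a % 2 == 1
  | zeroMinus, _ => true

/-- The arc that ends at the marked point `j` (clockwise). -/
def before {c : Col} (j : c.Pt) : c.Arc := ⟨j.val, lt_max_of_lt_right j.isLt⟩

/-- The arc that starts at the marked point `j` (clockwise). -/
def after {c : Col} (j : c.Pt) : c.Arc :=
  ⟨(j.val + 1) % (2 * c.size),
    lt_max_of_lt_right (Nat.mod_lt _ (Nat.zero_lt_of_lt j.isLt))⟩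

/-- The unshaded one of the two arcs adjacent to a marked point. -/
def whiteArc {c : Col} (j : c.Pt) : c.Arc := if j.val % 2 = 0 then before j else after j

/-- The shaded one of the two arcs adjacent to a marked point. -/
def blackArc {c : Col} (j : c.Pt) : c.Arc := if j.val % 2 = 0 then after j else before j

/-- The effect on marked points of a reflection that preserves the distinguished arc. -/
def revPt {c : Col} (j : c.Pt) : c.Pt := Fin.rev j

/-- The effect on arcs of a reflection that preserves the distinguished arc. -/
def revArc {c : Col} (a : c.Arc) : c.Arc :=
  ⟨(2 * c.size - a.val) % (max 1 (2 * c.size)), Nat.mod_lt _ (by positivity)⟩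

end Col

/-! ## Planar tangles

A planar tangle is considered up to isotopy, and is recorded by its curves, its regions and their
incidences with the boundaries of the discs. The internal discs are indexed by `ι`. -/

section Incidence

variable {ι : Type} (c : ι → Col) (c₀ : Col)

/-- All marked points of a tangle: those on internal discs and those on the external disc. -/
abbrev Ends : Type := (Σ i, (c i).Pt) ⊕ c₀.Pt

/-- All boundary arcs of a tangle. -/
abbrev Arcs : Type := (Σ i, (c i).Arc) ⊕ c₀.Arc

variable {c c₀}

/-- Orient every curve so that the unshaded region lies on its left. Then this is `true` for the
marked points at which a string enters the diagram and `false` for those at which it leaves it. -/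
def isSource : Ends c c₀ → Bool
  | .inl p => p.2.val % 2 == 0
  | .inr j => j.val % 2 == 1

/-- The unshaded arc next to a marked point. -/
def endWhite : Ends c c₀ → Arcs c c₀
  | .inl p => .inl ⟨p.1, Col.whiteArc p.2⟩
  | .inr j => .inr (Col.whiteArc j)

/-- The shaded arc next to a marked point. -/
def endBlack : Ends c c₀ → Arcs c c₀
  | .inl p => .inl ⟨p.1, Col.blackArc p.2⟩
  | .inr j => .inr (Col.blackArc j)

/-- The map on marked points given by maps on the individual discs. -/
def endMap {X : Type} (f : ∀ i, (c i).Pt → X) (g : c₀.Pt → X) : Ends c c₀ → X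
  | .inl p => f p.1 p.2
  | .inr j => g j

/-- Two arcs are consecutive in a boundary circuit of a region if a string leads from an end of the
one to an end of the other, on the side of the string on which both arcs lie. -/
def ArcStep {X : Type} (e : Ends c c₀ → X) (a b : Arcs c c₀) : Prop :=
  ∃ p q, e p = e q ∧
    ((a = endWhite p ∧ b = endWhite q) ∨ (a = endBlack p ∧ b = endBlack q))

end Incidence

/-- A (shaded) planar tangle with external disc of colour `c₀` and internal discs of colours `c i`,
up to planar isotopy.

The curves are the strings (with two end points) and the closed loops (without end points). The
last two fields say that the surface which is glued together from the discs, from the strings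
(thickened to ribbons), from the loops (thickened to annuli) and from the regions (a region with
`b` boundary circuits being a sphere with `b` holes) is connected and has Euler characteristic `2`,
that is, that it is a sphere. -/
structure Tangle {ι : Type} (c : ι → Col) (c₀ : Col) : Type 1 where
  Curve : Type
  Region : Type
  finite_curve : Finite Curve
  finite_region : Finite Region
  /-- The curve that ends at a given marked point. -/
  inCurve : ∀ i, (c i).Pt → Curve
  outCurve : c₀.Pt → Curve
  /-- The region adjacent to a given boundary arc. -/
  inRegion : ∀ i, (c i).Arc → Region
  outRegion : c₀.Arc → Region
  /-- The checkerboard shading of the regions. -/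
  shaded : Region → Bool
  /-- The unshaded and the shaded side of a curve. -/
  white : Curve → Region
  black : Curve → Region
  shaded_white : ∀ x, shaded (white x) = false
  shaded_black : ∀ x, shaded (black x) = true
  shaded_in : ∀ i a, shaded (inRegion i a) = (c i).shade a.val
  shaded_out : ∀ a, shaded (outRegion a) = c₀.shade a.val
  white_in : ∀ i j, white (inCurve i j) = inRegion i (Col.whiteArc j)
  black_in : ∀ i j, black (inCurve i j) = inRegion i (Col.blackArc j)
  white_out : ∀ j, white (outCurve j) = outRegion (Col.whiteArc j)
  black_out : ∀ j, black (outCurve j) = outRegion (Col.blackArc j)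
  /-- A curve with an end point has exactly one end of each kind. -/
  two_ends : ∀ p : Ends c c₀, ∃! q : Ends c c₀,
    endMap inCurve outCurve q = endMap inCurve outCurve p ∧ isSource q = !isSource p
  connected : ∀ r s : Region,
    Relation.EqvGen (fun r s => ∃ x, white x = r ∧ black x = s) r s
  /-- `(discs) - (strings) + 2 (regions) - (circuits without loops) - 2 (loops) = 2`. -/
  euler : (Nat.card ι + 1) + 2 * Nat.card Region =
    2 + Nat.card Curve + Nat.card {x : Curve // ∀ p, endMap inCurve outCurve p ≠ x} +
      Nat.card (Quot (ArcStep (endMap inCurve outCurve)))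

namespace Tangle

/-- `T'` is `T` with its internal discs renamed along `e` (for `e` the identity: the two tangles
are isotopic). -/
def IsRelabelling {ι ι' : Type} (e : ι ≃ ι') {c' : ι' → Col} {c₀ : Col}
    (T : Tangle (fun i => c' (e i)) c₀) (T' : Tangle c' c₀) : Prop :=
  ∃ (φ : T.Curve ≃ T'.Curve) (ψ : T.Region ≃ T'.Region),
    (∀ i j, φ (T.inCurve i j) = T'.inCurve (e i) j) ∧
    (∀ j, φ (T.outCurve j) = T'.outCurve j) ∧
    (∀ i a, ψ (T.inRegion i a) = T'.inRegion (e i) a) ∧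
    (∀ a, ψ (T.outRegion a) = T'.outRegion a) ∧
    (∀ x, ψ (T.white x) = T'.white (φ x)) ∧
    (∀ x, ψ (T.black x) = T'.black (φ x))

/-- `T'` is obtained from `T` by a reflection that preserves all distinguished arcs. -/
def IsMirror {ι : Type} {c : ι → Col} {c₀ : Col} (T T' : Tangle c c₀) : Prop :=
  ∃ (φ : T.Curve ≃ T'.Curve) (ψ : T.Region ≃ T'.Region),
    (∀ i j, φ (T.inCurve i j) = T'.inCurve i (Col.revPt j)) ∧
    (∀ j, φ (T.outCurve j) = T'.outCurve (Col.revPt j)) ∧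
    (∀ i a, ψ (T.inRegion i a) = T'.inRegion i (Col.revArc a)) ∧
    (∀ a, ψ (T.outRegion a) = T'.outRegion (Col.revArc a)) ∧
    (∀ x, ψ (T.white x) = T'.white (φ x)) ∧
    (∀ x, ψ (T.black x) = T'.black (φ x))

/-- Two tangles whose external discs have no marked points are isotopic on the sphere: they agree
up to the position of the external disc. -/
def IsSphericallyIsotopic {ι : Type} {c : ι → Col} {s s' : Bool}
    (T : Tangle c (Col.zero s)) (T' : Tangle c (Col.zero s')) : Prop :=
  ∃ (φ : T.Curve ≃ T'.Curve) (ψ : T.Region ≃ T'.Region),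
    (∀ i j, φ (T.inCurve i j) = T'.inCurve i j) ∧
    (∀ i a, ψ (T.inRegion i a) = T'.inRegion i a) ∧
    (∀ x, ψ (T.white x) = T'.white (φ x)) ∧
    (∀ x, ψ (T.black x) = T'.black (φ x))

section Composition

variable {ι : Type} {κ : ι → Type} {c : ι → Col} {d : ∀ i, κ i → Col} {c₀ : Col}

/-- When tangles `S i` are inserted into the internal discs of `T`, curves are joined at the marked
points of these discs … -/
def GlueCurves (T : Tangle c c₀) (S : ∀ i, Tangle (d i) (c i))
    (x y : T.Curve ⊕ (Σ i, (S i).Curve)) : Prop :=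
  ∃ i j, x = .inl (T.inCurve i j) ∧ y = .inr ⟨i, (S i).outCurve j⟩

/-- … and regions are joined along the arcs. -/
def GlueRegions (T : Tangle c c₀) (S : ∀ i, Tangle (d i) (c i))
    (x y : T.Region ⊕ (Σ i, (S i).Region)) : Prop :=
  ∃ i a, x = .inl (T.inRegion i a) ∧ y = .inr ⟨i, (S i).outRegion a⟩

/-- `T'` is (isotopic to) the tangle obtained by inserting the tangles `S i` into the internal
discs of `T`. -/
def IsComposite (T : Tangle c c₀) (S : ∀ i, Tangle (d i) (c i))
    (T' : Tangle (fun p : Σ i, κ i => d p.1 p.2) c₀) : Prop :=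
  ∃ (φ : Quot (GlueCurves T S) ≃ T'.Curve) (ψ : Quot (GlueRegions T S) ≃ T'.Region),
    (∀ j, φ (Quot.mk _ (.inl (T.outCurve j))) = T'.outCurve j) ∧
    (∀ i k j, φ (Quot.mk _ (.inr ⟨i, (S i).inCurve k j⟩)) = T'.inCurve ⟨i, k⟩ j) ∧
    (∀ a, ψ (Quot.mk _ (.inl (T.outRegion a))) = T'.outRegion a) ∧
    (∀ i k a, ψ (Quot.mk _ (.inr ⟨i, (S i).inRegion k a⟩)) = T'.inRegion ⟨i, k⟩ a) ∧
    (∀ x, ψ (Quot.mk _ (.inl (T.white x))) = T'.white (φ (Quot.mk _ (.inl x)))) ∧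
    (∀ x, ψ (Quot.mk _ (.inl (T.black x))) = T'.black (φ (Quot.mk _ (.inl x)))) ∧
    (∀ i x, ψ (Quot.mk _ (.inr ⟨i, (S i).white x⟩)) = T'.white (φ (Quot.mk _ (.inr ⟨i, x⟩)))) ∧
    (∀ i x, ψ (Quot.mk _ (.inr ⟨i, (S i).black x⟩)) = T'.black (φ (Quot.mk _ (.inr ⟨i, x⟩))))

end Composition

/-! ### Auxiliary facts for the construction of tangles -/

theorem connected_of_step {N : ℕ} {C : Type} (w b : C → Fin N)
    (h : ∀ r : Fin N, r.val ≠ 0 → ∃ s : Fin N, s < r ∧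
      ∃ x, (w x = r ∧ b x = s) ∨ (w x = s ∧ b x = r)) (r s : Fin N) :
    Relation.EqvGen (fun r s => ∃ x, w x = r ∧ b x = s) r s := by
  have key : ∀ n : ℕ, ∀ r : Fin N, r.val = n → ∀ z : Fin N, z.val = 0 →
      Relation.EqvGen (fun r s => ∃ x, w x = r ∧ b x = s) r z := by
    intro n
    induction n using Nat.strong_induction_on with
    | _ n ih =>
      intro r hr z hz
      by_cases h0 : r.val = 0
      · have : r = z := Fin.ext (by omega)
        exact this ▸ Relation.EqvGen.refl _
      · obtain ⟨s, hs, x, hx⟩ := h r h0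
        have hs' : s.val < n := by rw [← hr]; exact hs
        have h2 := ih s.val hs' s rfl z hz
        rcases hx with hx | hx
        · exact .trans _ _ _ (.rel _ _ ⟨x, hx⟩) h2
        · exact .trans _ _ _ (.symm _ _ (.rel _ _ ⟨x, hx⟩)) h2
  have hN : 0 < N := Nat.zero_lt_of_lt r.isLt
  exact .trans _ _ _ (key _ r rfl ⟨0, hN⟩ rfl) (.symm _ _ (key _ s rfl ⟨0, hN⟩ rfl))

theorem card_circuits {A : Type} {N : ℕ} {r : A → A → Prop} (f : A → Fin N)
    (rep : Fin N → A) (hf : ∀ a b, r a b → f a = f b) (hrep : ∀ n, f (rep n) = n)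
    (h : ∀ a, Relation.EqvGen r a (rep (f a))) : Nat.card (Quot r) = N := by
  have e : Quot r ≃ Fin N :=
    { toFun := Quot.lift f hf
      invFun := fun n => Quot.mk _ (rep n)
      left_inv := by
        intro q
        induction q using Quot.ind with
        | _ a => exact (Quot.eqvGen_sound (h a)).symm
      right_inv := hrep }
  rw [Nat.card_congr e, Nat.card_eq_fintype_card, Fintype.card_fin]

end Tangle

namespace Col

theorem add_mod_eq {a b K : ℕ} (ha : a < K) (hb : b ≤ K) :
    (a + b) % K = if a + b < K then a + b else a + b - K := by
  split_ifs with h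
  · exact Nat.mod_eq_of_lt h
  · rw [Nat.mod_eq_sub_mod (by omega), Nat.mod_eq_of_lt (by omega)]

theorem before_val {c : Col} (j : c.Pt) : (before j).val = j.val := rfl

theorem after_val {c : Col} (j : c.Pt) : (after j).val =
    if j.val + 1 < 2 * c.size then j.val + 1 else 0 := by
  have hj := j.isLt
  show (j.val + 1) % (2 * c.size) = _
  rw [add_mod_eq hj (by omega)]
  split_ifs <;> omega

theorem whiteArc_val {c : Col} (j : c.Pt) : (whiteArc j).val =
    if j.val % 2 = 0 then j.val else if j.val + 1 < 2 * c.size then j.val + 1 else 0 := by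
  unfold whiteArc
  split_ifs with h h1
  · rfl
  · rw [after_val, if_pos h1]
  · rw [after_val, if_neg h1]

theorem blackArc_val {c : Col} (j : c.Pt) : (blackArc j).val =
    if j.val % 2 = 0 then j.val + 1 else j.val := by
  have hj := j.isLt
  unfold blackArc
  split_ifs with h
  · rw [after_val, if_pos (by omega)]
  · rfl

theorem shade_whiteArc {c : Col} (j : c.Pt) : c.shade (whiteArc j).val = false := by
  rw [whiteArc_val]
  cases c with
  | zeroMinus => exact absurd j.isLt (by simp [size])
  | nat n => simp only [shade, beq_eq_false_iff_ne]; split_ifs <;> omega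

theorem shade_blackArc {c : Col} (j : c.Pt) : c.shade (blackArc j).val = true := by
  rw [blackArc_val]
  cases c with
  | zeroMinus => exact absurd j.isLt (by simp [size])
  | nat n => simp only [shade, beq_iff_eq]; split_ifs <;> omega

end Col

namespace Tangle

theorem no_loops {C E : Type} (e : E → C) (h : ∀ x, ∃ p, e p = x) :
    Nat.card {x : C // ∀ p, e p ≠ x} = 0 := by
  have : IsEmpty {x : C // ∀ p, e p ≠ x} :=
    ⟨fun x => by obtain ⟨p, hp⟩ := h x.1; exact x.2 p hp⟩
  exact Nat.card_of_isEmpty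

section Rotation

variable (c : Col) (s : ℕ)

def rotPt (j : c.Pt) : c.Pt :=
  ⟨(j.val + 2 * s) % (2 * c.size), Nat.mod_lt _ (Nat.zero_lt_of_lt j.isLt)⟩

def rotArc (a : c.Arc) : c.Arc :=
  ⟨(a.val + 2 * s) % (max 1 (2 * c.size)), Nat.mod_lt _ (by positivity)⟩

variable {c s}

theorem rotPt_val (hs : s ≤ c.size) (j : c.Pt) : (rotPt c s j).val =
    if j.val + 2 * s < 2 * c.size then j.val + 2 * s else j.val + 2 * s - 2 * c.size :=
  Col.add_mod_eq j.isLt (by omega)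

theorem rotArc_val (hs : s ≤ c.size) (a : c.Arc) : (rotArc c s a).val =
    if a.val + 2 * s < 2 * c.size then a.val + 2 * s else a.val + 2 * s - 2 * c.size := by
  have ha := a.isLt
  show (a.val + 2 * s) % (max 1 (2 * c.size)) = _
  rw [Col.add_mod_eq ha (by omega)]
  generalize a.val = z at *
  by_cases h : c.size = 0
  · have : max 1 (2 * c.size) = 1 := by omega
    rw [this] at ha ⊢
    split_ifs <;> omega
  · rw [max_eq_right (by omega)]

theorem rotArc_before (hs : s ≤ c.size) (j : c.Pt) :
    rotArc c s (Col.before j) = Col.before (rotPt c s j) := by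
  have hj := j.isLt
  apply Fin.ext
  rw [rotArc_val hs, Col.before_val, Col.before_val, rotPt_val hs]

theorem rotArc_after (hs : s ≤ c.size) (j : c.Pt) :
    rotArc c s (Col.after j) = Col.after (rotPt c s j) := by
  have hj := j.isLt
  apply Fin.ext
  rw [rotArc_val hs, Col.after_val, Col.after_val, rotPt_val hs]
  split_ifs <;> omega

theorem rotPt_parity (hs : s ≤ c.size) (j : c.Pt) : (rotPt c s j).val % 2 = j.val % 2 := by
  rw [rotPt_val hs]; split_ifs <;> omega

theorem rotPt_bijective (hs : s ≤ c.size) : Function.Bijective (rotPt c s) := by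
  rw [← Finite.injective_iff_bijective]
  intro i j h
  have h := congrArg Fin.val h
  have hi := i.isLt
  have hj := j.isLt
  rw [rotPt_val hs, rotPt_val hs] at h
  apply Fin.ext
  split_ifs at h <;> omega

theorem rotArc_bijective (hs : s ≤ c.size) : Function.Bijective (rotArc c s) := by
  rw [← Finite.injective_iff_bijective]
  intro i j h
  have h := congrArg Fin.val h
  have hi := i.isLt
  have hj := j.isLt
  rw [rotArc_val hs, rotArc_val hs] at h
  apply Fin.ext
  split_ifs at h <;> omega

theorem exists_point (h : 0 < c.size) (a : c.Arc) :
    ∃ j : c.Pt, Col.before j = a :=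
  ⟨⟨a.val, by have := a.isLt; omega⟩, Fin.ext rfl⟩

theorem rot_whiteArc (hs : s ≤ c.size) (j : c.Pt) :
    rotArc c s (Col.whiteArc j) = Col.whiteArc (rotPt c s j) := by
  unfold Col.whiteArc
  rw [rotPt_parity hs]
  split_ifs
  · exact rotArc_before hs j
  · exact rotArc_after hs j

theorem rot_blackArc (hs : s ≤ c.size) (j : c.Pt) :
    rotArc c s (Col.blackArc j) = Col.blackArc (rotPt c s j) := by
  unfold Col.blackArc
  rw [rotPt_parity hs]
  split_ifs
  · exact rotArc_after hs j
  · exact rotArc_before hs j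

theorem rot_shade (hs : s ≤ c.size) (a : c.Arc) :
    c.shade (rotArc c s a).val = c.shade a.val := by
  cases c with
  | zeroMinus => rfl
  | nat n =>
    have : (rotArc (Col.nat n) s a).val % 2 = a.val % 2 := by
      have h1 : s ≤ n := hs
      have h2 := a.isLt
      rw [rotArc_val hs]
      generalize a.val = z at *
      change z < max 1 (2 * n) at h2
      change (if z + 2 * s < 2 * n then z + 2 * s else z + 2 * s - 2 * n) % 2 = z % 2
      split_ifs <;> omega
    simp [Col.shade, this]

end Rotation

/-- The annular tangle with one internal disc in which the marked point `j` on the external disc is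
connected to the marked point `j + 2 s` on the internal disc: the `s`-th power of the rotation
tangle. For `s = 0` this is the identity tangle. -/
def rotation (c : Col) (s : ℕ) (hs : s ≤ c.size) : Tangle (fun _ : Unit => c) c where
  Curve := c.Pt
  Region := c.Arc
  finite_curve := inferInstance
  finite_region := inferInstance
  inCurve _ j := j
  outCurve j := rotPt c s j
  inRegion _ a := a
  outRegion a := rotArc c s a
  shaded a := c.shade a.val
  white := Col.whiteArc
  black := Col.blackArc
  shaded_white := Col.shade_whiteArc
  shaded_black := Col.shade_blackArc
  shaded_in _ _ := rfl
  shaded_out := rot_shade hs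
  white_in _ _ := rfl
  black_in _ _ := rfl
  white_out j := (rot_whiteArc hs j).symm
  black_out j := (rot_blackArc hs j).symm
  two_ends := by
    rintro (⟨⟨⟩, j⟩ | j)
    · obtain ⟨i, hi⟩ := (rotPt_bijective hs).2 j
      have hp := rotPt_parity hs i
      rw [hi] at hp
      refine ⟨.inr i, ⟨hi, ?_⟩, ?_⟩
      · simp only [isSource, ← hp]
        rcases Nat.mod_two_eq_zero_or_one j.val with h | h <;> simp [h]
      · rintro (⟨⟨⟩, q⟩ | q) ⟨h1, h2⟩
        · have h1 : q = j := h1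
          subst h1
          simp [isSource] at h2
        · exact congrArg _ ((rotPt_bijective hs).1 (h1.trans hi.symm))
    · have hp := rotPt_parity hs j
      refine ⟨.inl ⟨(), rotPt c s j⟩, ⟨rfl, ?_⟩, ?_⟩
      · simp only [isSource, hp]
        rcases Nat.mod_two_eq_zero_or_one j.val with h | h <;> simp [h]
      · rintro (⟨⟨⟩, q⟩ | q) ⟨h1, h2⟩
        · have h1 : q = rotPt c s j := h1
          subst h1
          rfl
        · have h1 := (rotPt_bijective hs).1 h1
          subst h1
          simp [isSource] at h2
  connected := by
    apply connected_of_step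
    intro r hr
    have hr' : r.val < max 1 (2 * c.size) := r.isLt
    refine ⟨⟨r.val - 1, by omega⟩, show r.val - 1 < r.val by omega,
      (⟨r.val - 1, by omega⟩ : c.Pt), ?_⟩
    have hb : Col.before (⟨r.val - 1, by omega⟩ : c.Pt) = (⟨r.val - 1, by omega⟩ : c.Arc) := rfl
    have ha : Col.after (⟨r.val - 1, by omega⟩ : c.Pt) = r := by
      apply Fin.ext
      rw [Col.after_val]
      show (if r.val - 1 + 1 < _ then r.val - 1 + 1 else _) = _
      split_ifs <;> omega
    unfold Col.whiteArc Col.blackArc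
    rw [ha, hb]
    split_ifs <;> simp
  euler := by
    rw [no_loops _ (fun x => ⟨.inl ⟨(), x⟩, rfl⟩)]
    by_cases h0 : c.size = 0
    · have h1 : IsEmpty (Ends (fun _ : Unit => c) c) := by
        refine ⟨?_⟩
        rintro (p | p)
        · have : p.2.val < 2 * c.size := p.2.isLt
          omega
        · have : p.val < 2 * c.size := p.isLt
          omega
      have hz : ∀ a : c.Arc, a.val = 0 := fun a => by
        have := a.isLt
        omega
      rw [card_circuits (N := 2) (fun a => match a with | .inl _ => 0 | .inr _ => 1)
        (fun n => if n = 0 then .inl ⟨(), ⟨0, by omega⟩⟩ else .inr ⟨0, by omega⟩)]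
      · simp [h0]
      · rintro a b ⟨p, -⟩
        exact h1.elim p
      · intro n; fin_cases n <;> rfl
      · rintro (⟨⟨⟩, a⟩ | a)
        · have : a = ⟨0, by omega⟩ := Fin.ext (hz a)
          subst this; exact .refl _
        · have : a = ⟨0, by omega⟩ := Fin.ext (hz a)
          subst this; exact .refl _
    · rw [card_circuits (N := max 1 (2 * c.size))
        (fun a => match a with | .inl a => a.2 | .inr a => rotArc c s a)
        (fun n => .inl ⟨(), n⟩)]
      · simp; omega
      · rintro a b ⟨p, q, h, h' | h'⟩
        · obtain ⟨rfl, rfl⟩ := h'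
          rcases p with ⟨⟨⟩, p⟩ | p <;> rcases q with ⟨⟨⟩, q⟩ | q <;>
            simp only [endWhite, endMap, rot_whiteArc hs] at h ⊢ <;> rw [h]
        · obtain ⟨rfl, rfl⟩ := h'
          rcases p with ⟨⟨⟩, p⟩ | p <;> rcases q with ⟨⟨⟩, q⟩ | q <;>
            simp only [endBlack, endMap, rot_blackArc hs] at h ⊢ <;> rw [h]
      · intro n; rfl
      · rintro (⟨⟨⟩, a⟩ | a)
        · exact .refl _
        · obtain ⟨j, rfl⟩ := exists_point (by omega) a
          refine .rel _ _ ⟨.inr j, .inl ⟨(), rotPt c s j⟩, rfl, ?_⟩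
          show _ ∨ _
          simp only [endWhite, endBlack, rotArc_before hs, Col.whiteArc, Col.blackArc,
            rotPt_parity hs]
          split_ifs <;> simp

end Tangle

namespace Tangle

section Caps

variable {c : Col}

/-- The nested system of strings connecting `j` with `2 n - 1 - j`: labels of strings and regions. -/
def capPt (j : c.Pt) : Fin c.size :=
  ⟨min j.val (2 * c.size - 1 - j.val), by have := j.isLt; omega⟩

def capArc (a : c.Arc) : Fin (c.size + 1) :=
  ⟨min a.val (2 * c.size - a.val), by omega⟩

def capWhite (x : Fin c.size) : Fin (c.size + 1) :=
  ⟨if x.val % 2 = 0 then x.val else x.val + 1, by have := x.isLt; split_ifs <;> omega⟩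

def capBlack (x : Fin c.size) : Fin (c.size + 1) :=
  ⟨if x.val % 2 = 0 then x.val + 1 else x.val, by have := x.isLt; split_ifs <;> omega⟩

theorem capPt_val (j : c.Pt) : (capPt j).val = min j.val (2 * c.size - 1 - j.val) := rfl

theorem capArc_val (a : c.Arc) : (capArc a).val = min a.val (2 * c.size - a.val) := rfl

theorem cap_white_aux {N z w m : ℕ} (hz : z < 2 * N) (hm : m = min z (2 * N - 1 - z))
    (hw : w = if z % 2 = 0 then z else if z + 1 < 2 * N then z + 1 else 0) :
    (if m % 2 = 0 then m else m + 1) = min w (2 * N - w) := by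
  split_ifs at hw ⊢ <;> omega

theorem cap_black_aux {N z w m : ℕ} (hz : z < 2 * N) (hm : m = min z (2 * N - 1 - z))
    (hw : w = if z % 2 = 0 then z + 1 else z) :
    (if m % 2 = 0 then m + 1 else m) = min w (2 * N - w) := by
  split_ifs at hw ⊢ <;> omega

theorem cap_white (j : c.Pt) : capWhite (capPt j) = capArc (Col.whiteArc j) :=
  Fin.ext (cap_white_aux j.isLt rfl (Col.whiteArc_val j))

theorem cap_black (j : c.Pt) : capBlack (capPt j) = capArc (Col.blackArc j) :=
  Fin.ext (cap_black_aux j.isLt rfl (Col.blackArc_val j))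

theorem shade_congr (c : Col) {a b : ℕ} (h : a % 2 = b % 2) : c.shade a = c.shade b := by
  cases c <;> simp [Col.shade, h]

theorem shade_capWhite (x : Fin c.size) : c.shade (capWhite x).val = false := by
  cases c with
  | zeroMinus => exact absurd x.isLt (by simp [Col.size])
  | nat n => simp only [capWhite, Col.shade, beq_eq_false_iff_ne]; split_ifs <;> omega

theorem shade_capBlack (x : Fin c.size) : c.shade (capBlack x).val = true := by
  cases c with
  | zeroMinus => exact absurd x.isLt (by simp [Col.size])
  | nat n => simp only [capBlack, Col.shade, beq_iff_eq]; split_ifs <;> omega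

theorem shade_capArc (a : c.Arc) : c.shade (capArc a).val = c.shade a.val := by
  have ha := a.isLt
  apply shade_congr
  rw [capArc_val]
  generalize a.val = z at *
  omega

theorem cap_connected (r s : Fin (c.size + 1)) :
    Relation.EqvGen (fun r s => ∃ x : Fin c.size, capWhite x = r ∧ capBlack x = s) r s := by
  apply connected_of_step
  intro r hr
  have hr' := r.isLt
  refine ⟨⟨r.val - 1, by omega⟩, show r.val - 1 < r.val by omega, ⟨r.val - 1, by omega⟩, ?_⟩
  simp only [capWhite, capBlack, Fin.ext_iff]
  split_ifs <;> omega

/-- The other end of a string. -/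
def capOther (j : c.Pt) : c.Pt := ⟨2 * c.size - 1 - j.val, by have := j.isLt; omega⟩

theorem cap_two (j q : c.Pt) :
    (capPt q = capPt j ∧ q.val % 2 ≠ j.val % 2) ↔ q = capOther j := by
  have hj := j.isLt
  have hq := q.isLt
  simp only [Fin.ext_iff, capPt_val, capOther]
  omega

/-- The canonical arc in each region. -/
def capRep (c : Col) (r : Fin (c.size + 1)) : c.Arc := ⟨r.val, by have := r.isLt; omega⟩

theorem capArc_capRep (r : Fin (c.size + 1)) : capArc (capRep c r) = r := by
  have hr := r.isLt
  apply Fin.ext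
  rw [capArc_val]
  show min r.val (2 * c.size - r.val) = r.val
  omega

/-- Every arc is the canonical one, or a string leads from it to the canonical one. -/
theorem cap_step (a : c.Arc) : a = capRep c (capArc a) ∨ ∃ p q : c.Pt, capPt p = capPt q ∧
    ((a = Col.whiteArc p ∧ capRep c (capArc a) = Col.whiteArc q) ∨
      (a = Col.blackArc p ∧ capRep c (capArc a) = Col.blackArc q)) := by
  have ha := a.isLt
  by_cases h : a.val ≤ c.size
  · left
    apply Fin.ext
    show a.val = min a.val (2 * c.size - a.val)
    omega
  · right
    refine ⟨⟨a.val, by omega⟩, ⟨2 * c.size - 1 - a.val, by omega⟩, ?_, ?_⟩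
    · apply Fin.ext
      simp only [capPt_val]
      omega
    · simp only [Fin.ext_iff, Col.whiteArc_val, Col.blackArc_val, capRep, capArc_val]
      split_ifs <;> omega

end Caps

theorem bool_mod (a b : ℕ) : ((a % 2 == 0) = !(b % 2 == 0)) ↔ a % 2 ≠ b % 2 := by
  rcases Nat.mod_two_eq_zero_or_one a with h | h <;>
    rcases Nat.mod_two_eq_zero_or_one b with h' | h' <;> simp [h, h']

theorem bool_mod' (a b : ℕ) : ((a % 2 == 1) = !(b % 2 == 1)) ↔ a % 2 ≠ b % 2 := by
  rcases Nat.mod_two_eq_zero_or_one a with h | h <;>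
    rcases Nat.mod_two_eq_zero_or_one b with h' | h' <;> simp [h, h']

/-- The tangle without internal discs whose strings connect the marked points `j` and
`2 n - 1 - j`: the multiplicative unit. -/
def unit (c : Col) : Tangle (fun i : Empty => (i.elim : Col)) c where
  Curve := Fin c.size
  Region := Fin (c.size + 1)
  finite_curve := inferInstance
  finite_region := inferInstance
  inCurve i := i.elim
  outCurve := capPt
  inRegion i := i.elim
  outRegion := capArc
  shaded r := c.shade r.val
  white := capWhite
  black := capBlack
  shaded_white := shade_capWhite
  shaded_black := shade_capBlack
  shaded_in i := i.elim
  shaded_out := shade_capArc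
  white_in i := i.elim
  black_in i := i.elim
  white_out := cap_white
  black_out := cap_black
  two_ends := by
    rintro (⟨⟨⟩, _⟩ | j)
    refine ⟨.inr (capOther j), ?_, ?_⟩
    · have := (cap_two j (capOther j)).2 rfl
      exact ⟨this.1, (bool_mod' _ _).2 this.2⟩
    · rintro (⟨⟨⟩, _⟩ | q) ⟨h1, h2⟩
      exact congrArg Sum.inr ((cap_two j q).1 ⟨h1, (bool_mod' _ _).1 h2⟩)
  connected := cap_connected
  euler := by
    rw [no_loops _ (fun x => ⟨.inr ⟨x.val, by have := x.isLt; omega⟩, by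
      have := x.isLt
      apply Fin.ext
      show min x.val (2 * c.size - 1 - x.val) = x.val
      omega⟩)]
    rw [card_circuits (N := c.size + 1)
        (fun a : Arcs (fun i : Empty => (i.elim : Col)) c =>
          match a with | .inl p => p.1.elim | .inr a => capArc a)
        (fun n => Sum.inr (capRep c n))]
    · simp; omega
    · rintro a b ⟨⟨⟨⟩, _⟩ | p, ⟨⟨⟩, _⟩ | q, h, h' | h'⟩
      · obtain ⟨rfl, rfl⟩ := h'
        show capArc (Col.whiteArc p) = capArc (Col.whiteArc q)
        rw [← cap_white, ← cap_white]
        exact congrArg _ h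
      · obtain ⟨rfl, rfl⟩ := h'
        show capArc (Col.blackArc p) = capArc (Col.blackArc q)
        rw [← cap_black, ← cap_black]
        exact congrArg _ h
    · exact capArc_capRep
    · rintro (⟨⟨⟩, _⟩ | a)
      rcases cap_step a with h | ⟨p, q, h, h'⟩
      · change Relation.EqvGen _ _ (Sum.inr (capRep c (capArc a)))
        rw [← h]
        exact .refl _
      · refine .rel _ _ ⟨.inr p, .inr q, h, ?_⟩
        rcases h' with h' | h'
        · exact .inl ⟨congrArg (fun z => Sum.inr z) h'.1, congrArg (fun z => Sum.inr z) h'.2⟩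
        · exact .inr ⟨congrArg (fun z => Sum.inr z) h'.1, congrArg (fun z => Sum.inr z) h'.2⟩

/-- The trace tangle: the marked points `j` and `2 n - 1 - j` of the internal disc are connected;
the external disc has no marked points. -/
def trace (n : ℕ) : Tangle (fun _ : Unit => Col.nat n) (Col.nat 0) where
  Curve := Fin (Col.nat n).size
  Region := Fin ((Col.nat n).size + 1)
  finite_curve := inferInstance
  finite_region := inferInstance
  inCurve _ := capPt
  outCurve j := j.elim0
  inRegion _ := capArc
  outRegion _ := 0
  shaded r := (Col.nat n).shade r.val
  white := capWhite
  black := capBlack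
  shaded_white := shade_capWhite
  shaded_black := shade_capBlack
  shaded_in _ := shade_capArc
  shaded_out a := by
    have : a.val = 0 := by
      have : a.val < 1 := a.isLt
      omega
    rw [this]; rfl
  white_in _ := cap_white
  black_in _ := cap_black
  white_out j := j.elim0
  black_out j := j.elim0
  two_ends := by
    rintro (⟨⟨⟩, j⟩ | j)
    · refine ⟨.inl ⟨(), capOther j⟩, ?_, ?_⟩
      · have := (cap_two j (capOther j)).2 rfl
        exact ⟨this.1, (bool_mod _ _).2 this.2⟩
      · rintro (⟨⟨⟩, q⟩ | q) ⟨h1, h2⟩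
        · rw [(cap_two j q).1 ⟨h1, (bool_mod _ _).1 h2⟩]
        · exact q.elim0
    · exact j.elim0
  connected := cap_connected
  euler := by
    rw [no_loops _ (fun x => ⟨.inl ⟨(), ⟨x.val, by have := x.isLt; show x.val < 2 * (Col.nat n).size; omega⟩⟩, by
      have := x.isLt
      apply Fin.ext
      show min x.val (2 * (Col.nat n).size - 1 - x.val) = x.val
      omega⟩)]
    rw [card_circuits (N := (Col.nat n).size + 1 + 1)
        (fun a => match a with | .inl a => (capArc a.2).castSucc | .inr _ => Fin.last _)
        (Fin.lastCases (Sum.inr ⟨0, by simp⟩) (fun r => Sum.inl ⟨(), capRep _ r⟩))]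
    · simp; omega
    · rintro a b ⟨⟨⟨⟩, p⟩ | p, ⟨⟨⟩, q⟩ | q, h, h'⟩
      · rcases h' with h' | h'
        · obtain ⟨rfl, rfl⟩ := h'
          show (capArc (Col.whiteArc p)).castSucc = (capArc (Col.whiteArc q)).castSucc
          rw [← cap_white, ← cap_white]
          exact congrArg (fun x => (capWhite x).castSucc) h
        · obtain ⟨rfl, rfl⟩ := h'
          show (capArc (Col.blackArc p)).castSucc = (capArc (Col.blackArc q)).castSucc
          rw [← cap_black, ← cap_black]
          exact congrArg (fun x => (capBlack x).castSucc) h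
      · exact q.elim0
      · exact p.elim0
      · exact p.elim0
    · intro r
      induction r using Fin.lastCases with
      | last => simp
      | cast r => simp [capArc_capRep]
    · rintro (⟨⟨⟩, a⟩ | a)
      · simp only [Fin.lastCases_castSucc]
        rcases cap_step a with h | ⟨p, q, h, h'⟩
        · rw [← h]
          exact .refl _
        · refine .rel _ _ ⟨.inl ⟨(), p⟩, .inl ⟨(), q⟩, h, ?_⟩
          let g : (Col.nat n).Arc → Arcs (fun _ : Unit => Col.nat n) (Col.nat 0) :=
            fun z => Sum.inl ⟨(), z⟩
          rcases h' with h' | h'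
          · exact .inl ⟨congrArg g h'.1, congrArg g h'.2⟩
          · exact .inr ⟨congrArg g h'.1, congrArg g h'.2⟩
      · have : a = ⟨0, by simp⟩ := by
          apply Fin.ext
          have : a.val < 1 := a.isLt
          show a.val = 0
          omega
        rw [this]
        simp only [Fin.lastCases_last]
        exact .refl _

/-- The tangle without internal discs and marked points that consists of one closed loop. -/
def loop (s : Bool) : Tangle (fun i : Empty => (i.elim : Col)) (Col.zero s) where
  Curve := Unit
  Region := Bool
  finite_curve := inferInstance
  finite_region := inferInstance
  inCurve i := i.elim
  outCurve j := by cases s <;> exact j.elim0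
  inRegion i := i.elim
  outRegion _ := s
  shaded := id
  white _ := false
  black _ := true
  shaded_white _ := rfl
  shaded_black _ := rfl
  shaded_in i := i.elim
  shaded_out a := by
    cases s
    · have : a.val = 0 := by
        have : a.val < 1 := a.isLt
        omega
      rw [this]; rfl
    · rfl
  white_in i := i.elim
  black_in i := i.elim
  white_out j := by cases s <;> exact j.elim0
  black_out j := by cases s <;> exact j.elim0
  two_ends := by
    rintro (⟨⟨⟩, _⟩ | j)
    cases s <;> exact j.elim0
  connected := by
    have h : Relation.EqvGen (fun r s : Bool => ∃ _ : Unit, false = r ∧ true = s) false true :=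
      .rel _ _ ⟨(), rfl, rfl⟩
    rintro (_ | _) (_ | _)
    · exact .refl _
    · exact h
    · exact .symm _ _ h
    · exact .refl _
  euler := by
    have h0 : IsEmpty (Ends (fun i : Empty => (i.elim : Col)) (Col.zero s)) := by
      refine ⟨?_⟩
      rintro (⟨⟨⟩, _⟩ | j)
      cases s <;> exact j.elim0
    have h1 : (Col.zero s).size = 0 := by cases s <;> rfl
    rw [card_circuits (N := 1) (fun _ => 0) (fun _ => .inr ⟨0, by omega⟩)]
    · have h2 : ∀ f : Ends (fun i : Empty => (i.elim : Col)) (Col.zero s) → Unit,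
          Nat.card {x : Unit // ∀ p, f p ≠ x} = 1 := by
        intro f
        rw [Nat.card_eq_one_iff_unique]
        exact ⟨inferInstance, ⟨⟨(), fun p => h0.elim p⟩⟩⟩
      rw [h2]
      simp
    · intro a b _; rfl
    · intro n; exact (Subsingleton.elim _ _)
    · rintro (⟨⟨⟩, _⟩ | a)
      have : a = ⟨0, by omega⟩ := by
        have := a.isLt
        apply Fin.ext
        show a.val = 0
        omega
      rw [this]
      exact .refl _

end Tangle

namespace Tangle

section Product

/-- The colours of two internal discs: the disc `false` comes first. -/
def pairCol (m n : ℕ) : Bool → Col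
  | false => Col.nat m
  | true => Col.nat n

/-- Labels of the strings of the multiplication tangle. The string at the external point `j` has
label `j`, the strings that connect the two internal discs have labels from `2 t` on. -/
def prodA (k m n t j : ℕ) : ℕ :=
  if j < m + t - n - k then j
  else if j < 2 * m - k then 2 * t + (j - (m + t - n - k))
  else j + 2 * t - 2 * m

def prodB (k m n t j : ℕ) : ℕ :=
  if j < m + n - k - t then 2 * t + (m + n - k - t) - 1 - j
  else if j < 2 * n - k then j + (m + t - n - k) - (m + n - k - t)
  else 2 * t + 2 * n + (m + n - k - t) - 1 - j

/-- Labels of the regions. The region at the external arc `a` has label `a`, the regions between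
the strings that connect the two internal discs have labels from `2 t` on. -/
def prodArcA (k m n t a : ℕ) : ℕ :=
  if a ≤ m + t - n - k then a
  else if a < 2 * m - k then 2 * t + (a - (m + t - n - k) - 1)
  else a + 2 * t - 2 * m

def prodArcB (k m n t a : ℕ) : ℕ :=
  if a < m + n - k - t then 2 * t + (m + n - k - t) - 1 - a
  else if a ≤ 2 * n - k then a + (m + t - n - k) - (m + n - k - t)
  else 2 * t + 2 * n + (m + n - k - t) - 1 - a

/-- The unshaded and the shaded side of the string with label `x`. -/
def prodWhite (k m n t x : ℕ) : ℕ :=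
  if x < 2 * t then (if x % 2 = 0 then x else if x + 1 < 2 * t then x + 1 else 0)
  else prodArcA k m n t (if (x - 2 * t + (m + t - n - k)) % 2 = 0 then
    x - 2 * t + (m + t - n - k) else x - 2 * t + (m + t - n - k) + 1)

def prodBlack (k m n t x : ℕ) : ℕ :=
  if x < 2 * t then (if x % 2 = 0 then x + 1 else x)
  else prodArcA k m n t (if (x - 2 * t + (m + t - n - k)) % 2 = 0 then
    x - 2 * t + (m + t - n - k) + 1 else x - 2 * t + (m + t - n - k))

/-- The possible components of a product: `|m - n| + k ≤ t ≤ m + n - k`, for `1 ≤ k ≤ m, n`. -/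
structure ProdRange (k m n t : ℕ) : Prop where
  pos : 1 ≤ k
  le_left : k ≤ m
  le_right : k ≤ n
  left_le : m + k ≤ n + t
  right_le : n + k ≤ m + t
  le_add : t + k ≤ m + n

variable {k m n t : ℕ}

/-- The numbers of strings and of regions. -/
abbrev prodC (m n t : ℕ) : ℕ := m + n + t
abbrev prodR (m n t : ℕ) : ℕ := m + n + t - 1

theorem ProdRange.arc_lt_left (h : ProdRange k m n t) (a : (Col.nat m).Arc) :
    a.val < 2 * m := by
  have h1 := h.pos
  have h2 := h.le_left
  have h3 : a.val < max 1 (2 * m) := a.isLt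
  omega

theorem ProdRange.arc_lt_right (h : ProdRange k m n t) (a : (Col.nat n).Arc) :
    a.val < 2 * n := by
  have h1 := h.pos
  have h2 := h.le_right
  have h3 : a.val < max 1 (2 * n) := a.isLt
  omega

theorem ProdRange.arc_lt_out (h : ProdRange k m n t) (a : (Col.nat t).Arc) :
    a.val < 2 * t := by
  have h1 := h.pos
  have h2 := h.left_le
  have h4 := h.right_le
  have h3 : a.val < max 1 (2 * t) := a.isLt
  omega

theorem mod_beq_zero (a b : ℕ) : ((a % 2 == 0) = (b % 2 == 0)) ↔ a % 2 = b % 2 := by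
  rcases Nat.mod_two_eq_zero_or_one a with h | h <;>
    rcases Nat.mod_two_eq_zero_or_one b with h' | h' <;> simp [h, h']

theorem mod_beq_zero_one (a b : ℕ) : ((a % 2 == 0) = (b % 2 == 1)) ↔ a % 2 ≠ b % 2 := by
  rcases Nat.mod_two_eq_zero_or_one a with h | h <;>
    rcases Nat.mod_two_eq_zero_or_one b with h' | h' <;> simp [h, h']

/-- The shading of the region with label `r`. -/
def prodShade (k m n t r : ℕ) : Bool :=
  if r < 2 * t then r % 2 == 1 else (r - 2 * t + (m + t - n - k) + 1) % 2 == 1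

/-- The unshaded and the shaded arc next to the point `j`, for a disc with `2 N` points. -/
def wv (N j : ℕ) : ℕ := if j % 2 = 0 then j else if j + 1 < 2 * N then j + 1 else 0

def bv (j : ℕ) : ℕ := if j % 2 = 0 then j + 1 else j

theorem prodA_lt (h : ProdRange k m n t) {j : ℕ} (hj : j < 2 * m) : prodA k m n t j < m + n + t := by
  obtain ⟨h1, h2, h3, h4, h5, h6⟩ := h
  unfold prodA; split_ifs <;> omega

theorem prodB_lt (h : ProdRange k m n t) {j : ℕ} (hj : j < 2 * n) : prodB k m n t j < m + n + t := by
  obtain ⟨h1, h2, h3, h4, h5, h6⟩ := h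
  unfold prodB; split_ifs <;> omega

theorem prodOut_lt (h : ProdRange k m n t) {j : ℕ} (hj : j < 2 * t) : j < m + n + t := by
  obtain ⟨h1, h2, h3, h4, h5, h6⟩ := h
  omega

theorem prodArcA_lt (h : ProdRange k m n t) {a : ℕ} (ha : a < 2 * m) : prodArcA k m n t a < m + n + t - 1 := by
  obtain ⟨h1, h2, h3, h4, h5, h6⟩ := h
  unfold prodArcA; split_ifs <;> omega

theorem prodArcB_lt (h : ProdRange k m n t) {a : ℕ} (ha : a < 2 * n) : prodArcB k m n t a < m + n + t - 1 := by
  obtain ⟨h1, h2, h3, h4, h5, h6⟩ := h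
  unfold prodArcB; split_ifs <;> omega

theorem prodArcOut_lt (h : ProdRange k m n t) {j : ℕ} (hj : j < 2 * t) : j < m + n + t - 1 := by
  obtain ⟨h1, h2, h3, h4, h5, h6⟩ := h
  omega

theorem prodWhite_lt (h : ProdRange k m n t) {x : ℕ} (hx : x < m + n + t) : prodWhite k m n t x < m + n + t - 1 := by
  have hA := @prodArcA_lt _ _ _ _ h
  obtain ⟨h1, h2, h3, h4, h5, h6⟩ := h
  unfold prodWhite
  split_ifs <;> first | omega | (apply hA; omega)

theorem prodBlack_lt (h : ProdRange k m n t) {x : ℕ} (hx : x < m + n + t) : prodBlack k m n t x < m + n + t - 1 := by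
  have hA := @prodArcA_lt _ _ _ _ h
  obtain ⟨h1, h2, h3, h4, h5, h6⟩ := h
  unfold prodBlack
  split_ifs <;> first | omega | (apply hA; omega)

theorem prodShadeA (h : ProdRange k m n t) {a : ℕ} (ha : a < 2 * m) :
    prodShade k m n t (prodArcA k m n t a) = (a % 2 == 1) := by
  obtain ⟨h1, h2, h3, h4, h5, h6⟩ := h
  unfold prodShade prodArcA
  rw [Bool.eq_iff_iff]
  split_ifs <;> simp only [beq_iff_eq] <;> omega

theorem prodShadeB (h : ProdRange k m n t) {a : ℕ} (ha : a < 2 * n) :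
    prodShade k m n t (prodArcB k m n t a) = (a % 2 == 1) := by
  obtain ⟨h1, h2, h3, h4, h5, h6⟩ := h
  unfold prodShade prodArcB
  rw [Bool.eq_iff_iff]
  split_ifs <;> simp only [beq_iff_eq] <;> omega

theorem prodShadeOut {a : ℕ} (ha : a < 2 * t) : prodShade k m n t a = (a % 2 == 1) := by
  unfold prodShade
  rw [if_pos ha]

theorem prodShadeWhite (h : ProdRange k m n t) {x : ℕ} (hx : x < m + n + t) :
    prodShade k m n t (prodWhite k m n t x) = false := by
  have hA := @prodShadeA _ _ _ _ h
  obtain ⟨h1, h2, h3, h4, h5, h6⟩ := h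
  unfold prodWhite
  split_ifs <;>
    first
    | (rw [prodShadeOut (by omega), beq_eq_false_iff_ne]; omega)
    | (rw [hA (by omega), beq_eq_false_iff_ne]; omega)

theorem prodShadeBlack (h : ProdRange k m n t) {x : ℕ} (hx : x < m + n + t) :
    prodShade k m n t (prodBlack k m n t x) = true := by
  have hA := @prodShadeA _ _ _ _ h
  obtain ⟨h1, h2, h3, h4, h5, h6⟩ := h
  unfold prodBlack
  split_ifs <;>
    first
    | (rw [prodShadeOut (by omega), beq_iff_eq]; omega)
    | (rw [hA (by omega), beq_iff_eq]; omega)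

theorem prodWhite_join {y : ℕ} (hy : m + t - n - k ≤ y) :
    prodWhite k m n t (2 * t + (y - (m + t - n - k))) =
      prodArcA k m n t (if y % 2 = 0 then y else y + 1) := by
  unfold prodWhite
  rw [if_neg (by omega), show 2 * t + (y - (m + t - n - k)) - 2 * t + (m + t - n - k) = y by omega]

theorem prodBlack_join {y : ℕ} (hy : m + t - n - k ≤ y) :
    prodBlack k m n t (2 * t + (y - (m + t - n - k))) =
      prodArcA k m n t (if y % 2 = 0 then y + 1 else y) := by
  unfold prodBlack
  rw [if_neg (by omega), show 2 * t + (y - (m + t - n - k)) - 2 * t + (m + t - n - k) = y by omega]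

theorem prodWhite_low {x : ℕ} (hx : x < 2 * t) : prodWhite k m n t x = wv t x := by
  unfold prodWhite wv
  rw [if_pos hx]

theorem prodBlack_low {x : ℕ} (hx : x < 2 * t) : prodBlack k m n t x = bv x := by
  unfold prodBlack bv
  rw [if_pos hx]

/-- For matching points on two discs whose adjacent arcs have matching labels, the labels of the
unshaded and of the shaded arcs match. -/
theorem sides_congr {N i j : ℕ} (f : ℕ → ℕ) (p : i % 2 = j % 2) (hN : j + 1 < 2 * N ∨ j + 1 = 2 * N)
    {M : ℕ} (h0 : f i = j) (h1 : j + 1 < 2 * N → i + 1 < 2 * M ∧ f (i + 1) = j + 1)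
    (h2 : j + 1 = 2 * N → i + 1 = 2 * M ∧ f 0 = 0) :
    wv N j = f (wv M i) ∧ bv j = f (bv i) := by
  unfold wv bv
  rw [← p]
  by_cases hi : i % 2 = 0
  · rw [if_pos hi, if_pos hi, if_pos hi, if_pos hi]
    refine ⟨h0.symm, (h1 ?_).2.symm⟩
    omega
  · rw [if_neg hi, if_neg hi, if_neg hi, if_neg hi]
    refine ⟨?_, h0.symm⟩
    rcases hN with hN | hN
    · rw [if_pos hN, if_pos (h1 hN).1, (h1 hN).2]
    · rw [if_neg (by omega), if_neg (by have := (h2 hN).1; omega), (h2 hN).2]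

theorem prodSidesA (h : ProdRange k m n t) {j : ℕ} (hj : j < 2 * m) :
    prodWhite k m n t (prodA k m n t j) = prodArcA k m n t (wv m j) ∧
      prodBlack k m n t (prodA k m n t j) = prodArcA k m n t (bv j) := by
  obtain ⟨h1, h2, h3, h4, h5, h6⟩ := h
  by_cases hc : m + t - n - k ≤ j ∧ j < 2 * m - k
  · rw [show prodA k m n t j = 2 * t + (j - (m + t - n - k)) by
      unfold prodA; rw [if_neg (by omega), if_pos (by omega)], prodWhite_join hc.1,
      prodBlack_join hc.1]
    refine ⟨?_, rfl⟩
    unfold wv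
    rw [if_pos (show j + 1 < 2 * m by omega)]
  · by_cases h7 : j < m + t - n - k
    · have e : prodA k m n t j = j := by unfold prodA; rw [if_pos h7]
      rw [e, prodWhite_low (by omega), prodBlack_low (by omega)]
      refine sides_congr _ rfl (.inl (by omega)) ?_ (fun _ => ⟨by omega, ?_⟩) (fun _ => by omega)
      · unfold prodArcA; rw [if_pos (by omega)]
      · unfold prodArcA; rw [if_pos (by omega)]
    · have e : prodA k m n t j = j + 2 * t - 2 * m := by
        unfold prodA; rw [if_neg (by omega), if_neg (by omega)]
      rw [e, prodWhite_low (by omega), prodBlack_low (by omega)]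
      refine sides_congr _ (by omega) (by omega) ?_ (fun _ => ⟨by omega, ?_⟩)
        (fun _ => ⟨by omega, ?_⟩)
      · unfold prodArcA; rw [if_neg (by omega), if_neg (by omega)]
      · unfold prodArcA; rw [if_neg (by omega), if_neg (by omega)]; omega
      · unfold prodArcA; rw [if_pos (by omega)]

/-- The arcs adjacent to the two ends of a string that connects the two internal discs. -/
theorem prodJoin (h : ProdRange k m n t) {y j : ℕ} (hy : m + t - n - k ≤ y) (hj : j < 2 * n)
    (hxy : j < m + n - k - t ∧ y + j + 1 = m + t - n - k + (m + n - k - t) ∨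
      2 * n - k ≤ j ∧ y + j + 1 = m + t - n - k + (m + n - k - t) + 2 * n) :
    prodArcA k m n t (y + 1) = prodArcB k m n t j ∧
      prodArcA k m n t y = prodArcB k m n t (if j + 1 < 2 * n then j + 1 else 0) := by
  obtain ⟨h1, h2, h3, h4, h5, h6⟩ := h
  rcases hxy with ⟨hp, hxy⟩ | ⟨hp, hxy⟩
  · rw [if_pos (by omega)]
    constructor
    · unfold prodArcA prodArcB
      rw [if_neg (by omega), if_pos (by omega), if_pos hp]
      omega
    · by_cases h7 : j + 1 < m + n - k - t
      · unfold prodArcA prodArcB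
        rw [if_neg (by omega), if_pos (by omega), if_pos h7]
        omega
      · unfold prodArcA prodArcB
        rw [if_pos (by omega), if_neg h7, if_pos (by omega)]
        omega
  · constructor
    · by_cases h7 : j = 2 * n - k
      · unfold prodArcA prodArcB
        rw [if_neg (by omega), if_neg (by omega), if_neg (by omega), if_pos (by omega)]
        omega
      · unfold prodArcA prodArcB
        rw [if_neg (by omega), if_pos (by omega), if_neg (by omega), if_neg (by omega)]
        omega
    · by_cases h7 : j + 1 < 2 * n
      · rw [if_pos h7]
        unfold prodArcA prodArcB
        rw [if_neg (by omega), if_pos (by omega), if_neg (by omega), if_neg (by omega)]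
        omega
      · rw [if_neg h7]
        by_cases h8 : 0 < m + n - k - t
        · unfold prodArcA prodArcB
          rw [if_neg (by omega), if_pos (by omega), if_pos h8]
          omega
        · unfold prodArcA prodArcB
          rw [if_pos (by omega), if_neg h8, if_pos (by omega)]
          omega

theorem prodSidesB (h : ProdRange k m n t) {j : ℕ} (hj : j < 2 * n) :
    prodWhite k m n t (prodB k m n t j) = prodArcB k m n t (wv n j) ∧
      prodBlack k m n t (prodB k m n t j) = prodArcB k m n t (bv j) := by
  have hJ := fun y hy hxy => prodJoin h (y := y) hy hj hxy
  obtain ⟨h1, h2, h3, h4, h5, h6⟩ := h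
  by_cases hc : m + n - k - t ≤ j ∧ j < 2 * n - k
  · have e : prodB k m n t j = j + (m + t - n - k) - (m + n - k - t) := by
      unfold prodB; rw [if_neg (by omega), if_pos (by omega)]
    rw [e, prodWhite_low (by omega), prodBlack_low (by omega)]
    refine sides_congr _ (by omega) (.inl (by omega)) ?_ (fun _ => ⟨by omega, ?_⟩)
      (fun _ => by omega)
    · unfold prodArcB; rw [if_neg (by omega), if_pos (by omega)]
    · unfold prodArcB; rw [if_neg (by omega), if_pos (by omega)]; omega
  · obtain ⟨y, hy, hy', hxy⟩ : ∃ y, m + t - n - k ≤ y ∧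
        prodB k m n t j = 2 * t + (y - (m + t - n - k)) ∧
        (j < m + n - k - t ∧ y + j + 1 = m + t - n - k + (m + n - k - t) ∨
          2 * n - k ≤ j ∧ y + j + 1 = m + t - n - k + (m + n - k - t) + 2 * n) := by
      by_cases hj' : j < m + n - k - t
      · refine ⟨m + t - n - k + (m + n - k - t) - 1 - j, by omega, ?_, .inl ⟨hj', by omega⟩⟩
        unfold prodB; rw [if_pos hj']; omega
      · refine ⟨m + t - n - k + (m + n - k - t) + 2 * n - 1 - j, by omega, ?_,
          .inr ⟨by omega, by omega⟩⟩
        unfold prodB; rw [if_neg hj', if_neg (by omega)]; omega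
    obtain ⟨e1, e2⟩ := hJ y hy hxy
    rw [hy', prodWhite_join hy, prodBlack_join hy]
    have hpar : y % 2 ≠ j % 2 := by omega
    unfold wv bv
    by_cases hjp : j % 2 = 0
    · have hyp : ¬ y % 2 = 0 := by omega
      simp only [if_neg hyp, if_pos hjp]
      exact ⟨e1, e2.trans (by rw [if_pos (by omega)])⟩
    · have hyp : y % 2 = 0 := by omega
      simp only [if_pos hyp, if_neg hjp]
      exact ⟨e2, e1⟩

/-- Two ends with the same label and the same orientation agree. -/
theorem prodA_inj (h : ProdRange k m n t) {i j : ℕ} (hi : i < 2 * m) (hj : j < 2 * m)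
    (e : prodA k m n t i = prodA k m n t j) : i = j := by
  obtain ⟨h1, h2, h3, h4, h5, h6⟩ := h
  unfold prodA at e
  split_ifs at e <;> omega

theorem prodB_inj (h : ProdRange k m n t) {i j : ℕ} (hi : i < 2 * n) (hj : j < 2 * n)
    (e : prodB k m n t i = prodB k m n t j) : i = j := by
  obtain ⟨h1, h2, h3, h4, h5, h6⟩ := h
  unfold prodB at e
  split_ifs at e <;> omega

theorem prodAB_parity (h : ProdRange k m n t) {i j : ℕ} (hi : i < 2 * m) (hj : j < 2 * n)
    (e : prodA k m n t i = prodB k m n t j) : i % 2 ≠ j % 2 := by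
  obtain ⟨h1, h2, h3, h4, h5, h6⟩ := h
  unfold prodA prodB at e
  split_ifs at e <;> omega

theorem prodA_parity (h : ProdRange k m n t) {i j : ℕ} (hj : j < 2 * t)
    (e : prodA k m n t i = j) : i % 2 = j % 2 := by
  obtain ⟨h1, h2, h3, h4, h5, h6⟩ := h
  unfold prodA at e
  split_ifs at e <;> omega

theorem prodB_parity (h : ProdRange k m n t) {i j : ℕ} (hi : i < 2 * n) (hj : j < 2 * t)
    (e : prodB k m n t i = j) : i % 2 = j % 2 := by
  obtain ⟨h1, h2, h3, h4, h5, h6⟩ := h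
  unfold prodB at e
  split_ifs at e <;> omega

/-- Every string has two ends. -/
theorem prodA_cover (h : ProdRange k m n t) {x : ℕ} (hx : x < m + n + t) :
    (x < 2 * t ∧ ((∃ i < 2 * m, prodA k m n t i = x) ∨ ∃ j < 2 * n, prodB k m n t j = x)) ∨
      ((∃ i < 2 * m, prodA k m n t i = x) ∧ ∃ j < 2 * n, prodB k m n t j = x) := by
  obtain ⟨h1, h2, h3, h4, h5, h6⟩ := h
  by_cases hc : x < 2 * t
  · left
    refine ⟨hc, ?_⟩
    by_cases h7 : x < m + t - n - k
    · left
      refine ⟨x, by omega, ?_⟩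
      unfold prodA; rw [if_pos h7]
    · by_cases h8 : x < 2 * t - k
      · right
        refine ⟨x - (m + t - n - k) + (m + n - k - t), by omega, ?_⟩
        unfold prodB; rw [if_neg (by omega), if_pos (by omega)]; omega
      · left
        refine ⟨x + 2 * m - 2 * t, by omega, ?_⟩
        unfold prodA; rw [if_neg (by omega), if_neg (by omega)]; omega
  · right
    refine ⟨⟨x - 2 * t + (m + t - n - k), by omega, ?_⟩, ?_⟩
    · unfold prodA; rw [if_neg (by omega), if_pos (by omega)]; omega
    · by_cases h7 : x - 2 * t < m + n - k - t
      · refine ⟨m + n - k - t - 1 - (x - 2 * t), by omega, ?_⟩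
        unfold prodB; rw [if_pos (by omega)]; omega
      · refine ⟨2 * n + (m + n - k - t) - 1 - (x - 2 * t), by omega, ?_⟩
        unfold prodB; rw [if_neg (by omega), if_neg (by omega)]; omega

theorem prod_connected_aux (h : ProdRange k m n t) {r : ℕ} (hr : r < m + n + t - 1)
    (h0 : r ≠ 0) : ∃ s < r, ∃ x < m + n + t,
      (prodWhite k m n t x = r ∧ prodBlack k m n t x = s) ∨
      (prodWhite k m n t x = s ∧ prodBlack k m n t x = r) := by
  obtain ⟨h1, h2, h3, h4, h5, h6⟩ := h
  by_cases hc : r < 2 * t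
  · refine ⟨r - 1, by omega, r - 1, by omega, ?_⟩
    rw [prodWhite_low (by omega), prodBlack_low (by omega)]
    unfold wv bv
    split_ifs <;> omega
  · refine ⟨if r = 2 * t then m + t - n - k else r - 1, by split_ifs <;> omega, r, by omega, ?_⟩
    have e : r = 2 * t + ((r - 2 * t + (m + t - n - k)) - (m + t - n - k)) := by omega
    have e1 := prodWhite_join (k := k) (m := m) (n := n) (t := t)
      (y := r - 2 * t + (m + t - n - k)) (by omega)
    have e2 := prodBlack_join (k := k) (m := m) (n := n) (t := t)
      (y := r - 2 * t + (m + t - n - k)) (by omega)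
    rw [← e] at e1 e2
    have e3 : prodArcA k m n t (r - 2 * t + (m + t - n - k)) =
        if r = 2 * t then m + t - n - k else r - 1 := by
      unfold prodArcA
      split_ifs <;> omega
    have e4 : prodArcA k m n t (r - 2 * t + (m + t - n - k) + 1) = r := by
      unfold prodArcA
      rw [if_neg (by omega), if_pos (by omega)]
      omega
    rw [e1, e2]
    by_cases hp : (r - 2 * t + (m + t - n - k)) % 2 = 0
    · rw [if_pos hp, if_pos hp, e3, e4]
      exact .inr ⟨rfl, rfl⟩
    · rw [if_neg hp, if_neg hp, e3, e4]
      exact .inl ⟨rfl, rfl⟩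

theorem sides_before {N M i j : ℕ} (h : i % 2 = j % 2) :
    (i = wv N i ∧ j = wv M j) ∨ (i = bv i ∧ j = bv j) := by
  unfold wv bv
  split_ifs <;> omega

theorem sides_after {N M i j : ℕ} (h : i % 2 = j % 2) (hi : i + 1 < 2 * N) (hj : j + 1 < 2 * M) :
    (i + 1 = wv N i ∧ j + 1 = wv M j) ∨ (i + 1 = bv i ∧ j + 1 = bv j) := by
  unfold wv bv
  split_ifs <;> omega

theorem sides_mixed {N M i j : ℕ} (h : i % 2 ≠ j % 2) (hj : j + 1 < 2 * M) :
    (i = wv N i ∧ j + 1 = wv M j) ∨ (i = bv i ∧ j + 1 = bv j) := by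
  unfold wv bv
  split_ifs <;> omega

/-- The arc of an internal disc next to an outer region, and the points which lead to the
external arc. -/
theorem prodStepA (h : ProdRange k m n t) {a : ℕ} (ha : a < 2 * m)
    (hr : prodArcA k m n t a < 2 * t) : ∃ i < 2 * m, ∃ j < 2 * t, prodA k m n t i = j ∧
      ((a = wv m i ∧ prodArcA k m n t a = wv t j) ∨ (a = bv i ∧ prodArcA k m n t a = bv j)) := by
  obtain ⟨h1, h2, h3, h4, h5, h6⟩ := h
  by_cases h7 : a < m + t - n - k
  · have e : prodArcA k m n t a = a := by unfold prodArcA; rw [if_pos (by omega)]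
    refine ⟨a, ha, a, by omega, ?_, ?_⟩
    · unfold prodA; rw [if_pos h7]
    · rw [e]; exact sides_before rfl
  by_cases h8 : a = m + t - n - k
  · have e : prodArcA k m n t a = a := by unfold prodArcA; rw [if_pos (by omega)]
    by_cases h9 : a = 0
    · refine ⟨2 * m - 1, by omega, 2 * t - 1, by omega, ?_, ?_⟩
      · unfold prodA; rw [if_neg (by omega), if_neg (by omega)]; omega
      · rw [e]
        left
        unfold wv
        rw [if_neg (by omega), if_neg (by omega), if_neg (by omega), if_neg (by omega)]
        exact ⟨h9, h9⟩
    · obtain ⟨i, rfl⟩ : ∃ i, a = i + 1 := ⟨a - 1, by omega⟩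
      refine ⟨i, by omega, i, by omega, ?_, ?_⟩
      · unfold prodA; rw [if_pos (by omega)]
      · rw [e]; exact sides_after rfl (by omega) (by omega)
  by_cases h9 : a < 2 * m - k
  · exfalso
    unfold prodArcA at hr
    rw [if_neg (by omega), if_pos h9] at hr
    omega
  · have e : prodArcA k m n t a = a + 2 * t - 2 * m := by
      unfold prodArcA; rw [if_neg (by omega), if_neg (by omega)]
    refine ⟨a, ha, a + 2 * t - 2 * m, by omega, ?_, ?_⟩
    · unfold prodA; rw [if_neg (by omega), if_neg (by omega)]
    · rw [e]; exact sides_before (by omega)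

theorem prodStepB (h : ProdRange k m n t) {a : ℕ} (ha : a < 2 * n)
    (hr : prodArcB k m n t a < 2 * t) : ∃ i < 2 * n, ∃ j < 2 * t, prodB k m n t i = j ∧
      ((a = wv n i ∧ prodArcB k m n t a = wv t j) ∨ (a = bv i ∧ prodArcB k m n t a = bv j)) := by
  obtain ⟨h1, h2, h3, h4, h5, h6⟩ := h
  by_cases h7 : a < m + n - k - t
  · exfalso
    unfold prodArcB at hr
    rw [if_pos h7] at hr
    omega
  by_cases h8 : a < 2 * n - k
  · have e : prodArcB k m n t a = a + (m + t - n - k) - (m + n - k - t) := by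
      unfold prodArcB; rw [if_neg (by omega), if_pos (by omega)]
    refine ⟨a, ha, a + (m + t - n - k) - (m + n - k - t), by omega, ?_, ?_⟩
    · unfold prodB; rw [if_neg (by omega), if_pos h8]
    · rw [e]; exact sides_before (by omega)
  by_cases h9 : a = 2 * n - k
  · obtain ⟨i, rfl⟩ : ∃ i, a = i + 1 := ⟨a - 1, by omega⟩
    have e : prodArcB k m n t (i + 1) = i + (m + t - n - k) - (m + n - k - t) + 1 := by
      unfold prodArcB; rw [if_neg (by omega), if_pos (by omega)]; omega
    refine ⟨i, by omega, i + (m + t - n - k) - (m + n - k - t), by omega, ?_, ?_⟩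
    · unfold prodB; rw [if_neg (by omega), if_pos (by omega)]
    · rw [e]; exact sides_after (by omega) (by omega) (by omega)
  · exfalso
    unfold prodArcB at hr
    rw [if_neg (by omega), if_neg (by omega)] at hr
    omega

theorem prodStepBA (h : ProdRange k m n t) {a : ℕ} (ha : a < 2 * n)
    (hr : ¬ prodArcB k m n t a < 2 * t) : ∃ i < 2 * n, ∃ j < 2 * m,
      prodB k m n t i = prodA k m n t j ∧
      ((a = wv n i ∧ prodArcB k m n t a - 2 * t + (m + t - n - k) + 1 = wv m j) ∨
        (a = bv i ∧ prodArcB k m n t a - 2 * t + (m + t - n - k) + 1 = bv j)) := by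
  obtain ⟨h1, h2, h3, h4, h5, h6⟩ := h
  by_cases h7 : a < m + n - k - t
  · have e : prodArcB k m n t a - 2 * t + (m + t - n - k) + 1 =
        (m + t - n - k) + (m + n - k - t) - 1 - a + 1 := by
      unfold prodArcB; rw [if_pos h7]; omega
    refine ⟨a, ha, (m + t - n - k) + (m + n - k - t) - 1 - a, by omega, ?_, ?_⟩
    · unfold prodB prodA; rw [if_pos h7, if_neg (by omega), if_pos (by omega)]; omega
    · rw [e]; exact sides_mixed (by omega) (by omega)
  by_cases h8 : a ≤ 2 * n - k
  · exfalso
    unfold prodArcB at hr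
    rw [if_neg (by omega), if_pos h8] at hr
    omega
  · have e : prodArcB k m n t a - 2 * t + (m + t - n - k) + 1 =
        (m + t - n - k) + 2 * n + (m + n - k - t) - 1 - a + 1 := by
      unfold prodArcB; rw [if_neg (by omega), if_neg (by omega)]; omega
    refine ⟨a, ha, (m + t - n - k) + 2 * n + (m + n - k - t) - 1 - a, by omega, ?_, ?_⟩
    · unfold prodB prodA
      rw [if_neg (by omega), if_neg (by omega), if_neg (by omega), if_pos (by omega)]; omega
    · rw [e]; exact sides_mixed (by omega) (by omega)

/-- The canonical arc on the first disc in an inner region. -/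
theorem prodRep (h : ProdRange k m n t) {r : ℕ} (hr : r < m + n + t - 1) (hr' : ¬ r < 2 * t) :
    r - 2 * t + (m + t - n - k) + 1 < 2 * m ∧
      prodArcA k m n t (r - 2 * t + (m + t - n - k) + 1) = r := by
  obtain ⟨h1, h2, h3, h4, h5, h6⟩ := h
  refine ⟨by omega, ?_⟩
  unfold prodArcA
  rw [if_neg (by omega), if_pos (by omega)]
  omega

theorem prodRep_eq (h : ProdRange k m n t) {a : ℕ} (ha : a < 2 * m)
    (hr : ¬ prodArcA k m n t a < 2 * t) :
    prodArcA k m n t a - 2 * t + (m + t - n - k) + 1 = a := by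
  obtain ⟨h1, h2, h3, h4, h5, h6⟩ := h
  unfold prodArcA at hr ⊢
  split_ifs at hr ⊢ <;> omega

theorem whiteArc_wv {c : Col} (j : c.Pt) : (Col.whiteArc j).val = wv c.size j.val :=
  Col.whiteArc_val j

theorem blackArc_bv {c : Col} (j : c.Pt) : (Col.blackArc j).val = bv j.val :=
  Col.blackArc_val j

variable {ι X : Type} {c : ι → Col} {c₀ : Col}

theorem step_in_out (e : Ends c c₀ → X) (i : ι) (p : (c i).Pt) (q : c₀.Pt)
    (he : e (.inl ⟨i, p⟩) = e (.inr q)) (a : (c i).Arc) (b : c₀.Arc)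
    (h : (a.val = wv (c i).size p.val ∧ b.val = wv c₀.size q.val) ∨
      (a.val = bv p.val ∧ b.val = bv q.val)) :
    Relation.EqvGen (ArcStep e) (.inl ⟨i, a⟩) (.inr b) := by
  refine .rel _ _ ⟨_, _, he, ?_⟩
  rw [← whiteArc_wv, ← whiteArc_wv, ← blackArc_bv, ← blackArc_bv] at h
  rcases h with ⟨h1, h2⟩ | ⟨h1, h2⟩
  · left
    rw [Fin.ext h1, Fin.ext h2]
    exact ⟨rfl, rfl⟩
  · right
    rw [Fin.ext h1, Fin.ext h2]
    exact ⟨rfl, rfl⟩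

theorem step_in_in (e : Ends c c₀ → X) (i i' : ι) (p : (c i).Pt) (q : (c i').Pt)
    (he : e (.inl ⟨i, p⟩) = e (.inl ⟨i', q⟩)) (a : (c i).Arc) (b : (c i').Arc)
    (h : (a.val = wv (c i).size p.val ∧ b.val = wv (c i').size q.val) ∨
      (a.val = bv p.val ∧ b.val = bv q.val)) :
    Relation.EqvGen (ArcStep e) (.inl ⟨i, a⟩) (.inl ⟨i', b⟩) := by
  refine .rel _ _ ⟨_, _, he, ?_⟩
  rw [← whiteArc_wv, ← whiteArc_wv, ← blackArc_bv, ← blackArc_bv] at h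
  rcases h with ⟨h1, h2⟩ | ⟨h1, h2⟩
  · left
    rw [Fin.ext h1, Fin.ext h2]
    exact ⟨rfl, rfl⟩
  · right
    rw [Fin.ext h1, Fin.ext h2]
    exact ⟨rfl, rfl⟩

/-- A string has one end of each kind, provided that the label and the kind determine the end and
that there is an end of each kind. -/
theorem two_ends_of (e : Ends c c₀ → X)
    (inj : ∀ p q, e p = e q → isSource p = isSource q → p = q)
    (ex : ∀ p, ∃ q, q ≠ p ∧ e q = e p) (p : Ends c c₀) :
    ∃! q, e q = e p ∧ isSource q = !isSource p := by
  obtain ⟨q, hq, hq'⟩ := ex p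
  have hs : isSource q = !isSource p := by
    have : isSource q ≠ isSource p := fun hs => hq (inj _ _ hq' hs)
    revert this
    cases isSource q <;> cases isSource p <;> simp
  exact ⟨q, ⟨hq', hs⟩, fun r hr => inj _ _ (hr.1.trans hq'.symm) (hr.2.trans hs.symm)⟩

/-- The label of the string at a marked point, and of the region at a boundary arc. -/
def prodEnd (h : ProdRange k m n t) : Ends (pairCol m n) (Col.nat t) → Fin (m + n + t)
  | .inl ⟨false, j⟩ => ⟨prodA k m n t j.val, prodA_lt h j.isLt⟩
  | .inl ⟨true, j⟩ => ⟨prodB k m n t j.val, prodB_lt h j.isLt⟩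
  | .inr j => ⟨j.val, prodOut_lt h j.isLt⟩

def prodReg (h : ProdRange k m n t) : Arcs (pairCol m n) (Col.nat t) → Fin (m + n + t - 1)
  | .inl ⟨false, a⟩ => ⟨prodArcA k m n t a.val, prodArcA_lt h (h.arc_lt_left a)⟩
  | .inl ⟨true, a⟩ => ⟨prodArcB k m n t a.val, prodArcB_lt h (h.arc_lt_right a)⟩
  | .inr a => ⟨a.val, prodArcOut_lt h (h.arc_lt_out a)⟩

theorem prodReg_white (h : ProdRange k m n t) (p : Ends (pairCol m n) (Col.nat t)) :
    (prodReg h (endWhite p)).val = prodWhite k m n t (prodEnd h p).val := by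
  rcases p with ⟨_ | _, p⟩ | p
  · exact ((prodSidesA h p.isLt).1.trans (congrArg (prodArcA k m n t) (whiteArc_wv p).symm)).symm
  · exact ((prodSidesB h p.isLt).1.trans (congrArg (prodArcB k m n t) (whiteArc_wv p).symm)).symm
  · exact ((prodWhite_low p.isLt).trans (whiteArc_wv p).symm).symm

theorem prodReg_black (h : ProdRange k m n t) (p : Ends (pairCol m n) (Col.nat t)) :
    (prodReg h (endBlack p)).val = prodBlack k m n t (prodEnd h p).val := by
  rcases p with ⟨_ | _, p⟩ | p
  · exact ((prodSidesA h p.isLt).2.trans (congrArg (prodArcA k m n t) (blackArc_bv p).symm)).symm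
  · exact ((prodSidesB h p.isLt).2.trans (congrArg (prodArcB k m n t) (blackArc_bv p).symm)).symm
  · exact ((prodBlack_low p.isLt).trans (blackArc_bv p).symm).symm

theorem prodReg_shade (h : ProdRange k m n t) (a : Arcs (pairCol m n) (Col.nat t)) :
    prodShade k m n t (prodReg h a).val =
      match a with
      | .inl a => (pairCol m n a.1).shade a.2.val
      | .inr a => (Col.nat t).shade a.val := by
  rcases a with ⟨_ | _, a⟩ | a
  · exact prodShadeA h (h.arc_lt_left a)
  · exact prodShadeB h (h.arc_lt_right a)
  · exact prodShadeOut (h.arc_lt_out a)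

theorem prodEnd_inj (h : ProdRange k m n t) (p q : Ends (pairCol m n) (Col.nat t))
    (he : prodEnd h p = prodEnd h q) (hs : isSource p = isSource q) : p = q := by
  have he := congrArg Fin.val he
  rcases p with ⟨_ | _, p⟩ | p <;> rcases q with ⟨_ | _, q⟩ | q
  · rw [show p = q from Fin.ext (prodA_inj h p.isLt q.isLt he)]
  · exact absurd ((mod_beq_zero _ _).1 hs) (prodAB_parity h p.isLt q.isLt he)
  · exact ((mod_beq_zero_one _ _).1 hs (prodA_parity h q.isLt he)).elim
  · exact absurd ((mod_beq_zero _ _).1 hs).symm (prodAB_parity h q.isLt p.isLt he.symm)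
  · rw [show p = q from Fin.ext (prodB_inj h p.isLt q.isLt he)]
  · exact ((mod_beq_zero_one _ _).1 hs (prodB_parity h p.isLt q.isLt he)).elim
  · exact ((mod_beq_zero_one _ _).1 hs.symm (prodA_parity h p.isLt he.symm)).elim
  · exact ((mod_beq_zero_one _ _).1 hs.symm (prodB_parity h q.isLt p.isLt he.symm)).elim
  · rw [show p = q from Fin.ext he]

theorem prodEnd_ex (h : ProdRange k m n t) (x : Fin (m + n + t)) :
    ∃ p q : Ends (pairCol m n) (Col.nat t), p ≠ q ∧ prodEnd h p = x ∧ prodEnd h q = x := by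
  rcases prodA_cover h x.isLt with ⟨hx, ⟨i, hi, hi'⟩ | ⟨i, hi, hi'⟩⟩ | ⟨⟨i, hi, hi'⟩, j, hj, hj'⟩
  · exact ⟨.inr ⟨_, hx⟩, .inl ⟨false, ⟨i, hi⟩⟩, Sum.inr_ne_inl, Fin.ext rfl, Fin.ext hi'⟩
  · exact ⟨.inr ⟨_, hx⟩, .inl ⟨true, ⟨i, hi⟩⟩, Sum.inr_ne_inl, Fin.ext rfl, Fin.ext hi'⟩
  · refine ⟨.inl ⟨false, ⟨i, hi⟩⟩, .inl ⟨true, ⟨j, hj⟩⟩, ?_, Fin.ext hi', Fin.ext hj'⟩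
    intro hc
    exact Bool.noConfusion (congrArg Sigma.fst (Sum.inl.inj hc))

/-- A canonical arc in every region. -/
def prodArcRep (h : ProdRange k m n t) (r : Fin (m + n + t - 1)) :
    Arcs (pairCol m n) (Col.nat t) :=
  if hr : r.val < 2 * t then .inr ⟨r.val, lt_max_of_lt_right hr⟩
  else .inl ⟨false, ⟨r.val - 2 * t + (m + t - n - k) + 1,
    lt_max_of_lt_right (prodRep h r.isLt hr).1⟩⟩

theorem prodReg_rep (h : ProdRange k m n t) (r : Fin (m + n + t - 1)) :
    prodReg h (prodArcRep h r) = r := by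
  unfold prodArcRep
  split_ifs with hr
  · rfl
  · exact Fin.ext (prodRep h r.isLt hr).2

theorem prodArcRep_pos (h : ProdRange k m n t) (r : Fin (m + n + t - 1)) (hr : r.val < 2 * t) :
    prodArcRep h r = .inr ⟨r.val, lt_max_of_lt_right hr⟩ := dif_pos hr

theorem prodArcRep_neg (h : ProdRange k m n t) (r : Fin (m + n + t - 1)) (hr : ¬ r.val < 2 * t) :
    prodArcRep h r = .inl ⟨false, ⟨r.val - 2 * t + (m + t - n - k) + 1,
      lt_max_of_lt_right (prodRep h r.isLt hr).1⟩⟩ := dif_neg hr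

theorem prodReg_step (h : ProdRange k m n t) (a : Arcs (pairCol m n) (Col.nat t)) :
    Relation.EqvGen (ArcStep (prodEnd h)) a (prodArcRep h (prodReg h a)) := by
  rcases a with ⟨_ | _, a⟩ | a
  · by_cases hr : prodArcA k m n t a.val < 2 * t
    · rw [prodArcRep_pos h _ hr]
      obtain ⟨i, hi, j, hj, hij, hw⟩ := prodStepA h (h.arc_lt_left a) hr
      exact step_in_out (prodEnd h) false ⟨i, hi⟩ ⟨j, hj⟩ (Fin.ext hij) _ _ hw
    · rw [prodArcRep_neg h _ hr]
      have e : (⟨_, lt_max_of_lt_right (prodRep h (prodArcA_lt h (h.arc_lt_left a)) hr).1⟩ :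
        (Col.nat m).Arc) = a := Fin.ext (prodRep_eq h (h.arc_lt_left a) hr)
      exact (congrArg (fun z : (Col.nat m).Arc => Relation.EqvGen (ArcStep (prodEnd h))
        (.inl ⟨false, a⟩) (.inl ⟨false, z⟩)) e).mpr (.refl _)
  · by_cases hr : prodArcB k m n t a.val < 2 * t
    · rw [prodArcRep_pos h _ hr]
      obtain ⟨i, hi, j, hj, hij, hw⟩ := prodStepB h (h.arc_lt_right a) hr
      exact step_in_out (prodEnd h) true ⟨i, hi⟩ ⟨j, hj⟩ (Fin.ext hij) _ _ hw
    · rw [prodArcRep_neg h _ hr]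
      obtain ⟨i, hi, j, hj, hij, hw⟩ := prodStepBA h (h.arc_lt_right a) hr
      exact step_in_in (prodEnd h) true false ⟨i, hi⟩ ⟨j, hj⟩ (Fin.ext hij) _ _ hw
  · rw [prodArcRep_pos h _ (h.arc_lt_out a)]
    exact .refl _

theorem endMap_eta (f : Ends c c₀ → X) :
    endMap (fun i j => f (.inl ⟨i, j⟩)) (fun j => f (.inr j)) = f := by
  funext p
  rcases p with ⟨i, j⟩ | j <;> rfl

/-- The multiplication tangle for elements `a` of colour `m` (disc `false`) and `b` of colour `n`
(disc `true`), with result of colour `t`. The boundary of each disc of colour `m` is divided into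
the `2 m - 2 k` points on the top (numbered `0, …, 2 m - 2 k - 1` from left to right), `k` points on
the right (from top to bottom) and `k` points on the left (from bottom to top). The disc `a` is on
the left of the disc `b`. The `k` points on the right of `a` are connected with the `k` points on
the left of `b`, the `m + n - k - t` points on the right end of the top of `a` are connected with
the same number of points on the left end of the top of `b` (the strings being nested), and all
the other points are connected with the external disc. -/
def prod (k m n t : ℕ) (h : ProdRange k m n t) : Tangle (pairCol m n) (Col.nat t) where
  Curve := Fin (m + n + t)
  Region := Fin (m + n + t - 1)
  finite_curve := inferInstance
  finite_region := inferInstance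
  inCurve i j := prodEnd h (.inl ⟨i, j⟩)
  outCurve j := prodEnd h (.inr j)
  inRegion i a := prodReg h (.inl ⟨i, a⟩)
  outRegion a := prodReg h (.inr a)
  shaded r := prodShade k m n t r.val
  white x := ⟨prodWhite k m n t x.val, prodWhite_lt h x.isLt⟩
  black x := ⟨prodBlack k m n t x.val, prodBlack_lt h x.isLt⟩
  shaded_white x := prodShadeWhite h x.isLt
  shaded_black x := prodShadeBlack h x.isLt
  shaded_in i a := prodReg_shade h (.inl ⟨i, a⟩)
  shaded_out a := prodReg_shade h (.inr a)
  white_in i j := Fin.ext (prodReg_white h (.inl ⟨i, j⟩)).symm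
  black_in i j := Fin.ext (prodReg_black h (.inl ⟨i, j⟩)).symm
  white_out j := Fin.ext (prodReg_white h (.inr j)).symm
  black_out j := Fin.ext (prodReg_black h (.inr j)).symm
  two_ends := by
    rw [endMap_eta (prodEnd h)]
    refine two_ends_of _ (prodEnd_inj h) ?_
    intro p
    obtain ⟨q, q', hne, hq, hq'⟩ := prodEnd_ex h (prodEnd h p)
    by_cases hp : q = p
    · exact ⟨q', fun hc => hne (hp.trans hc.symm), hq'⟩
    · exact ⟨q, hp, hq⟩
  connected := by
    apply connected_of_step
    intro r hr
    obtain ⟨s, hs, x, hx, hw⟩ := prod_connected_aux h r.isLt hr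
    refine ⟨⟨s, hs.trans r.isLt⟩, hs, ⟨x, hx⟩, ?_⟩
    simpa only [Fin.ext_iff] using hw
  euler := by
    rw [endMap_eta (prodEnd h), no_loops _ (fun x => by
      obtain ⟨q, -, -, hq, -⟩ := prodEnd_ex h x
      exact ⟨q, hq⟩)]
    have hpos := h.pos
    have hle := h.le_left
    have hle' := h.le_right
    rw [card_circuits (prodReg h) (prodArcRep h) _ (prodReg_rep h) (prodReg_step h)]
    · simp; omega
    · rintro a b ⟨p, q, hpq, ⟨rfl, rfl⟩ | ⟨rfl, rfl⟩⟩
      · apply Fin.ext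
        rw [prodReg_white, prodReg_white, hpq]
      · apply Fin.ext
        rw [prodReg_black, prodReg_black, hpq]

end Product
end Tangle

/-! ## Planar algebras -/

/-- A planar algebra: vector spaces indexed by the colours on which the planar tangles act by
multilinear maps, compatibly with isotopy, with the numbering of the internal discs and with the
composition of tangles. -/
structure PlanarAlgebra : Type (u + 1) where
  V : Col → Type u
  [addCommGroup : ∀ c, AddCommGroup (V c)]
  [module : ∀ c, Module ℂ (V c)]
  Z : ∀ {ι : Type} [Finite ι] {c : ι → Col} {c₀ : Col}, Tangle c c₀ →
    MultilinearMap ℂ (fun i => V (c i)) (V c₀)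
  Z_relabel : ∀ {ι ι' : Type} [Finite ι] [Finite ι'] (e : ι ≃ ι') {c' : ι' → Col} {c₀ : Col}
    (T : Tangle (fun i => c' (e i)) c₀) (T' : Tangle c' c₀), Tangle.IsRelabelling e T T' →
    ∀ x : ∀ i, V (c' i), Z T (fun i => x (e i)) = Z T' x
  Z_identity : ∀ (c : Col) (x : V c), Z (Tangle.rotation c 0 (Nat.zero_le _)) (fun _ => x) = x
  Z_composite : ∀ {ι : Type} {κ : ι → Type} [Finite ι] [∀ i, Finite (κ i)] {c : ι → Col}
    {d : ∀ i, κ i → Col} {c₀ : Col} (T : Tangle c c₀) (S : ∀ i, Tangle (d i) (c i))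
    (T' : Tangle (fun p : Σ i, κ i => d p.1 p.2) c₀), Tangle.IsComposite T S T' →
    ∀ x : ∀ p : Σ i, κ i, V (d p.1 p.2),
      Z T' x = Z T (fun i => Z (S i) (fun k => x ⟨i, k⟩))

attribute [instance] PlanarAlgebra.addCommGroup PlanarAlgebra.module

/-- A planar `*`-algebra: conjugate linear involutions, compatible with the reflection of
tangles. -/
structure StarPlanarAlgebra : Type (u + 1) extends PlanarAlgebra.{u} where
  conj : ∀ c, V c →ₛₗ[starRingEnd ℂ] V c
  conj_conj : ∀ c x, conj c (conj c x) = x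
  conj_Z : ∀ {ι : Type} [Finite ι] {c : ι → Col} {c₀ : Col} (T T' : Tangle c c₀),
    Tangle.IsMirror T T' → ∀ x : ∀ i, V (c i),
      conj c₀ (Z T x) = Z T' (fun i => conj (c i) (x i))

namespace PlanarAlgebra

variable (P : PlanarAlgebra.{u})

/-- The value of a tangle without internal discs. -/
def unitElem (c : Col) : P.V c := P.Z (Tangle.unit c) (fun i => i.elim)

/-- The value of a closed loop. -/
def loopElem (s : Bool) : P.V (Col.zero s) := P.Z (Tangle.loop s) (fun i => i.elim)

/-- A pair of elements as the input of a tangle with two internal discs. -/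
def pair {m n : ℕ} (a : P.V (.nat m)) (b : P.V (.nat n)) :
    ∀ i : Bool, P.V (Tangle.pairCol m n i)
  | false => a
  | true => b

theorem pair_left {m n : ℕ} (a : P.V (.nat m)) (b : P.V (.nat n)) :
    P.pair a b = Function.update (P.pair 0 b) false a := by
  funext i; cases i <;> rfl

theorem pair_right {m n : ℕ} (a : P.V (.nat m)) (b : P.V (.nat n)) :
    P.pair a b = Function.update (P.pair a 0) true b := by
  funext i; cases i <;> rfl

/-- The bilinear map given by a multiplication tangle. -/
def prodMap {k m n t : ℕ} (h : Tangle.ProdRange k m n t) :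
    P.V (.nat m) →ₗ[ℂ] P.V (.nat n) →ₗ[ℂ] P.V (.nat t) :=
  LinearMap.mk₂ ℂ (fun a b => P.Z (Tangle.prod k m n t h) (P.pair a b))
    (fun a a' b => by
      rw [pair_left P (a + a') b, pair_left P a b, pair_left P a' b]
      exact (P.Z (Tangle.prod k m n t h)).map_update_add (P.pair 0 b) false a a')
    (fun r a b => by
      rw [pair_left P (r • a) b, pair_left P a b]
      exact (P.Z (Tangle.prod k m n t h)).map_update_smul (P.pair 0 b) false r a)
    (fun a b b' => by
      rw [pair_right P a (b + b'), pair_right P a b, pair_right P a b']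
      exact (P.Z (Tangle.prod k m n t h)).map_update_add (P.pair a 0) true b b')
    (fun r a b => by
      rw [pair_right P a (r • b), pair_right P a b]
      exact (P.Z (Tangle.prod k m n t h)).map_update_smul (P.pair a 0) true r b)

/-- The linear map given by a tangle with one internal disc. -/
def unaryMap {c c₀ : Col} (T : Tangle (fun _ : Unit => c) c₀) : P.V c →ₗ[ℂ] P.V c₀ where
  toFun a := P.Z T (fun _ => a)
  map_add' a b := by
    have e : ∀ z : P.V c, (fun _ : Unit => z) = Function.update (fun _ : Unit => a) () z := by
      intro z; funext i; rfl
    rw [e (a + b), e b, MultilinearMap.map_update_add, ← e a]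
  map_smul' r a := by
    have e : ∀ z : P.V c, (fun _ : Unit => z) = Function.update (fun _ : Unit => a) () z := by
      intro z; funext i; rfl
    rw [e (r • a), MultilinearMap.map_update_smul, ← e a]
    rfl

/-- The multiplication of `P_n`, for `n ≥ 1`. -/
def mulMap (n : ℕ) (hn : 1 ≤ n) :
    P.V (.nat n) →ₗ[ℂ] P.V (.nat n) →ₗ[ℂ] P.V (.nat n) :=
  P.prodMap (k := n) ⟨hn, le_rfl, le_rfl, le_rfl, le_rfl, le_rfl⟩

end PlanarAlgebra

/-- A subfactor planar algebra of modulus `δ`: a planar `*`-algebra with finite dimensional spaces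
which is connected, has modulus `δ`, is spherical, and is positive: the pictorial trace of `x* x`
is positive for `x ≠ 0`. For the colours `0₊` and `0₋`, positivity is automatic, since these spaces
are spanned by the units. -/
structure SubfactorPlanarAlgebra (δ : ℝ) : Type (u + 1) extends StarPlanarAlgebra.{u} where
  finiteDimensional : ∀ c, FiniteDimensional ℂ (V c)
  connected : ∀ s : Bool,
    Function.Bijective (fun r : ℂ => r • toPlanarAlgebra.unitElem (Col.zero s))
  modulus : ∀ s : Bool, toPlanarAlgebra.loopElem s = (δ : ℂ) • toPlanarAlgebra.unitElem (Col.zero s)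
  spherical : ∀ {ι : Type} [Finite ι] {c : ι → Col} {s s' : Bool}
    (T : Tangle c (Col.zero s)) (T' : Tangle c (Col.zero s')), Tangle.IsSphericallyIsotopic T T' →
    ∀ x : ∀ i, V (c i), ∃ r : ℂ,
      Z T x = r • toPlanarAlgebra.unitElem (Col.zero s) ∧
      Z T' x = r • toPlanarAlgebra.unitElem (Col.zero s')
  positive : ∀ (n : ℕ) (hn : 1 ≤ n) (x : V (.nat n)), x ≠ 0 → ∃ r : ℝ, 0 < r ∧
    toPlanarAlgebra.unaryMap (Tangle.trace n) (toPlanarAlgebra.mulMap n hn (conj _ x) x) =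
      (r : ℂ) • toPlanarAlgebra.unitElem (.nat 0)

/-- A `*`-planar subalgebra: subspaces that are closed under the action of all tangles and under
the involution. -/
structure StarPlanarSubalgebra {δ : ℝ} (P : SubfactorPlanarAlgebra.{u} δ) : Type u where
  carrier : ∀ c, Submodule ℂ (P.V c)
  Z_mem : ∀ {ι : Type} [Finite ι] {c : ι → Col} {c₀ : Col} (T : Tangle c c₀)
    (x : ∀ i, P.V (c i)), (∀ i, x i ∈ carrier (c i)) → P.Z T x ∈ carrier c₀
  conj_mem : ∀ c (x : P.V c), x ∈ carrier c → P.conj c x ∈ carrier c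

namespace StarPlanarSubalgebra

variable {δ : ℝ} {P : SubfactorPlanarAlgebra.{u} δ} (Q : StarPlanarSubalgebra P)

/-- A `*`-planar subalgebra is a planar algebra. -/
def toPlanarAlgebra : PlanarAlgebra.{u} where
  V c := Q.carrier c
  Z {ι} _ {c} {c₀} T :=
    ((P.Z T).compLinearMap (fun i => (Q.carrier (c i)).subtype)).codRestrict (Q.carrier c₀)
      (fun x => Q.Z_mem T _ (fun i => (x i).2))
  Z_relabel e _ _ T T' h x := Subtype.ext (P.Z_relabel e T T' h (fun i => (x i : P.V _)))
  Z_identity c x := Subtype.ext (P.Z_identity c x)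
  Z_composite T S T' h x := Subtype.ext (P.Z_composite T S T' h (fun p => (x p : P.V _)))

/-- The inclusion of `Q_c` into `P_c`. -/
def val (c : Col) : Q.toPlanarAlgebra.V c →ₗ[ℂ] P.V c := (Q.carrier c).subtype

theorem val_injective (c : Col) : Function.Injective (Q.val c) := Subtype.val_injective

theorem val_Z {ι : Type} [Finite ι] {c : ι → Col} {c₀ : Col} (T : Tangle c c₀)
    (x : ∀ i, Q.toPlanarAlgebra.V (c i)) :
    Q.val c₀ (Q.toPlanarAlgebra.Z T x) = P.Z T (fun i => Q.val (c i) (x i)) := rfl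

theorem val_unitElem (c : Col) : Q.val c (Q.toPlanarAlgebra.unitElem c) = P.unitElem c :=
  (Q.val_Z _ _).trans (congrArg (P.Z (Tangle.unit c)) (funext fun i => i.elim))

theorem val_loopElem (s : Bool) :
    Q.val (Col.zero s) (Q.toPlanarAlgebra.loopElem s) = P.loopElem s :=
  (Q.val_Z _ _).trans (congrArg (P.Z (Tangle.loop s)) (funext fun i => i.elim))

theorem val_mulMap (n : ℕ) (hn : 1 ≤ n) (x y : Q.toPlanarAlgebra.V (.nat n)) :
    Q.val (.nat n) (Q.toPlanarAlgebra.mulMap n hn x y) =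
      P.mulMap n hn (Q.val (.nat n) x) (Q.val (.nat n) y) := by
  refine (Q.val_Z _ _).trans ?_
  refine congrArg (P.Z (Tangle.prod n n n n _)) (funext fun i => ?_)
  cases i <;> rfl

/-- The restriction of the involution. -/
def conjQ (c : Col) : Q.toPlanarAlgebra.V c →ₛₗ[starRingEnd ℂ] Q.toPlanarAlgebra.V c where
  toFun x := ⟨P.conj c (Q.val c x), Q.conj_mem c _ (Subtype.prop x)⟩
  map_add' x y := Q.val_injective c (by
    show P.conj c (Q.val c (x + y)) = P.conj c (Q.val c x) + P.conj c (Q.val c y)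
    rw [map_add, map_add])
  map_smul' r x := Q.val_injective c (by
    show P.conj c (Q.val c (r • x)) = starRingEnd ℂ r • P.conj c (Q.val c x)
    rw [map_smul, map_smulₛₗ])

theorem val_conjQ (c : Col) (x : Q.toPlanarAlgebra.V c) :
    Q.val c (Q.conjQ c x) = P.conj c (Q.val c x) := rfl

/-- A `*`-planar subalgebra of a subfactor planar algebra is a subfactor planar algebra of the
same modulus. -/
def toSubfactorPlanarAlgebra : SubfactorPlanarAlgebra.{u} δ where
  toPlanarAlgebra := Q.toPlanarAlgebra
  conj := Q.conjQ
  conj_conj c x := Q.val_injective c (P.conj_conj c _)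
  conj_Z T T' h x := Q.val_injective _ (P.conj_Z T T' h (fun i => Q.val _ (x i)))
  finiteDimensional c := by
    have := P.finiteDimensional c
    exact FiniteDimensional.finiteDimensional_submodule (Q.carrier c)
  connected s := by
    refine ⟨fun a b hab => (P.connected s).1 ?_, fun x => ?_⟩
    · have h := congrArg (Q.val _) hab
      simp only [map_smul, val_unitElem] at h
      exact h
    · obtain ⟨r, hr⟩ := (P.connected s).2 (Q.val _ x)
      refine ⟨r, Q.val_injective _ ?_⟩
      rw [← hr, map_smul, val_unitElem]
  modulus s := Q.val_injective _ (by
    rw [map_smul, val_loopElem, val_unitElem]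
    exact P.modulus s)
  spherical T T' h x := by
    obtain ⟨r, h1, h2⟩ := P.spherical T T' h (fun i => Q.val _ (x i))
    refine ⟨r, Q.val_injective _ ?_, Q.val_injective _ ?_⟩
    · rw [map_smul, val_unitElem]
      exact h1
    · rw [map_smul, val_unitElem]
      exact h2
  positive n hn x hx := by
    have hx' : Q.val _ x ≠ 0 := fun h => hx (Q.val_injective _ (h.trans (map_zero _).symm))
    obtain ⟨r, hr, h⟩ := P.positive n hn _ hx'
    refine ⟨r, hr, Q.val_injective _ ?_⟩
    rw [map_smul]
    refine Eq.trans ?_ (h.trans ?_)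
    · exact congrArg (P.Z (Tangle.trace n)) (funext fun _ => Q.val_mulMap n hn _ _)
    · exact congrArg ((r : ℂ) • ·) (Q.val_unitElem _).symm

end StarPlanarSubalgebra

/-! ## Finite pre-von Neumann algebras -/

/-- The operations of a complex `*`-algebra with a linear functional. -/
structure TracialData (A : Type u) [AddCommGroup A] [Module ℂ A] : Type u where
  mul : A →ₗ[ℂ] A →ₗ[ℂ] A
  one : A
  dag : A →ₛₗ[starRingEnd ℂ] A
  tr : A →ₗ[ℂ] ℂ

/-- The operations form a finite pre-von Neumann algebra: a unital `*`-algebra with a normalised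
trace such that `⟨a, b⟩ = t (b* a)` is an inner product, and such that left multiplications are
bounded for the norm of this inner product. -/
structure TracialData.IsFinitePreVonNeumann {A : Type u} [AddCommGroup A] [Module ℂ A]
    (D : TracialData A) : Prop where
  mul_assoc : ∀ a b c, D.mul (D.mul a b) c = D.mul a (D.mul b c)
  one_mul : ∀ a, D.mul D.one a = a
  mul_one : ∀ a, D.mul a D.one = a
  dag_dag : ∀ a, D.dag (D.dag a) = a
  dag_mul : ∀ a b, D.dag (D.mul a b) = D.mul (D.dag b) (D.dag a)
  tr_one : D.tr D.one = 1
  tr_comm : ∀ a b, D.tr (D.mul a b) = D.tr (D.mul b a)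
  inner_symm : ∀ a b, D.tr (D.mul (D.dag b) a) = starRingEnd ℂ (D.tr (D.mul (D.dag a) b))
  inner_pos : ∀ a, a ≠ 0 → 0 < (D.tr (D.mul (D.dag a) a)).re
  bounded : ∀ a, ∃ C : ℝ, ∀ b,
    (D.tr (D.mul (D.dag (D.mul a b)) (D.mul a b))).re ≤ C ^ 2 * (D.tr (D.mul (D.dag b) b)).re

/-- `i` makes `A ⊆ B` a compatible pair of finite pre-von Neumann algebras. -/
structure IsCompatiblePair {A B : Type u} [AddCommGroup A] [Module ℂ A] [AddCommGroup B]
    [Module ℂ B] (D : TracialData A) (D' : TracialData B) (i : A →ₗ[ℂ] B) : Prop where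
  left : D.IsFinitePreVonNeumann
  right : D'.IsFinitePreVonNeumann
  injective : Function.Injective i
  map_mul : ∀ a b, i (D.mul a b) = D'.mul (i a) (i b)
  map_one : i D.one = D'.one
  map_dag : ∀ a, i (D.dag a) = D'.dag (i a)
  map_tr : ∀ a, D'.tr (i a) = D.tr a

/-- `E` is a `*`- and trace-preserving `A`-`A`-bimodule retraction for the inclusion `i` of `A`
into `B`. -/
structure IsBimoduleRetraction {A B : Type u} [AddCommGroup A] [Module ℂ A] [AddCommGroup B]
    [Module ℂ B] (D : TracialData A) (D' : TracialData B) (i : A →ₗ[ℂ] B) (E : B →ₗ[ℂ] A) :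
    Prop where
  retraction : ∀ a, E (i a) = a
  map_mul_left : ∀ a b, E (D'.mul (i a) b) = D.mul a (E b)
  map_mul_right : ∀ b a, E (D'.mul b (i a)) = D.mul (E b) a
  map_dag : ∀ b, E (D'.dag b) = D.dag (E b)
  map_tr : ∀ b, D.tr (E b) = D'.tr b

/-! ## The algebras `F_k(P)` -/

namespace SubfactorPlanarAlgebra

variable {δ : ℝ} (P : SubfactorPlanarAlgebra.{u} δ)

/-- The identification of `P_{0₊}` with the complex numbers which sends the unit to `1`. -/
def scalar : P.V (.nat 0) →ₗ[ℂ] ℂ :=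
  (LinearEquiv.ofBijective (LinearMap.toSpanSingleton ℂ _ (P.unitElem (.nat 0)))
    (P.connected false)).symm

/-- The normalised pictorial trace `τ` on `P_n`. -/
def tau (n : ℕ) : P.V (.nat n) →ₗ[ℂ] ℂ :=
  ((δ : ℂ) ^ n)⁻¹ • P.scalar ∘ₗ P.unaryMap (Tangle.trace n)

variable (k : ℕ)

/-- The vector space `F_k(P)`, the direct sum of the spaces `P_n` with `n ≥ k`. -/
abbrev F : Type u := ⨁ n : {n : ℕ // k ≤ n}, P.V (.nat n.1)

/-- The components of the product of elements of `P_m` and `P_n`. -/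
theorem prodRange {k m n t : ℕ} (hk : 1 ≤ k) (hm : k ≤ m) (hn : k ≤ n)
    (ht : t ∈ Finset.Icc ((m - n) + (n - m) + k) (m + n - k)) : Tangle.ProdRange k m n t := by
  rw [Finset.mem_Icc] at ht
  exact ⟨hk, hm, hn, by omega, by omega, by omega⟩

/-- The product in `F_k(P)` of elements of `P_m` and `P_n`: its component in `P_t` is given by the
multiplication tangle, for `|m - n| + k ≤ t ≤ m + n - k`. -/
def mulComponents (hk : 1 ≤ k) (m n : {n : ℕ // k ≤ n}) :
    P.V (.nat m.1) →ₗ[ℂ] P.V (.nat n.1) →ₗ[ℂ] P.F k :=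
  ∑ t ∈ (Finset.Icc ((m.1 - n.1) + (n.1 - m.1) + k) (m.1 + n.1 - k)).attach,
    (P.prodMap (prodRange hk m.2 n.2 t.2)).compr₂
      (DirectSum.lof ℂ {n : ℕ // k ≤ n} (fun n => P.V (.nat n.1))
        ⟨t.1, le_trans (Nat.le_add_left _ _) (Finset.mem_Icc.1 t.2).1⟩)

/-- The product `#` of `F_k(P)`, the bilinear extension of the above. -/
def mulF (hk : 1 ≤ k) : P.F k →ₗ[ℂ] P.F k →ₗ[ℂ] P.F k :=
  DirectSum.toModule ℂ _ _ fun m =>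
    (DirectSum.toModule ℂ _ _ fun n => (P.mulComponents k hk m n).flip).flip

/-- The involution `†` of `F_k(P)`: on `P_m`, it is given by `a ↦ Z_{R^k}(a*)`, where `R` is the
rotation. -/
def dagF : P.F k →ₛₗ[starRingEnd ℂ] P.F k where
  toFun := DirectSum.map fun m : {n : ℕ // k ≤ n} =>
    ((P.unaryMap (Tangle.rotation (.nat m.1) k m.2)).comp (P.conj (.nat m.1))).toAddMonoidHom
  map_add' := map_add _
  map_smul' r x := by
    refine DFinsupp.ext fun m => ?_
    exact ((P.unaryMap (Tangle.rotation (.nat m.1) k m.2)).comp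
      (P.conj (.nat m.1))).map_smul' r (x m)

/-- The algebra `F_k(P)`, with its unit in `P_k` and with the trace `t_k`, which is the normalised
trace of the component in `P_k`. -/
def algF (hk : 1 ≤ k) : TracialData (P.F k) where
  mul := P.mulF k hk
  one := DirectSum.lof ℂ {n : ℕ // k ≤ n} (fun n => P.V (.nat n.1)) ⟨k, le_rfl⟩
    (P.unitElem (.nat k))
  dag := P.dagF k
  tr := P.tau k ∘ₗ DirectSum.component ℂ {n : ℕ // k ≤ n} (fun n => P.V (.nat n.1)) ⟨k, le_rfl⟩

end SubfactorPlanarAlgebra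

namespace StarPlanarSubalgebra

variable {δ : ℝ} {P : SubfactorPlanarAlgebra.{u} δ} (Q : StarPlanarSubalgebra P)

/-- The inclusion of `F_k(Q)` into `F_k(P)`. -/
def inclF (k : ℕ) : Q.toSubfactorPlanarAlgebra.F k →ₗ[ℂ] P.F k :=
  DirectSum.lmap fun n : {n : ℕ // k ≤ n} => Q.val (.nat n.1)

/-- `e` is the trace-preserving conditional expectation of `P_n` onto `Q_n`, for `n ≥ 1`: a linear,
`*`-preserving and `τ`-preserving `Q_n`-`Q_n`-bimodule map which is the identity on `Q_n`. -/
structure IsConditionalExpectation (n : ℕ) (hn : 1 ≤ n)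
    (e : P.V (.nat n) →ₗ[ℂ] Q.toSubfactorPlanarAlgebra.V (.nat n)) : Prop where
  retraction : ∀ y, e (Q.val _ y) = y
  map_mul_left : ∀ y x, e (P.mulMap n hn (Q.val _ y) x) =
    Q.toSubfactorPlanarAlgebra.mulMap n hn y (e x)
  map_mul_right : ∀ x y, e (P.mulMap n hn x (Q.val _ y)) =
    Q.toSubfactorPlanarAlgebra.mulMap n hn (e x) y
  map_conj : ∀ x, e (P.conj _ x) = Q.toSubfactorPlanarAlgebra.conj _ (e x)
  map_tau : ∀ x, P.tau n (Q.val _ (e x)) = P.tau n x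

end StarPlanarSubalgebra

end

/-!
The proof has three layers: identities between planar tangles, the algebra `F_k(P)` for a general
`k ≥ 1` (in which boxes have `k` strings on either side), and the orthogonal projection onto
`F_k(Q)`.

**Tangles.** Every identity needed between tangles is a statement about which marked points are
joined by strings. A tangle is called tight (`IsTight`) if every string has an end on an internal
disc and the boundary arcs in each region form one circuit. A tight tangle is determined up to
isotopy by its matching of the marked points (`exists_isotopy`), except for the position of an
external disc without marked points, which does not matter by sphericality (`Z_congr`,
`Z_congr_closed`). Tight tangles compose to tight tangles (`comp`, `comp_isTight`,
`comp_isComposite`); that the composite satisfies Euler's formula follows by adding up the formulas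
of its parts. Hence associativity of the components of `#` (`prodMap_assoc`), the rule
`(a # b)† = b† # a†` (`dagMap_prodMap`), the trace property (`tau_prodMap_comm`), and the equality,
up to a constant, of the inner product of `F_k(P)` on `P_m` with that of `P_m`
(`trace_dagMap_prodMap`) reduce to linear arithmetic with the positions of marked points. The
strings of the unit have no internal ends, so that the unit law and `t(1) = 1` need the composite
itself (`prodMap_unitElem_left`, `trace_unitElem`).

**Boundedness.** Let `a ∈ P_m`, `b ∈ P_n`, and let `a #_t b` be the component of `a # b` in `P_t`.
By associativity `‖a #_t b‖² = ⟨b, X #_n b⟩`, where `s = m + n - t` and `X = a† #_s a ∈ P_s`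
(`tau_prodMap_self`). The self-adjoint operator `b ↦ X #_n b` belongs to a `*`-representation of the
finite dimensional algebra `(P_s, #_s)` on `P_n`, and its norm is bounded independently of `n`. This
follows by iterating the Cauchy–Schwarz inequality: with `g j = ⟨b, X ^ (2 ^ j) b⟩` one has
`g j ^ 2 ≤ ‖b‖² * g (j + 1)`, while the powers of `X` in the finite dimensional `P_s` grow at most
geometrically, at a rate independent of `b` and `n` (`le_mul_of_sq_le_mul_succ`,
`exists_growth_bound`, `exists_bound_of_dagMap_eq`). As `a # b` has components only in `P_t` with
`|t - n| ≤ m`, left multiplication by `a` is bounded on all of `F_k(P)` (`exists_bound_ofF`).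

**Expectation.** A map onto a subalgebra that is orthogonal for the trace form is automatically a
trace-preserving bimodule retraction (`isBimoduleRetraction`). On `P_n` the orthogonal projection
onto `Q_n` exists by finite dimension. Since the inner products of `F_k(P)` and of `P_n` are
proportional on `P_n`, the direct sum of these projections is orthogonal on `F_k(P)` (`tr_lmap`),
and this gives the expectation together with its description by components.
-/

noncomputable section

/-! ### Tight tangles -/

namespace Tangle

section Tight

variable {ι : Type} {c : ι → Col} {c₀ : Col}

/-- An arc step between arcs of internal discs along a string that joins two internal discs, where
`f` assigns to a marked point of an internal disc the curve that ends there. -/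
def InStep {X : Type} (f : (Σ i, (c i).Pt) → X) (a b : Σ i, (c i).Arc) : Prop :=
  ∃ p q, f p = f q ∧
    ((a = ⟨p.1, Col.whiteArc p.2⟩ ∧ b = ⟨q.1, Col.whiteArc q.2⟩) ∨
      (a = ⟨p.1, Col.blackArc p.2⟩ ∧ b = ⟨q.1, Col.blackArc q.2⟩))

/-- A chain of steps between internal discs is a chain of arc steps of the tangle. -/
theorem arcStep_of_inStep {X : Type} (e : Ends c c₀ → X) {a b : Σ i, (c i).Arc}
    (h : Relation.EqvGen (InStep fun p => e (.inl p)) a b) :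
    Relation.EqvGen (ArcStep e) (.inl a) (.inl b) := by
  induction h with
  | rel a b h =>
    obtain ⟨p, q, h1, h2⟩ := h
    refine .rel _ _ ⟨.inl p, .inl q, h1, ?_⟩
    rcases h2 with ⟨rfl, rfl⟩ | ⟨rfl, rfl⟩
    · exact .inl ⟨rfl, rfl⟩
    · exact .inr ⟨rfl, rfl⟩
  | refl a => exact .refl _
  | symm a b _ ih => exact .symm _ _ ih
  | trans a b d _ _ ih1 ih2 => exact .trans _ _ _ ih1 ih2

theorem exists_eq_whiteArc_or_blackArc {c : Col} (h : 0 < c.size) (a : c.Arc) :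
    ∃ j : c.Pt, a = Col.whiteArc j ∨ a = Col.blackArc j := by
  obtain ⟨j, rfl⟩ := exists_point h a
  refine ⟨j, ?_⟩
  unfold Col.whiteArc Col.blackArc
  split_ifs <;> simp

/-- If every region is bounded by one circuit of inner arcs, and if all strings from the external
disc lead to internal discs, then the circuits are the regions, and one more if the external disc
has no marked points. -/
theorem card_circuits_eq {X R : Type} [Finite R] (e : Ends c c₀ → X) (g : Arcs c c₀ → R)
    (hw : ∀ p q, e p = e q → g (endWhite p) = g (endWhite q))
    (hb : ∀ p q, e p = e q → g (endBlack p) = g (endBlack q))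
    (surj : ∀ r, ∃ a, g (.inl a) = r)
    (conn : ∀ a b, g (.inl a) = g (.inl b) → Relation.EqvGen (InStep fun p => e (.inl p)) a b)
    (out : ∀ j, ∃ p, e (.inl p) = e (.inr j)) :
    Nat.card (Quot (ArcStep e)) = Nat.card R + if c₀.size = 0 then 1 else 0 := by
  have hstep : ∀ a b, ArcStep e a b → g a = g b := by
    rintro a b ⟨p, q, h, ⟨rfl, rfl⟩ | ⟨rfl, rfl⟩⟩
    · exact hw p q h
    · exact hb p q h
  split_ifs with h0
  · have hout : ∀ j : c₀.Pt, False := fun j => by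
      have := j.isLt
      omega
    rw [← Finite.card_option]
    refine Nat.card_congr (Equiv.ofBijective (Quot.lift
      (fun a : Arcs c c₀ => match a with | .inl a => some (g (.inl a)) | .inr _ => none) ?_)
        ⟨?_, ?_⟩)
    · rintro a b ⟨p | p, q | q, h, h'⟩
      · have := hstep _ _ ⟨.inl p, .inl q, h, h'⟩
        rcases h' with ⟨rfl, rfl⟩ | ⟨rfl, rfl⟩ <;> exact congrArg some this
      · exact (hout q).elim
      · exact (hout p).elim
      · exact (hout p).elim
    · intro a b
      induction a using Quot.ind with
      | _ a =>
      induction b using Quot.ind with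
      | _ b =>
      intro h
      rcases a with a | a <;> rcases b with b | b
      · exact Quot.eqvGen_sound (arcStep_of_inStep e (conn a b (Option.some.inj h)))
      · cases h
      · cases h
      · have : a = b := by
          have ha := a.isLt
          have hb := b.isLt
          exact Fin.ext (by omega)
        rw [this]
    · rintro (_ | r)
      · exact ⟨Quot.mk _ (.inr ⟨0, by omega⟩), rfl⟩
      · obtain ⟨a, ha⟩ := surj r
        exact ⟨Quot.mk _ (.inl a), congrArg some ha⟩
  · rw [add_zero]
    have link : ∀ a : Arcs c c₀, ∃ b, Quot.mk (ArcStep e) a = Quot.mk _ (.inl b) := by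
      rintro (a | a)
      · exact ⟨a, rfl⟩
      · obtain ⟨j, hj⟩ := exists_eq_whiteArc_or_blackArc (Nat.pos_of_ne_zero h0) a
        obtain ⟨p, hp⟩ := out j
        rcases hj with rfl | rfl
        · exact ⟨⟨p.1, Col.whiteArc p.2⟩, Quot.sound ⟨.inr j, .inl p, hp.symm, .inl ⟨rfl, rfl⟩⟩⟩
        · exact ⟨⟨p.1, Col.blackArc p.2⟩, Quot.sound ⟨.inr j, .inl p, hp.symm, .inr ⟨rfl, rfl⟩⟩⟩
    refine Nat.card_congr (Equiv.ofBijective (Quot.lift g hstep) ⟨?_, ?_⟩)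
    · intro a b
      induction a using Quot.ind with
      | _ a =>
      induction b using Quot.ind with
      | _ b =>
      obtain ⟨a', ha⟩ := link a
      obtain ⟨b', hb⟩ := link b
      rw [ha, hb]
      intro h
      exact Quot.eqvGen_sound (arcStep_of_inStep e (conn a' b' h))
    · intro r
      obtain ⟨a, ha⟩ := surj r
      exact ⟨Quot.mk _ (.inl a), ha⟩

/-- The curve at a marked point of an internal disc. -/
def curveAt (T : Tangle c c₀) (p : Σ i, (c i).Pt) : T.Curve := T.inCurve p.1 p.2

/-- The region at an arc of an internal disc. -/
def regionAt (T : Tangle c c₀) (a : Σ i, (c i).Arc) : T.Region := T.inRegion a.1 a.2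

/-- A tangle is tight if it has no loops, if every string has an end on an internal disc (so that
all strings from the external disc lead to internal discs), if the arcs of the internal discs in
each region form one circuit, linked by strings between internal discs, and if different arcs of
the external disc lie in different regions. Up to isotopy, and up to the position of an external
disc without marked points, such a tangle is determined by its matching of the marked points. -/
structure IsTight (T : Tangle c c₀) : Prop where
  curve : ∀ x, ∃ p, T.curveAt p = x
  region : ∀ r, ∃ a, T.regionAt a = r
  circuit : ∀ a b, T.regionAt a = T.regionAt b → Relation.EqvGen (InStep T.curveAt) a b
  outCurve_inj : Function.Injective T.outCurve
  outRegion_inj : Function.Injective T.outRegion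

/-- The curve at a marked point. -/
abbrev endAt (T : Tangle c c₀) : Ends c c₀ → T.Curve := endMap T.inCurve T.outCurve

/-- The region at an arc. -/
def arcAt (T : Tangle c c₀) : Arcs c c₀ → T.Region
  | .inl a => T.regionAt a
  | .inr a => T.outRegion a

theorem arcAt_endWhite (T : Tangle c c₀) (p : Ends c c₀) :
    T.arcAt (endWhite p) = T.white (T.endAt p) := by
  rcases p with p | p
  · exact (T.white_in p.1 p.2).symm
  · exact (T.white_out p).symm

theorem arcAt_endBlack (T : Tangle c c₀) (p : Ends c c₀) :
    T.arcAt (endBlack p) = T.black (T.endAt p) := by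
  rcases p with p | p
  · exact (T.black_in p.1 p.2).symm
  · exact (T.black_out p).symm

/-- A string has at most one end of each orientation. -/
theorem end_inj (T : Tangle c c₀) {p q : Ends c c₀} (h : T.endAt p = T.endAt q)
    (hs : isSource p = isSource q) : p = q := by
  obtain ⟨r, ⟨h1, h2⟩, -⟩ := T.two_ends p
  obtain ⟨_, -, hu⟩ := T.two_ends r
  refine (hu p ⟨h1.symm, by rw [h2, Bool.not_not]⟩).trans
    (hu q ⟨(h1.trans h).symm, by rw [h2, Bool.not_not, hs]⟩).symm

theorem source_ne (T : Tangle c c₀) {p q : Ends c c₀} (h : T.endAt p = T.endAt q)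
    (hpq : p ≠ q) : isSource p = !isSource q := by
  have := mt (T.end_inj h) hpq
  revert this
  cases isSource p <;> cases isSource q <;> simp

theorem end_unique (T : Tangle c c₀) {p q r : Ends c c₀} (hq : T.endAt q = T.endAt p)
    (hr : T.endAt r = T.endAt p) (hqp : q ≠ p) (hrp : r ≠ p) : q = r :=
  T.end_inj (hq.trans hr.symm) (by rw [T.source_ne hq hqp, T.source_ne hr hrp])

/-- Every marked point is joined to another one. -/
theorem exists_partner (T : Tangle c c₀) (p : Ends c c₀) : ∃ q, q ≠ p ∧ T.endAt q = T.endAt p := by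
  obtain ⟨q, ⟨h1, h2⟩, -⟩ := T.two_ends p
  refine ⟨q, ?_, h1⟩
  rintro rfl
  cases h : isSource q <;> simp [h] at h2

/-- In a tight tangle, the strings from the external disc lead to internal discs. -/
theorem IsTight.exists_in {T : Tangle c c₀} (h : T.IsTight) (j : c₀.Pt) :
    ∃ p : Σ i, (c i).Pt, T.curveAt p = T.outCurve j ∧ p.2.val % 2 = j.val % 2 := by
  obtain ⟨q | q, hq, hq'⟩ := T.exists_partner (.inr j)
  · refine ⟨q, hq', ?_⟩
    have := T.source_ne hq' hq
    simp only [isSource] at this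
    rw [← mod_beq_zero, this]
    rcases Nat.mod_two_eq_zero_or_one j.val with h | h <;> simp [h]
  · exact absurd (congrArg Sum.inr (h.outCurve_inj hq')) hq

theorem IsTight.card_circuits {T : Tangle c c₀} (h : T.IsTight) :
    Nat.card (Quot (ArcStep T.endAt)) = Nat.card T.Region + if c₀.size = 0 then 1 else 0 := by
  have := T.finite_region
  refine card_circuits_eq T.endAt T.arcAt ?_ ?_ h.region h.circuit ?_
  · intro p q hpq
    rw [arcAt_endWhite, arcAt_endWhite, hpq]
  · intro p q hpq
    rw [arcAt_endBlack, arcAt_endBlack, hpq]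
  · intro j
    obtain ⟨p, hp, -⟩ := h.exists_in j
    exact ⟨p, hp⟩

/-- The Euler characteristic of a tight tangle. -/
theorem IsTight.count {T : Tangle c c₀} (h : T.IsTight) :
    Nat.card ι + 1 + Nat.card T.Region =
      2 + Nat.card T.Curve + if c₀.size = 0 then 1 else 0 := by
  have h1 := T.euler
  rw [h.card_circuits, no_loops _ (fun x => by
    obtain ⟨p, hp⟩ := h.curve x
    exact ⟨.inl p, hp⟩)] at h1
  omega

theorem regionAt_whiteArc (T : Tangle c c₀) (p : Σ i, (c i).Pt) :
    T.regionAt ⟨p.1, Col.whiteArc p.2⟩ = T.white (T.curveAt p) := (T.white_in p.1 p.2).symm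

theorem regionAt_blackArc (T : Tangle c c₀) (p : Σ i, (c i).Pt) :
    T.regionAt ⟨p.1, Col.blackArc p.2⟩ = T.black (T.curveAt p) := (T.black_in p.1 p.2).symm

theorem regionAt_eq_of_inStep (T : Tangle c c₀) {a b : Σ i, (c i).Arc}
    (h : Relation.EqvGen (InStep T.curveAt) a b) : T.regionAt a = T.regionAt b := by
  induction h with
  | rel a b h =>
    obtain ⟨p, q, h1, ⟨rfl, rfl⟩ | ⟨rfl, rfl⟩⟩ := h
    · rw [regionAt_whiteArc, regionAt_whiteArc, h1]
    · rw [regionAt_blackArc, regionAt_blackArc, h1]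
  | refl a => rfl
  | symm a b _ ih => exact ih.symm
  | trans a b d _ _ ih1 ih2 => exact ih1.trans ih2

end Tight

/-! ### Composition of tight tangles -/

section Glue

variable {ι Y : Type} {A X : ι → Type}

/-- The result of gluing the sets `X i` to `Y` along injections `f i : A i → X i` and maps
`A i → Y`: the set `Y` together with the elements of the `X i` that are not glued. -/
abbrev Glue (Y : Type) (f : ∀ i, A i → X i) : Type := Y ⊕ Σ i, {x : X i // ¬ ∃ a, f i a = x}

open Classical in
/-- The map of `X i` to the result of the gluing. -/
def glueMap (t : ∀ i, A i → Y) (f : ∀ i, A i → X i) (i : ι) (x : X i) : Glue Y f :=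
  if h : ∃ a, f i a = x then .inl (t i h.choose) else .inr ⟨i, x, h⟩

variable {t : ∀ i, A i → Y} {f : ∀ i, A i → X i}

theorem glueMap_apply (hf : ∀ i, Function.Injective (f i)) (i : ι) (a : A i) :
    glueMap t f i (f i a) = .inl (t i a) := by
  have h : ∃ a', f i a' = f i a := ⟨a, rfl⟩
  unfold glueMap
  rw [dif_pos h, hf i h.choose_spec]

theorem glueMap_of_not {i : ι} {x : X i} (h : ¬ ∃ a, f i a = x) :
    glueMap t f i x = .inr ⟨i, x, h⟩ := dif_neg h

theorem glueMap_eq_inl {i : ι} {x : X i} {y : Y} (h : glueMap t f i x = .inl y) :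
    ∃ a, f i a = x ∧ t i a = y := by
  unfold glueMap at h
  split_ifs at h with h'
  exact ⟨_, h'.choose_spec, Sum.inl.inj h⟩

theorem glueMap_eq_glueMap {i i' : ι} {x : X i} {x' : X i'}
    (h : glueMap t f i x = glueMap t f i' x') :
    (∃ a a', f i a = x ∧ f i' a' = x' ∧ t i a = t i' a') ∨
      ((¬ ∃ a, f i a = x) ∧ (⟨i, x⟩ : Σ i, X i) = ⟨i', x'⟩) := by
  by_cases hx : ∃ a, f i a = x
  · left
    have e : glueMap t f i x = .inl (t i hx.choose) := dif_pos hx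
    obtain ⟨a', h1, h2⟩ := glueMap_eq_inl (h.symm.trans e)
    exact ⟨hx.choose, a', hx.choose_spec, h1, h2.symm⟩
  · right
    refine ⟨hx, ?_⟩
    rw [glueMap_of_not hx] at h
    by_cases hx' : ∃ a, f i' a = x'
    · have e : glueMap t f i' x' = .inl (t i' hx'.choose) := dif_pos hx'
      rw [e] at h
      cases h
    · rw [glueMap_of_not hx'] at h
      have h := Sum.inr.inj h
      cases h
      rfl

/-- If the maps `f i` are injective, `Glue` is the quotient that identifies `t i a` with `f i a`. -/
def glueEquiv (hf : ∀ i, Function.Injective (f i)) :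
    Quot (fun x y : Y ⊕ Σ i, X i => ∃ i a, x = .inl (t i a) ∧ y = .inr ⟨i, f i a⟩) ≃ Glue Y f where
  toFun := Quot.lift (fun x => match x with | .inl y => .inl y | .inr x => glueMap t f x.1 x.2) (by
    rintro x y ⟨i, a, rfl, rfl⟩
    exact (glueMap_apply hf i a).symm)
  invFun x := match x with
    | .inl y => Quot.mk _ (.inl y)
    | .inr x => Quot.mk _ (.inr ⟨x.1, x.2.1⟩)
  left_inv := by
    intro x
    induction x using Quot.ind with
    | _ x =>
    rcases x with y | ⟨i, x⟩
    · rfl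
    · by_cases h : ∃ a, f i a = x
      · obtain ⟨a, rfl⟩ := h
        simp only [glueMap_apply hf]
        exact Quot.sound ⟨i, a, rfl, rfl⟩
      · simp only [glueMap_of_not h]
  right_inv := by
    rintro (y | ⟨i, x, hx⟩)
    · rfl
    · exact glueMap_of_not hx

/-- Gluing along injections removes one element for each element of the `A i`. -/
theorem card_glue [Finite ι] [Finite Y] [∀ i, Finite (X i)] [∀ i, Finite (A i)]
    (hf : ∀ i, Function.Injective (f i)) [Fintype ι] :
    Nat.card (Glue Y f) + ∑ i, Nat.card (A i) = Nat.card Y + ∑ i, Nat.card (X i) := by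
  have h : ∀ i, Nat.card {x : X i // ¬ ∃ a, f i a = x} + Nat.card (A i) = Nat.card (X i) := by
    intro i
    classical
    have := Fintype.ofFinite (X i)
    have h1 : Nat.card (A i) = Nat.card {x : X i // ∃ a, f i a = x} :=
      Nat.card_congr (Equiv.ofInjective (f i) (hf i))
    rw [h1]
    simp only [Nat.card_eq_fintype_card]
    rw [Fintype.card_subtype_compl]
    have := Fintype.card_subtype_le (fun x : X i => ∃ a, f i a = x)
    omega
  rw [Nat.card_sum, Nat.card_sigma, add_assoc, ← Finset.sum_add_distrib]
  congr 1
  exact Finset.sum_congr rfl fun i _ => h i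

end Glue

section Comp

variable {ι : Type} {κ : ι → Type} {c : ι → Col} {d : ∀ i, κ i → Col} {c₀ : Col}
  (T : Tangle c c₀) (S : ∀ i, Tangle (d i) (c i))

/-- The map from the curves of an inserted tangle to the curves of the composite. -/
def compCurve (i : ι) : (S i).Curve → Glue T.Curve (fun i => (S i).outCurve) :=
  glueMap T.inCurve (fun i => (S i).outCurve) i

/-- The map from the regions of an inserted tangle to the regions of the composite. -/
def compRegion (i : ι) : (S i).Region → Glue T.Region (fun i => (S i).outRegion) :=
  glueMap T.inRegion (fun i => (S i).outRegion) i

/-- The unshaded side of a curve of the composite. -/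
def compWhite : Glue T.Curve (fun i => (S i).outCurve) → Glue T.Region (fun i => (S i).outRegion)
  | .inl x => .inl (T.white x)
  | .inr x => compRegion T S x.1 ((S x.1).white x.2.1)

/-- The shaded side of a curve of the composite. -/
def compBlack : Glue T.Curve (fun i => (S i).outCurve) → Glue T.Region (fun i => (S i).outRegion)
  | .inl x => .inl (T.black x)
  | .inr x => compRegion T S x.1 ((S x.1).black x.2.1)

/-- The shading of the regions of the composite. -/
def compShaded : Glue T.Region (fun i => (S i).outRegion) → Bool
  | .inl r => T.shaded r
  | .inr r => (S r.1).shaded r.2.1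

/-- The curve of the composite at a marked point of a remaining disc. -/
def compEnd : Ends (fun p : Σ i, κ i => d p.1 p.2) c₀ → Glue T.Curve (fun i => (S i).outCurve)
  | .inl p => compCurve T S p.1.1 ((S p.1.1).inCurve p.1.2 p.2)
  | .inr j => .inl (T.outCurve j)

/-- The region of the composite at a boundary arc of a remaining disc. -/
def compArc : Arcs (fun p : Σ i, κ i => d p.1 p.2) c₀ → Glue T.Region (fun i => (S i).outRegion)
  | .inl p => compRegion T S p.1.1 ((S p.1.1).inRegion p.1.2 p.2)
  | .inr a => .inl (T.outRegion a)

variable {T S}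

theorem compCurve_eq_inl {i : ι} {x : (S i).Curve} {y : T.Curve}
    (h : compCurve T S i x = .inl y) : ∃ j, (S i).outCurve j = x ∧ T.inCurve i j = y :=
  glueMap_eq_inl h

theorem compCurve_eq {i i' : ι} {x : (S i).Curve} {x' : (S i').Curve}
    (h : compCurve T S i x = compCurve T S i' x') :
    (∃ j j', (S i).outCurve j = x ∧ (S i').outCurve j' = x' ∧
        T.inCurve i j = T.inCurve i' j') ∨
      (⟨i, x⟩ : Σ i, (S i).Curve) = ⟨i', x'⟩ :=
  (glueMap_eq_glueMap h).imp id And.right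

theorem compRegion_eq {i i' : ι} {x : (S i).Region} {x' : (S i').Region}
    (h : compRegion T S i x = compRegion T S i' x') :
    (∃ a a', (S i).outRegion a = x ∧ (S i').outRegion a' = x' ∧
        T.inRegion i a = T.inRegion i' a') ∨
      (⟨i, x⟩ : Σ i, (S i).Region) = ⟨i', x'⟩ :=
  (glueMap_eq_glueMap h).imp id And.right

variable (hS : ∀ i, (S i).IsTight)

include hS

theorem compCurve_out (i : ι) (j : (c i).Pt) :
    compCurve T S i ((S i).outCurve j) = .inl (T.inCurve i j) :=
  glueMap_apply (fun i => (hS i).outCurve_inj) i j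

theorem compRegion_out (i : ι) (a : (c i).Arc) :
    compRegion T S i ((S i).outRegion a) = .inl (T.inRegion i a) :=
  glueMap_apply (fun i => (hS i).outRegion_inj) i a

theorem compWhite_curve (i : ι) (x : (S i).Curve) :
    compWhite T S (compCurve T S i x) = compRegion T S i ((S i).white x) := by
  by_cases h : ∃ j, (S i).outCurve j = x
  · obtain ⟨j, rfl⟩ := h
    rw [compCurve_out hS, (S i).white_out, compRegion_out hS]
    exact congrArg Sum.inl (T.white_in i j)
  · rw [compCurve, glueMap_of_not h]
    rfl

theorem compBlack_curve (i : ι) (x : (S i).Curve) :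
    compBlack T S (compCurve T S i x) = compRegion T S i ((S i).black x) := by
  by_cases h : ∃ j, (S i).outCurve j = x
  · obtain ⟨j, rfl⟩ := h
    rw [compCurve_out hS, (S i).black_out, compRegion_out hS]
    exact congrArg Sum.inl (T.black_in i j)
  · rw [compCurve, glueMap_of_not h]
    rfl

theorem compShaded_region (i : ι) (r : (S i).Region) :
    compShaded T S (compRegion T S i r) = (S i).shaded r := by
  by_cases h : ∃ a, (S i).outRegion a = r
  · obtain ⟨a, rfl⟩ := h
    rw [compRegion_out hS, (S i).shaded_out]
    exact T.shaded_in i a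
  · rw [compRegion, glueMap_of_not h]
    rfl

theorem compArc_white (p : Ends (fun p : Σ i, κ i => d p.1 p.2) c₀) :
    compArc T S (endWhite p) = compWhite T S (compEnd T S p) := by
  rcases p with p | j
  · exact (congrArg _ ((S p.1.1).white_in p.1.2 p.2).symm).trans (compWhite_curve hS _ _).symm
  · exact congrArg Sum.inl (T.white_out j).symm

theorem compArc_black (p : Ends (fun p : Σ i, κ i => d p.1 p.2) c₀) :
    compArc T S (endBlack p) = compBlack T S (compEnd T S p) := by
  rcases p with p | j
  · exact (congrArg _ ((S p.1.1).black_in p.1.2 p.2).symm).trans (compBlack_curve hS _ _).symm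
  · exact congrArg Sum.inl (T.black_out j).symm

omit hS in
/-- By orientation, a string from an internal disc to the external disc joins points of the same
parity. -/
theorem parity_of_eq_out (T : Tangle c c₀) {p : Σ i, (c i).Pt} {j : c₀.Pt}
    (h : T.curveAt p = T.outCurve j) : p.2.val % 2 = j.val % 2 := by
  have := T.source_ne (p := .inl p) (q := .inr j) h Sum.inl_ne_inr
  simp only [isSource] at this
  rw [← mod_beq_zero, this]
  rcases Nat.mod_two_eq_zero_or_one j.val with h | h <;> simp [h]

omit hS in
/-- A string of the composite has at most one end of each orientation. -/
theorem compEnd_inj (p q : Ends (fun p : Σ i, κ i => d p.1 p.2) c₀)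
    (h : compEnd T S p = compEnd T S q) (hs : isSource p = isSource q) : p = q := by
  have hpar : ∀ (p : Σ x : (Σ i, κ i), (d x.1 x.2).Pt) (j : (c p.1.1).Pt),
      (S p.1.1).outCurve j = (S p.1.1).inCurve p.1.2 p.2 →
        isSource (c := c) (c₀ := c₀) (.inl ⟨p.1.1, j⟩) =
          isSource (c := d p.1.1) (c₀ := c p.1.1) (.inl ⟨p.1.2, p.2⟩) := by
    intro p j h
    exact (mod_beq_zero _ _).2 (parity_of_eq_out (S p.1.1) (p := ⟨p.1.2, p.2⟩) h.symm).symm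
  rcases p with ⟨⟨i, k⟩, p⟩ | p <;> rcases q with ⟨⟨i', k'⟩, q⟩ | q
  · rcases compCurve_eq h with ⟨j, j', h1, h2, h3⟩ | h1
    · have e := T.end_inj (p := .inl ⟨i, j⟩) (q := .inl ⟨i', j'⟩) h3
        ((hpar ⟨⟨i, k⟩, p⟩ j h1).trans (hs.trans (hpar ⟨⟨i', k'⟩, q⟩ j' h2).symm))
      have e := Sum.inl.inj e
      cases e
      have e := (S i).end_inj (p := .inl ⟨k, p⟩) (q := .inl ⟨k', q⟩) (h1.symm.trans h2) hs
      have e := Sum.inl.inj e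
      cases e
      rfl
    · obtain ⟨rfl, h1⟩ := Sigma.mk.inj h1
      have e := (S i).end_inj (p := .inl ⟨k, p⟩) (q := .inl ⟨k', q⟩) (eq_of_heq h1) hs
      have e := Sum.inl.inj e
      cases e
      rfl
  · obtain ⟨j, h1, h2⟩ := compCurve_eq_inl h
    have e := T.end_inj (p := .inl ⟨i, j⟩) (q := .inr q) h2 ((hpar ⟨⟨i, k⟩, p⟩ j h1).trans hs)
    cases e
  · obtain ⟨j, h1, h2⟩ := compCurve_eq_inl h.symm
    have e := T.end_inj (p := .inl ⟨i', j⟩) (q := .inr p) h2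
      ((hpar ⟨⟨i', k'⟩, q⟩ j h1).trans hs.symm)
    cases e
  · exact congrArg Sum.inr (Sum.inr.inj (T.end_inj (p := .inr p) (q := .inr q) (Sum.inl.inj h) hs))

/-- Every marked point of the composite has a partner: a string of `T` continues into the inserted
tangles, and there it ends on an internal disc. -/
theorem compEnd_ex (p : Ends (fun p : Σ i, κ i => d p.1 p.2) c₀) :
    ∃ q, q ≠ p ∧ compEnd T S q = compEnd T S p := by
  -- `lift`: follow the string of `T` at `P` into the inserted tangle, up to a remaining disc
  have lift : ∀ P : Ends c c₀, ∃ p, compEnd T S p = .inl (T.endAt P) ∧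
      (∀ i k j, p = .inl ⟨⟨i, k⟩, j⟩ → ∃ j', P = .inl ⟨i, j'⟩ ∧
        (S i).inCurve k j = (S i).outCurve j') ∧ (∀ j, p = .inr j → P = .inr j) := by
    rintro (⟨i, j⟩ | j)
    · obtain ⟨⟨k, q⟩, hq, -⟩ := (hS i).exists_in j
      refine ⟨.inl ⟨⟨i, k⟩, q⟩, ?_, ?_, ?_⟩
      · exact (congrArg (compCurve T S i) hq).trans (compCurve_out hS i j)
      · rintro i' k' j' h
        cases h
        exact ⟨j, rfl, hq⟩
      · rintro _ h
        cases h
    · refine ⟨.inr j, rfl, ?_, ?_⟩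
      · rintro _ _ _ h
        cases h
      · rintro j' h
        cases h
        rfl
  rcases p with ⟨⟨i, k⟩, p⟩ | p
  · by_cases h : ∃ j, (S i).outCurve j = (S i).inCurve k p
    · obtain ⟨j, hj⟩ := h
      obtain ⟨Q, hQ, hQ'⟩ := T.exists_partner (.inl ⟨i, j⟩)
      obtain ⟨q, h1, h2, -⟩ := lift Q
      refine ⟨q, ?_, ?_⟩
      · rintro rfl
        obtain ⟨j', rfl, hj'⟩ := h2 _ _ _ rfl
        exact hQ (by rw [(hS i).outCurve_inj (hj.trans hj')])
      · rw [h1, hQ']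
        exact (compCurve_out hS i j).symm.trans (congrArg (compCurve T S i) hj)
    · obtain ⟨⟨k', q⟩ | q, hq, hq'⟩ := (S i).exists_partner (.inl ⟨k, p⟩)
      · refine ⟨.inl ⟨⟨i, k'⟩, q⟩, ?_, congrArg (compCurve T S i) hq'⟩
        intro e
        cases e
        exact hq rfl
      · exact absurd ⟨q, hq'⟩ h
  · obtain ⟨Q, hQ, hQ'⟩ := T.exists_partner (.inr p)
    obtain ⟨q, h1, -, h3⟩ := lift Q
    refine ⟨q, ?_, ?_⟩
    · rintro rfl
      exact hQ (h3 _ rfl)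
    · rw [h1, hQ']
      rfl

/-- The composite is connected: the regions of an inserted tangle are connected with each other, and
with a region of `T`, as the tangle has an external boundary arc. -/
theorem comp_connected (hc : ∀ i, 0 < (c i).size)
    (r s : Glue T.Region (fun i => (S i).outRegion)) :
    Relation.EqvGen (fun r s => ∃ x, compWhite T S x = r ∧ compBlack T S x = s) r s := by
  have hT : ∀ r s : T.Region, Relation.EqvGen
      (fun r s => ∃ x, compWhite T S x = r ∧ compBlack T S x = s) (.inl r) (.inl s) := by
    intro r s
    have h := T.connected r s
    induction h with
    | rel r s h =>
      obtain ⟨x, rfl, rfl⟩ := h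
      exact .rel _ _ ⟨.inl x, rfl, rfl⟩
    | refl r => exact .refl _
    | symm r s _ ih => exact .symm _ _ ih
    | trans r s t _ _ ih1 ih2 => exact .trans _ _ _ ih1 ih2
  have hSi : ∀ i, ∀ r s : (S i).Region, Relation.EqvGen
      (fun r s => ∃ x, compWhite T S x = r ∧ compBlack T S x = s)
      (compRegion T S i r) (compRegion T S i s) := by
    intro i r s
    have h := (S i).connected r s
    induction h with
    | rel r s h =>
      obtain ⟨x, rfl, rfl⟩ := h
      exact .rel _ _ ⟨compCurve T S i x, compWhite_curve hS i x, compBlack_curve hS i x⟩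
    | refl r => exact .refl _
    | symm r s _ ih => exact .symm _ _ ih
    | trans r s t _ _ ih1 ih2 => exact .trans _ _ _ ih1 ih2
  have key : ∀ r, ∃ r₀ : T.Region, Relation.EqvGen
      (fun r s => ∃ x, compWhite T S x = r ∧ compBlack T S x = s) r (.inl r₀) := by
    rintro (r | ⟨i, r, hr⟩)
    · exact ⟨r, .refl _⟩
    · have a : (c i).Arc := ⟨0, by have := hc i; omega⟩
      refine ⟨T.inRegion i a, ?_⟩
      have h := hSi i r ((S i).outRegion a)
      rw [compRegion_out hS, compRegion, glueMap_of_not hr] at h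
      exact h
  obtain ⟨r₀, h1⟩ := key r
  obtain ⟨s₀, h2⟩ := key s
  exact .trans _ _ _ h1 (.trans _ _ _ (hT r₀ s₀) (.symm _ _ h2))

theorem compArc_surj (hT : T.IsTight) (r : Glue T.Region (fun i => (S i).outRegion)) :
    ∃ a, compArc T S (.inl a) = r := by
  have h : ∀ i, ∀ r : (S i).Region, ∃ a, compArc T S (.inl a) = compRegion T S i r := by
    intro i r
    obtain ⟨⟨k, a⟩, rfl⟩ := (hS i).region r
    exact ⟨⟨⟨i, k⟩, a⟩, rfl⟩
  rcases r with r | ⟨i, r, hr⟩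
  · obtain ⟨⟨i, a⟩, rfl⟩ := hT.region r
    obtain ⟨b, hb⟩ := h i ((S i).outRegion a)
    exact ⟨b, hb.trans (compRegion_out hS i a)⟩
  · obtain ⟨b, hb⟩ := h i r
    exact ⟨b, hb.trans (glueMap_of_not hr)⟩

theorem compEnd_surj (hT : T.IsTight) (x : Glue T.Curve (fun i => (S i).outCurve)) :
    ∃ p, compEnd T S (.inl p) = x := by
  have h : ∀ i, ∀ x : (S i).Curve, ∃ p, compEnd T S (.inl p) = compCurve T S i x := by
    intro i x
    obtain ⟨⟨k, a⟩, rfl⟩ := (hS i).curve x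
    exact ⟨⟨⟨i, k⟩, a⟩, rfl⟩
  rcases x with x | ⟨i, x, hx⟩
  · obtain ⟨⟨i, a⟩, rfl⟩ := hT.curve x
    obtain ⟨b, hb⟩ := h i ((S i).outCurve a)
    exact ⟨b, hb.trans (compCurve_out hS i a)⟩
  · obtain ⟨b, hb⟩ := h i x
    exact ⟨b, hb.trans (glueMap_of_not hx)⟩

/-- The circuits of the composite: a circuit of `T` lifts to the composite since each string that
leaves an inserted tangle has its other end on an internal disc of that tangle. -/
theorem comp_circuit (hT : T.IsTight) (a b : Σ p : (Σ i, κ i), (d p.1 p.2).Arc)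
    (h : compArc T S (.inl a) = compArc T S (.inl b)) :
    Relation.EqvGen (InStep fun p => compEnd T S (.inl p)) a b := by
  have inS : ∀ i (u v : Σ k, (d i k).Arc), (S i).regionAt u = (S i).regionAt v →
      Relation.EqvGen (InStep fun p => compEnd T S (.inl p)) ⟨⟨i, u.1⟩, u.2⟩ ⟨⟨i, v.1⟩, v.2⟩ := by
    intro i u v h
    replace h := (hS i).circuit u v h
    induction h with
    | rel u v h =>
      obtain ⟨p, q, hpq, h⟩ := h
      refine .rel _ _ ⟨⟨⟨i, p.1⟩, p.2⟩, ⟨⟨i, q.1⟩, q.2⟩, congrArg (compCurve T S i) hpq, ?_⟩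
      rcases h with ⟨rfl, rfl⟩ | ⟨rfl, rfl⟩
      · exact .inl ⟨rfl, rfl⟩
      · exact .inr ⟨rfl, rfl⟩
    | refl u => exact .refl _
    | symm u v _ ih => exact .symm _ _ (ih)
    | trans u v w _ _ ih1 ih2 => exact .trans _ _ _ (ih1) (ih2)
  have inT : ∀ A B : Σ i, (c i).Arc, Relation.EqvGen (InStep T.curveAt) A B →
      ∀ (u : Σ k, (d A.1 k).Arc) (v : Σ k, (d B.1 k).Arc),
        (S A.1).regionAt u = (S A.1).outRegion A.2 → (S B.1).regionAt v = (S B.1).outRegion B.2 →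
        Relation.EqvGen (InStep fun p => compEnd T S (.inl p))
          ⟨⟨A.1, u.1⟩, u.2⟩ ⟨⟨B.1, v.1⟩, v.2⟩ := by
    intro A B h
    induction h with
    | rel A B h =>
      obtain ⟨P, Q, hPQ, h⟩ := h
      obtain ⟨p, hp, -⟩ := (hS P.1).exists_in P.2
      obtain ⟨q, hq, -⟩ := (hS Q.1).exists_in Q.2
      have e : compEnd T S (.inl ⟨⟨P.1, p.1⟩, p.2⟩) = compEnd T S (.inl ⟨⟨Q.1, q.1⟩, q.2⟩) := by
        refine (congrArg (compCurve T S P.1) hp).trans ?_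
        refine Eq.trans ?_ (congrArg (compCurve T S Q.1) hq).symm
        rw [compCurve_out hS, compCurve_out hS]
        exact congrArg Sum.inl hPQ
      rcases h with ⟨rfl, rfl⟩ | ⟨rfl, rfl⟩
      · intro u v hu hv
        refine .trans _ _ _ (inS P.1 u ⟨p.1, Col.whiteArc p.2⟩ ?_)
          (.trans _ _ _ (.rel _ _ ⟨_, _, e, .inl ⟨rfl, rfl⟩⟩)
            (inS Q.1 ⟨q.1, Col.whiteArc q.2⟩ v ?_))
        · rw [hu, regionAt_whiteArc, hp, ← (S P.1).white_out]
        · rw [hv, regionAt_whiteArc, hq, ← (S Q.1).white_out]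
      · intro u v hu hv
        refine .trans _ _ _ (inS P.1 u ⟨p.1, Col.blackArc p.2⟩ ?_)
          (.trans _ _ _ (.rel _ _ ⟨_, _, e, .inr ⟨rfl, rfl⟩⟩)
            (inS Q.1 ⟨q.1, Col.blackArc q.2⟩ v ?_))
        · rw [hu, regionAt_blackArc, hp, ← (S P.1).black_out]
        · rw [hv, regionAt_blackArc, hq, ← (S Q.1).black_out]
    | refl A =>
      intro u v hu hv
      exact inS A.1 u v (hu.trans hv.symm)
    | symm A B _ ih =>
      intro u v hu hv
      exact .symm _ _ (ih v u hv hu)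
    | trans A B C _ _ ih1 ih2 =>
      intro u v hu hv
      obtain ⟨w, hw⟩ := (hS B.1).region ((S B.1).outRegion B.2)
      exact .trans _ _ _ (ih1 u w hu hw) (ih2 w v hw hv)
  obtain ⟨⟨i, k⟩, a⟩ := a
  obtain ⟨⟨i', k'⟩, b⟩ := b
  rcases compRegion_eq h with ⟨A, B, h1, h2, h3⟩ | h1
  · exact inT ⟨i, A⟩ ⟨i', B⟩ (hT.circuit _ _ h3) ⟨k, a⟩ ⟨k', b⟩ h1.symm h2.symm
  · obtain ⟨rfl, h1⟩ := Sigma.mk.inj h1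
    exact inS i ⟨k, a⟩ ⟨k', b⟩ (eq_of_heq h1)

/-- Euler's formula for the composite is the sum of those of its parts: gluing along a disc with
`2 * r > 0` marked points removes as many curves as regions, and since an inserted tangle has
`discs + regions = 1 + curves`, the balance is kept when it replaces a disc of `T`. -/
theorem comp_count [Finite ι] [∀ i, Finite (κ i)] (hT : T.IsTight) (hc : ∀ i, 0 < (c i).size) :
    Nat.card (Σ i, κ i) + 1 + Nat.card (Glue T.Region (fun i => (S i).outRegion)) =
      2 + Nat.card (Glue T.Curve (fun i => (S i).outCurve)) + if c₀.size = 0 then 1 else 0 := by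
  have := Fintype.ofFinite ι
  have := T.finite_curve
  have := T.finite_region
  have := fun i => (S i).finite_curve
  have := fun i => (S i).finite_region
  have h1 := card_glue (Y := T.Curve) (f := fun i => (S i).outCurve) (fun i => (hS i).outCurve_inj)
  have h2 := card_glue (Y := T.Region) (f := fun i => (S i).outRegion)
    (fun i => (hS i).outRegion_inj)
  have h3 := hT.count
  have h4 : ∀ i, Nat.card (κ i) + 1 + Nat.card (S i).Region + Nat.card (c i).Pt =
      2 + Nat.card (S i).Curve + Nat.card (c i).Arc := by
    intro i
    have h := (hS i).count
    have hi := hc i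
    rw [if_neg (by omega)] at h
    simp only [Nat.card_eq_fintype_card, Fintype.card_fin] at h ⊢
    omega
  have h5 := Finset.sum_congr (rfl : (Finset.univ : Finset ι) = _) (fun i _ => h4 i)
  simp only [Finset.sum_add_distrib, Finset.sum_const, smul_eq_mul] at h5
  rw [Nat.card_sigma]
  rw [Nat.card_eq_fintype_card, ← Finset.card_univ] at h3
  omega

/-- The composite of tight tangles, where all the internal discs of `T` have marked points. -/
def comp [Finite ι] [∀ i, Finite (κ i)] (hT : T.IsTight) (hc : ∀ i, 0 < (c i).size) :
    Tangle (fun p : Σ i, κ i => d p.1 p.2) c₀ where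
  Curve := Glue T.Curve (fun i => (S i).outCurve)
  Region := Glue T.Region (fun i => (S i).outRegion)
  finite_curve := by
    have := T.finite_curve
    have := fun i => (S i).finite_curve
    infer_instance
  finite_region := by
    have := T.finite_region
    have := fun i => (S i).finite_region
    infer_instance
  inCurve p j := compEnd T S (.inl ⟨p, j⟩)
  outCurve j := compEnd T S (.inr j)
  inRegion p a := compArc T S (.inl ⟨p, a⟩)
  outRegion a := compArc T S (.inr a)
  shaded := compShaded T S
  white := compWhite T S
  black := compBlack T S
  shaded_white := by
    rintro (x | ⟨i, x, hx⟩)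
    · exact T.shaded_white x
    · exact (compShaded_region hS i _).trans ((S i).shaded_white x)
  shaded_black := by
    rintro (x | ⟨i, x, hx⟩)
    · exact T.shaded_black x
    · exact (compShaded_region hS i _).trans ((S i).shaded_black x)
  shaded_in p a := (compShaded_region hS p.1 _).trans ((S p.1).shaded_in p.2 a)
  shaded_out a := T.shaded_out a
  white_in p j := (compArc_white hS (.inl ⟨p, j⟩)).symm
  black_in p j := (compArc_black hS (.inl ⟨p, j⟩)).symm
  white_out j := (compArc_white hS (.inr j)).symm
  black_out j := (compArc_black hS (.inr j)).symm
  two_ends := by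
    rw [endMap_eta (compEnd T S)]
    exact two_ends_of _ compEnd_inj (compEnd_ex hS)
  connected := comp_connected hS hc
  euler := by
    have := T.finite_region
    have := fun i => (S i).finite_region
    rw [endMap_eta (compEnd T S), no_loops _ (fun x => by
      obtain ⟨p, hp⟩ := compEnd_surj hS hT x
      exact ⟨_, hp⟩)]
    rw [card_circuits_eq (compEnd T S) (compArc T S)
      (fun p q h => by rw [compArc_white hS, compArc_white hS, h])
      (fun p q h => by rw [compArc_black hS, compArc_black hS, h])
      (compArc_surj hS hT) (comp_circuit hS hT) (fun j => by
        obtain ⟨⟨i, p⟩, hp, -⟩ := hT.exists_in j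
        obtain ⟨⟨k, q⟩, hq, -⟩ := (hS i).exists_in p
        refine ⟨⟨⟨i, k⟩, q⟩, ?_⟩
        refine (congrArg (compCurve T S i) hq).trans ?_
        rw [compCurve_out hS]
        exact congrArg Sum.inl hp)]
    have := comp_count hS hT hc
    omega

variable [Finite ι] [∀ i, Finite (κ i)] (hT : T.IsTight) (hc : ∀ i, 0 < (c i).size)

theorem comp_isTight : (comp hS hT hc).IsTight where
  curve := compEnd_surj hS hT
  region := compArc_surj hS hT
  circuit := comp_circuit hS hT
  outCurve_inj _ _ h := hT.outCurve_inj (Sum.inl.inj h)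
  outRegion_inj _ _ h := hT.outRegion_inj (Sum.inl.inj h)

theorem comp_isComposite : IsComposite T S (comp hS hT hc) := by
  refine ⟨glueEquiv (fun i => (hS i).outCurve_inj), glueEquiv (fun i => (hS i).outRegion_inj),
    fun _ => rfl, fun _ _ _ => rfl, fun _ => rfl, fun _ _ _ => rfl, fun _ => rfl, fun _ => rfl,
    ?_, ?_⟩
  · exact fun i x => (compWhite_curve hS i x).symm
  · exact fun i x => (compBlack_curve hS i x).symm

end Comp

/-! ### Reflection and renaming of tangles -/

section Transport

variable {ι ι' : Type} {c : ι → Col} {c' : ι' → Col} {c₀ c₀' : Col}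

/-- The condition on the ends of strings is invariant under a renaming `β` of the marked points that
keeps all orientations, or reverses all of them. -/
theorem two_ends_transport (T : Tangle c' c₀') (β : Ends c c₀ ≃ Ends c' c₀')
    (hs : ∀ p q, isSource p = isSource q → isSource (β p) = isSource (β q)) (p : Ends c c₀) :
    ∃! q, T.endAt (β q) = T.endAt (β p) ∧ isSource q = !isSource p := by
  refine two_ends_of (fun p => T.endAt (β p)) ?_ ?_ p
  · exact fun p q h h' => β.injective (T.end_inj h (hs p q h'))
  · intro p
    obtain ⟨q, h1, h2⟩ := T.exists_partner (β p)
    refine ⟨β.symm q, ?_, ?_⟩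
    · rintro rfl
      exact h1 (β.apply_symm_apply q).symm
    · simpa using h2

/-- Euler's formula is invariant under a renaming of the marked points and arcs which respects the
sides of the strings. -/
theorem euler_transport (T : Tangle c' c₀') (hι : Nat.card ι = Nat.card ι')
    (β : Ends c c₀ ≃ Ends c' c₀') (α : Arcs c c₀ ≃ Arcs c' c₀')
    (hw : ∀ p, α (endWhite p) = endWhite (β p)) (hb : ∀ p, α (endBlack p) = endBlack (β p)) :
    (Nat.card ι + 1) + 2 * Nat.card T.Region =
      2 + Nat.card T.Curve + Nat.card {x : T.Curve // ∀ p, T.endAt (β p) ≠ x} +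
        Nat.card (Quot (ArcStep fun p => T.endAt (β p))) := by
  have h1 : Nat.card (Quot (ArcStep fun p => T.endAt (β p))) =
      Nat.card (Quot (ArcStep T.endAt)) := by
    refine Nat.card_congr (Quot.congr α fun a b => ⟨?_, ?_⟩)
    · rintro ⟨p, q, h, ⟨rfl, rfl⟩ | ⟨rfl, rfl⟩⟩
      · exact ⟨β p, β q, h, .inl ⟨hw p, hw q⟩⟩
      · exact ⟨β p, β q, h, .inr ⟨hb p, hb q⟩⟩
    · rintro ⟨p, q, h, h'⟩
      obtain ⟨p, rfl⟩ := β.surjective p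
      obtain ⟨q, rfl⟩ := β.surjective q
      refine ⟨p, q, h, ?_⟩
      rw [← hw, ← hw, ← hb, ← hb] at h'
      simpa using h'
  have h2 : Nat.card {x : T.Curve // ∀ p, T.endAt (β p) ≠ x} =
      Nat.card {x : T.Curve // ∀ p, T.endAt p ≠ x} :=
    Nat.card_congr (Equiv.subtypeEquivRight fun x => β.forall_congr_left.trans (by simp))
  rw [h1, h2, hι]
  exact T.euler

end Transport

section Mirror

variable {ι : Type} {c : ι → Col} {c₀ : Col}

theorem revPt_revPt {c : Col} (j : c.Pt) : Col.revPt (Col.revPt j) = j := Fin.rev_rev j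

theorem revPt_val {c : Col} (j : c.Pt) : (Col.revPt j).val = 2 * c.size - 1 - j.val := by
  simp only [Col.revPt, Fin.val_rev]
  omega

theorem revArc_val {c : Col} (a : c.Arc) :
    (Col.revArc a).val = if a.val = 0 then 0 else 2 * c.size - a.val := by
  have ha := a.isLt
  simp only [Col.revArc]
  split_ifs with h
  · rw [h]
    by_cases hc : c.size = 0
    · rw [hc]
      rfl
    · rw [max_eq_right (by omega)]
      simp
  · exact Nat.mod_eq_of_lt (by omega)

theorem revArc_revArc {c : Col} (a : c.Arc) : Col.revArc (Col.revArc a) = a := by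
  have ha := a.isLt
  apply Fin.ext
  rw [revArc_val, revArc_val]
  split_ifs <;> omega

theorem revArc_whiteArc {c : Col} (j : c.Pt) :
    Col.revArc (Col.whiteArc j) = Col.whiteArc (Col.revPt j) := by
  have hj := j.isLt
  apply Fin.ext
  have h1 := Col.whiteArc_val j
  have h2 := Col.whiteArc_val (Col.revPt j)
  rw [revPt_val] at h2
  rw [revArc_val]
  split_ifs at h1 h2 ⊢ <;> omega

theorem revArc_blackArc {c : Col} (j : c.Pt) :
    Col.revArc (Col.blackArc j) = Col.blackArc (Col.revPt j) := by
  have hj := j.isLt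
  apply Fin.ext
  have h1 := Col.blackArc_val j
  have h2 := Col.blackArc_val (Col.revPt j)
  rw [revPt_val] at h2
  rw [revArc_val]
  split_ifs at h1 h2 ⊢ <;> omega

theorem shade_revArc {c : Col} (a : c.Arc) : c.shade (Col.revArc a).val = c.shade a.val := by
  have ha := a.isLt
  apply shade_congr
  rw [revArc_val]
  split_ifs <;> omega

/-- The reflection of the marked points of a disc. -/
def revPtEquiv (c : Col) : c.Pt ≃ c.Pt := ⟨Col.revPt, Col.revPt, revPt_revPt, revPt_revPt⟩

/-- The reflection of the boundary arcs of a disc; it fixes the arc `0`, which holds the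
distinguished interval. -/
def revArcEquiv (c : Col) : c.Arc ≃ c.Arc := ⟨Col.revArc, Col.revArc, revArc_revArc, revArc_revArc⟩

/-- The reflection of the marked points of all discs. -/
def revEnds : Ends c c₀ ≃ Ends c c₀ :=
  Equiv.sumCongr (Equiv.sigmaCongrRight fun i => revPtEquiv (c i)) (revPtEquiv c₀)

/-- The reflection of the boundary arcs of all discs. -/
def revArcs : Arcs c c₀ ≃ Arcs c c₀ :=
  Equiv.sumCongr (Equiv.sigmaCongrRight fun i => revArcEquiv (c i)) (revArcEquiv c₀)

theorem revArcs_white (p : Ends c c₀) : revArcs (endWhite p) = endWhite (revEnds p) := by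
  rcases p with ⟨i, p⟩ | p
  · exact congrArg (fun a => (Sum.inl ⟨i, a⟩ : Arcs c c₀)) (revArc_whiteArc p)
  · exact congrArg Sum.inr (revArc_whiteArc p)

theorem revArcs_black (p : Ends c c₀) : revArcs (endBlack p) = endBlack (revEnds p) := by
  rcases p with ⟨i, p⟩ | p
  · exact congrArg (fun a => (Sum.inl ⟨i, a⟩ : Arcs c c₀)) (revArc_blackArc p)
  · exact congrArg Sum.inr (revArc_blackArc p)

theorem isSource_revEnds (p : Ends c c₀) : isSource (revEnds p) = !isSource p := by
  rcases p with ⟨i, p⟩ | p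
  · refine (bool_mod _ _).2 ?_
    have hp : p.val < 2 * (c i).size := p.isLt
    change (Col.revPt p).val % 2 ≠ p.val % 2
    rw [revPt_val]
    omega
  · refine (bool_mod' _ _).2 ?_
    have hp := p.isLt
    change (Col.revPt p).val % 2 ≠ p.val % 2
    rw [revPt_val]
    omega

/-- The reflection of a tangle. -/
def mirror (T : Tangle c c₀) : Tangle c c₀ where
  Curve := T.Curve
  Region := T.Region
  finite_curve := T.finite_curve
  finite_region := T.finite_region
  inCurve i j := T.inCurve i (Col.revPt j)
  outCurve j := T.outCurve (Col.revPt j)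
  inRegion i a := T.inRegion i (Col.revArc a)
  outRegion a := T.outRegion (Col.revArc a)
  shaded := T.shaded
  white := T.white
  black := T.black
  shaded_white := T.shaded_white
  shaded_black := T.shaded_black
  shaded_in i a := (T.shaded_in i _).trans (shade_revArc a)
  shaded_out a := (T.shaded_out _).trans (shade_revArc a)
  white_in i j := by rw [T.white_in, revArc_whiteArc]
  black_in i j := by rw [T.black_in, revArc_blackArc]
  white_out j := by rw [T.white_out, revArc_whiteArc]
  black_out j := by rw [T.black_out, revArc_blackArc]
  two_ends := by
    have e : endMap (fun i j => T.inCurve i (Col.revPt j)) (fun j => T.outCurve (Col.revPt j)) =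
        fun p => T.endAt (revEnds p) := by
      funext p
      rcases p with p | p <;> rfl
    rw [e]
    exact two_ends_transport T revEnds fun p q h => by
      rw [isSource_revEnds, isSource_revEnds, h]
  connected := T.connected
  euler := by
    have e : endMap (fun i j => T.inCurve i (Col.revPt j)) (fun j => T.outCurve (Col.revPt j)) =
        fun p => T.endAt (revEnds p) := by
      funext p
      rcases p with p | p <;> rfl
    rw [e]
    exact euler_transport T rfl revEnds revArcs revArcs_white revArcs_black

theorem mirror_isMirror (T : Tangle c c₀) : IsMirror T T.mirror := by
  refine ⟨Equiv.refl _, Equiv.refl _, ?_, ?_, ?_, ?_, fun _ => rfl, fun _ => rfl⟩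
  · exact fun i j => congrArg (T.inCurve i) (revPt_revPt j).symm
  · exact fun j => congrArg T.outCurve (revPt_revPt j).symm
  · exact fun i j => congrArg (T.inRegion i) (revArc_revArc j).symm
  · exact fun j => congrArg T.outRegion (revArc_revArc j).symm

theorem mirror_isTight {T : Tangle c c₀} (h : T.IsTight) : T.mirror.IsTight where
  curve x := by
    obtain ⟨p, hp⟩ := h.curve x
    exact ⟨⟨p.1, Col.revPt p.2⟩, (congrArg (T.inCurve p.1) (revPt_revPt p.2)).trans hp⟩
  region x := by
    obtain ⟨p, hp⟩ := h.region x
    exact ⟨⟨p.1, Col.revArc p.2⟩, (congrArg (T.inRegion p.1) (revArc_revArc p.2)).trans hp⟩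
  circuit := by
    have key : ∀ a b, Relation.EqvGen (InStep T.curveAt) a b →
        Relation.EqvGen (InStep T.mirror.curveAt) ⟨a.1, Col.revArc a.2⟩ ⟨b.1, Col.revArc b.2⟩ := by
      intro a b h
      induction h with
      | rel a b h =>
        obtain ⟨p, q, h1, h2⟩ := h
        refine .rel _ _ ⟨⟨p.1, Col.revPt p.2⟩, ⟨q.1, Col.revPt q.2⟩, ?_, ?_⟩
        · refine (congrArg (T.inCurve p.1) (revPt_revPt p.2)).trans (h1.trans ?_)
          exact (congrArg (T.inCurve q.1) (revPt_revPt q.2)).symm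
        · rcases h2 with ⟨rfl, rfl⟩ | ⟨rfl, rfl⟩
          · left
            simp only [revArc_whiteArc, and_self]
          · right
            simp only [revArc_blackArc, and_self]
      | refl a => exact .refl _
      | symm a b _ ih => exact .symm _ _ ih
      | trans a b d _ _ ih1 ih2 => exact .trans _ _ _ ih1 ih2
    intro a b hab
    have := key _ _ (h.circuit ⟨a.1, Col.revArc a.2⟩ ⟨b.1, Col.revArc b.2⟩ hab)
    simpa only [revArc_revArc] using this
  outCurve_inj a b hab := by
    have := congrArg Col.revPt (h.outCurve_inj hab)
    simpa only [revPt_revPt] using this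
  outRegion_inj a b hab := by
    have := congrArg Col.revArc (h.outRegion_inj hab)
    simpa only [revArc_revArc] using this

end Mirror

section Reindex

variable {ι ι' : Type} {c : ι → Col} {c' : ι' → Col} {c₀ : Col}

/-- The tangle with its internal discs renamed. -/
def reindex (e : ι ≃ ι') (T : Tangle c' c₀) : Tangle (fun i => c' (e i)) c₀ where
  Curve := T.Curve
  Region := T.Region
  finite_curve := T.finite_curve
  finite_region := T.finite_region
  inCurve i j := T.inCurve (e i) j
  outCurve j := T.outCurve j
  inRegion i a := T.inRegion (e i) a
  outRegion a := T.outRegion a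
  shaded := T.shaded
  white := T.white
  black := T.black
  shaded_white := T.shaded_white
  shaded_black := T.shaded_black
  shaded_in i a := T.shaded_in (e i) a
  shaded_out a := T.shaded_out a
  white_in i j := T.white_in (e i) j
  black_in i j := T.black_in (e i) j
  white_out j := T.white_out j
  black_out j := T.black_out j
  two_ends := by
    have h : endMap (fun i j => T.inCurve (e i) j) T.outCurve = fun p => T.endAt
        (Equiv.sumCongr (Equiv.sigmaCongrLeft (β := fun i => (c' i).Pt) e) (Equiv.refl _) p) := by
      funext p
      rcases p with p | p <;> rfl
    change ∀ p, ∃! q, endMap (fun i j => T.inCurve (e i) j) T.outCurve q =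
      endMap (fun i j => T.inCurve (e i) j) T.outCurve p ∧ _
    rw [h]
    refine two_ends_transport T _ fun p q h => ?_
    rcases p with p | p <;> rcases q with q | q <;> exact h
  connected := T.connected
  euler := by
    have h : endMap (fun i j => T.inCurve (e i) j) T.outCurve = fun p => T.endAt
        (Equiv.sumCongr (Equiv.sigmaCongrLeft (β := fun i => (c' i).Pt) e) (Equiv.refl _) p) := by
      funext p
      rcases p with p | p <;> rfl
    have := euler_transport T (Nat.card_congr e)
      (Equiv.sumCongr (Equiv.sigmaCongrLeft (β := fun i => (c' i).Pt) e) (Equiv.refl _))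
      (Equiv.sumCongr (Equiv.sigmaCongrLeft (β := fun i => (c' i).Arc) e) (Equiv.refl _))
      (fun p => by rcases p with p | p <;> rfl) (fun p => by rcases p with p | p <;> rfl)
    rw [← h] at this
    simp only [fun p => (congrFun h p).symm] at this
    exact this

theorem reindex_isRelabelling (e : ι ≃ ι') (T : Tangle c' c₀) :
    IsRelabelling e (T.reindex e) T :=
  ⟨Equiv.refl _, Equiv.refl _, fun _ _ => rfl, fun _ => rfl, fun _ _ => rfl, fun _ => rfl,
    fun _ => rfl, fun _ => rfl⟩

end Reindex

/-! ### Tight tangles are determined by their matchings -/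

section Matching

variable {ι ι' : Type} {c : ι → Col} {c' : ι' → Col} {c₀ : Col}

/-- A string connects point `j` of the internal disc `i` with point `j'` of the internal disc
`i'`. -/
def JoinIn (T : Tangle c c₀) (i : ι) (j : ℕ) (i' : ι) (j' : ℕ) : Prop :=
  ∃ (h : j < 2 * (c i).size) (h' : j' < 2 * (c i').size),
    T.inCurve i ⟨j, h⟩ = T.inCurve i' ⟨j', h'⟩

/-- A string connects point `j` of the internal disc `i` with point `u` of the external disc. -/
def JoinOut (T : Tangle c c₀) (i : ι) (j : ℕ) (u : ℕ) : Prop :=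
  ∃ (h : j < 2 * (c i).size) (h' : u < 2 * c₀.size), T.inCurve i ⟨j, h⟩ = T.outCurve ⟨u, h'⟩

theorem JoinIn.symm {T : Tangle c c₀} {i i' : ι} {j j' : ℕ} (h : T.JoinIn i j i' j') :
    T.JoinIn i' j' i j := by
  obtain ⟨h1, h2, h3⟩ := h
  exact ⟨h2, h1, h3.symm⟩

/-- Every marked point of an internal disc has a common partner in the two tangles. -/
def SameMatching (e : ι ≃ ι') (T : Tangle c c₀) (T' : Tangle c' c₀) : Prop :=
  ∀ i j, j < 2 * (c i).size →
    (∃ i' j', (i = i' → j ≠ j') ∧ T.JoinIn i j i' j' ∧ T'.JoinIn (e i) j (e i') j') ∨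
    ∃ u, T.JoinOut i j u ∧ T'.JoinOut (e i) j u

/-- Tight tangles with the same matching of the marked points are isotopic, up to the position of
an external disc without marked points. -/
theorem exists_isotopy {e : ι ≃ ι'} {T : Tangle (fun i => c' (e i)) c₀} {T' : Tangle c' c₀}
    (hT : T.IsTight) (hT' : T'.IsTight) (hM : SameMatching e T T') :
    ∃ (φ : T.Curve ≃ T'.Curve) (ψ : T.Region ≃ T'.Region),
      (∀ i j, φ (T.inCurve i j) = T'.inCurve (e i) j) ∧
      (∀ j, φ (T.outCurve j) = T'.outCurve j) ∧
      (∀ i a, ψ (T.inRegion i a) = T'.inRegion (e i) a) ∧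
      (∀ x, ψ (T.white x) = T'.white (φ x)) ∧
      (∀ x, ψ (T.black x) = T'.black (φ x)) := by
  set E : Ends (fun i => c' (e i)) c₀ ≃ Ends c' c₀ :=
    Equiv.sumCongr (Equiv.sigmaCongrLeft (β := fun i => (c' i).Pt) e) (Equiv.refl _) with hE
  set F : (Σ i, (c' (e i)).Arc) ≃ Σ i, (c' i).Arc :=
    Equiv.sigmaCongrLeft (β := fun i => (c' i).Arc) e with hF
  -- every marked point has the same partner in `T` and in `T'`; for a point of the external disc,
  -- this is read off from its partner on an internal disc
  have partner_in : ∀ p : Σ i, (c' (e i)).Pt, ∃ q, q ≠ Sum.inl p ∧ T.endAt q = T.endAt (.inl p) ∧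
      T'.endAt (E q) = T'.endAt (E (.inl p)) := by
    rintro ⟨i, j⟩
    rcases hM i j.val j.isLt with
      ⟨i', j', hne, ⟨h1, h2, h3⟩, ⟨_, _, h4⟩⟩ | ⟨u, ⟨h1, h2, h3⟩, ⟨_, _, h4⟩⟩
    · refine ⟨.inl ⟨i', ⟨j', h2⟩⟩, ?_, h3.symm, h4.symm⟩
      intro h
      cases h
      exact hne rfl rfl
    · exact ⟨.inr ⟨u, h2⟩, Sum.inr_ne_inl, h3.symm, h4.symm⟩
  have partner : ∀ p, ∃ q, q ≠ p ∧ T.endAt q = T.endAt p ∧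
      T'.endAt (E q) = T'.endAt (E p) := by
    rintro (p | p)
    · exact partner_in p
    · obtain ⟨q, hq, -⟩ := hT.exists_in p
      obtain ⟨r, h1, h2, h3⟩ := partner_in q
      have : Sum.inr p = r := T.end_unique (p := .inl q) hq.symm h2 Sum.inr_ne_inl h1
      subst this
      exact ⟨.inl q, Sum.inl_ne_inr, hq, h3.symm⟩
  have match_iff : ∀ p q, T.endAt p = T.endAt q ↔ T'.endAt (E p) = T'.endAt (E q) := by
    intro p q
    by_cases hpq : p = q
    · subst hpq
      exact ⟨fun _ => rfl, fun _ => rfl⟩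
    · obtain ⟨r, h1, h2, h3⟩ := partner q
      constructor
      · intro h
        rw [T.end_unique h h2 hpq h1, h3]
      · intro h
        have := T'.end_unique h h3 (fun h => hpq (E.injective h)) (fun h => h1 (E.injective h))
        rw [E.injective this, h2]
  -- the arcs in a region are linked by strings, so the matching also determines the regions
  have region_iff : ∀ a b, T.regionAt a = T.regionAt b ↔
      T'.regionAt (F a) = T'.regionAt (F b) := by
    intro a b
    constructor
    · intro h
      replace h := hT.circuit a b h
      apply T'.regionAt_eq_of_inStep
      induction h with
      | rel a b h =>
        obtain ⟨p, q, h1, h2⟩ := h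
        refine .rel _ _ ⟨⟨e p.1, p.2⟩, ⟨e q.1, q.2⟩,
          (match_iff (.inl p) (.inl q)).1 h1, ?_⟩
        rcases h2 with ⟨rfl, rfl⟩ | ⟨rfl, rfl⟩
        · exact .inl ⟨rfl, rfl⟩
        · exact .inr ⟨rfl, rfl⟩
      | refl a => exact .refl _
      | symm a b _ ih => exact .symm _ _ ih
      | trans a b d _ _ ih1 ih2 => exact .trans _ _ _ ih1 ih2
    · intro h
      have h := hT'.circuit _ _ h
      have key : ∀ A B, Relation.EqvGen (InStep T'.curveAt) A B →
          Relation.EqvGen (InStep T.curveAt) (F.symm A) (F.symm B) := by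
        intro A B h
        induction h with
        | rel A B h =>
          obtain ⟨p, q, h1, h2⟩ := h
          obtain ⟨p, rfl⟩ := (Equiv.sigmaCongrLeft (β := fun i => (c' i).Pt) e).surjective p
          obtain ⟨q, rfl⟩ := (Equiv.sigmaCongrLeft (β := fun i => (c' i).Pt) e).surjective q
          refine .rel _ _ ⟨p, q, (match_iff (.inl p) (.inl q)).2 h1, ?_⟩
          rcases h2 with ⟨rfl, rfl⟩ | ⟨rfl, rfl⟩
          · exact .inl ⟨F.symm_apply_apply ⟨p.1, Col.whiteArc p.2⟩,
              F.symm_apply_apply ⟨q.1, Col.whiteArc q.2⟩⟩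
          · exact .inr ⟨F.symm_apply_apply ⟨p.1, Col.blackArc p.2⟩,
              F.symm_apply_apply ⟨q.1, Col.blackArc q.2⟩⟩
        | refl a => exact .refl _
        | symm a b _ ih => exact .symm _ _ ih
        | trans a b d _ _ ih1 ih2 => exact .trans _ _ _ ih1 ih2
      apply T.regionAt_eq_of_inStep
      simpa using key _ _ h
  -- curves and regions are classes of marked points and of arcs of internal discs
  have liftC : ∃ φ : T.Curve ≃ T'.Curve, ∀ p, φ (T.endAt p) = T'.endAt (E p) := by
    have hs : ∀ x, ∃ p, T.endAt p = x := fun x => by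
      obtain ⟨p, hp⟩ := hT.curve x
      exact ⟨.inl p, hp⟩
    choose r hr using hs
    have hr' : ∀ p, T'.endAt (E (r (T.endAt p))) = T'.endAt (E p) := fun p =>
      (match_iff _ _).1 (hr _)
    refine ⟨Equiv.ofBijective (fun x => T'.endAt (E (r x))) ⟨?_, ?_⟩, hr'⟩
    · intro x y h
      have := (match_iff _ _).2 h
      rwa [hr, hr] at this
    · intro y
      obtain ⟨p, rfl⟩ := hT'.curve y
      obtain ⟨q, hq⟩ := E.surjective (.inl p)
      exact ⟨T.endAt q, (hr' q).trans (congrArg T'.endAt hq)⟩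
  have liftR : ∃ ψ : T.Region ≃ T'.Region, ∀ a, ψ (T.regionAt a) = T'.regionAt (F a) := by
    choose r hr using hT.region
    have hr' : ∀ p, T'.regionAt (F (r (T.regionAt p))) = T'.regionAt (F p) := fun p =>
      (region_iff _ _).1 (hr _)
    refine ⟨Equiv.ofBijective (fun x => T'.regionAt (F (r x))) ⟨?_, ?_⟩, hr'⟩
    · intro x y h
      have := (region_iff _ _).2 h
      rwa [hr, hr] at this
    · intro y
      obtain ⟨p, rfl⟩ := hT'.region y
      obtain ⟨q, hq⟩ := F.surjective p
      exact ⟨T.regionAt q, (hr' q).trans (congrArg T'.regionAt hq)⟩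
  obtain ⟨φ, hφ⟩ := liftC
  obtain ⟨ψ, hψ⟩ := liftR
  refine ⟨φ, ψ, fun i j => hφ (.inl ⟨i, j⟩), fun j => hφ (.inr j), fun i a => hψ ⟨i, a⟩, ?_, ?_⟩
  · intro x
    obtain ⟨p, rfl⟩ := hT.curve x
    rw [← regionAt_whiteArc, hψ]
    exact (T'.regionAt_whiteArc ⟨e p.1, p.2⟩).trans (congrArg T'.white (hφ (.inl p)).symm)
  · intro x
    obtain ⟨p, rfl⟩ := hT.curve x
    rw [← regionAt_blackArc, hψ]
    exact (T'.regionAt_blackArc ⟨e p.1, p.2⟩).trans (congrArg T'.black (hφ (.inl p)).symm)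

theorem isRelabelling_of_sameMatching {e : ι ≃ ι'} {T : Tangle (fun i => c' (e i)) c₀}
    {T' : Tangle c' c₀} (hT : T.IsTight) (hT' : T'.IsTight) (hM : SameMatching e T T')
    (h0 : 0 < c₀.size) : IsRelabelling e T T' := by
  obtain ⟨φ, ψ, h1, h2, h3, h4, h5⟩ := exists_isotopy hT hT' hM
  refine ⟨φ, ψ, h1, h2, h3, ?_, h4, h5⟩
  intro a
  obtain ⟨j, rfl | rfl⟩ := exists_eq_whiteArc_or_blackArc h0 a
  · rw [← T.white_out, ← T'.white_out, h4, h2]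
  · rw [← T.black_out, ← T'.black_out, h5, h2]

end Matching

end Tangle

namespace PlanarAlgebra

/-- Tight tangles with the same matching of the marked points act in the same way. -/
theorem Z_congr (P : PlanarAlgebra.{u}) {ι ι' : Type} [Finite ι] [Finite ι'] (e : ι ≃ ι')
    {c : ι → Col} {c' : ι' → Col} {c₀ : Col} {T : Tangle c c₀} {T' : Tangle c' c₀}
    (hT : T.IsTight) (hT' : T'.IsTight) (h0 : 0 < c₀.size) (hc : ∀ i, c i = c' (e i))
    (hM : Tangle.SameMatching e T T') {x : ∀ i, P.V (c i)} {x' : ∀ i, P.V (c' i)}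
    (hx : ∀ i, HEq (x i) (x' (e i))) : P.Z T x = P.Z T' x' := by
  obtain rfl : c = fun i => c' (e i) := funext hc
  obtain rfl : x = fun i => x' (e i) := funext fun i => eq_of_heq (hx i)
  exact P.Z_relabel e T T' (Tangle.isRelabelling_of_sameMatching hT hT' hM h0) x'

theorem Z_comp (P : PlanarAlgebra.{u}) {ι : Type} {κ : ι → Type} [Finite ι] [∀ i, Finite (κ i)]
    {c : ι → Col} {d : ∀ i, κ i → Col} {c₀ : Col} {T : Tangle c c₀}
    {S : ∀ i, Tangle (d i) (c i)} (hS : ∀ i, (S i).IsTight) (hT : T.IsTight)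
    (hc : ∀ i, 0 < (c i).size) (x : ∀ p : Σ i, κ i, P.V (d p.1 p.2)) :
    P.Z (Tangle.comp hS hT hc) x = P.Z T (fun i => P.Z (S i) (fun k => x ⟨i, k⟩)) :=
  P.Z_composite T S _ (Tangle.comp_isComposite hS hT hc) x

end PlanarAlgebra

/-- Tight tangles without external marked points act in the same way if they have the same
matching of the marked points: here the position of the external disc does not matter, by
sphericality. -/
theorem SubfactorPlanarAlgebra.Z_congr_closed {δ : ℝ} (P : SubfactorPlanarAlgebra.{u} δ)
    {ι ι' : Type} [Finite ι] [Finite ι'] (e : ι ≃ ι')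
    {c : ι → Col} {c' : ι' → Col} {T : Tangle c (.nat 0)} {T' : Tangle c' (.nat 0)}
    (hT : T.IsTight) (hT' : T'.IsTight) (hc : ∀ i, c i = c' (e i))
    (hM : Tangle.SameMatching e T T') {x : ∀ i, P.V (c i)} {x' : ∀ i, P.V (c' i)}
    (hx : ∀ i, HEq (x i) (x' (e i))) : P.Z T x = P.Z T' x' := by
  obtain rfl : c = fun i => c' (e i) := funext hc
  obtain rfl : x = fun i => x' (e i) := funext fun i => eq_of_heq (hx i)
  rw [← P.Z_relabel e (T'.reindex e) T' (Tangle.reindex_isRelabelling e T')]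
  obtain ⟨φ, ψ, h1, -, h3, h4, h5⟩ := Tangle.exists_isotopy hT hT' hM
  obtain ⟨r, hr, hr'⟩ := P.spherical (s := false) (s' := false) T (T'.reindex e)
    ⟨φ, ψ, h1, h3, h4, h5⟩ (fun i => x' (e i))
  exact hr.trans hr'.symm

/-! ### Matchings of composites and of the basic tangles -/

namespace Tangle

section Joins

variable {ι : Type} {c : ι → Col} {c₀ : Col}

theorem mirror_joinIn {T : Tangle c c₀} {i i' : ι} {j j' : ℕ} (hj : j < 2 * (c i).size)
    (hj' : j' < 2 * (c i').size)
    (h : T.JoinIn i (2 * (c i).size - 1 - j) i' (2 * (c i').size - 1 - j')) :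
    T.mirror.JoinIn i j i' j' := by
  obtain ⟨h1, h2, h3⟩ := h
  refine ⟨hj, hj', ?_⟩
  refine (congrArg (T.inCurve i) (Fin.ext ?_)).trans (h3.trans
    (congrArg (T.inCurve i') (Fin.ext ?_)).symm)
  · exact revPt_val _
  · exact revPt_val _

theorem mirror_joinOut {T : Tangle c c₀} {i : ι} {j u : ℕ} (hj : j < 2 * (c i).size)
    (hu : u < 2 * c₀.size)
    (h : T.JoinOut i (2 * (c i).size - 1 - j) (2 * c₀.size - 1 - u)) :
    T.mirror.JoinOut i j u := by
  obtain ⟨h1, h2, h3⟩ := h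
  refine ⟨hj, hu, ?_⟩
  refine (congrArg (T.inCurve i) (Fin.ext ?_)).trans (h3.trans
    (congrArg T.outCurve (Fin.ext ?_)).symm)
  · exact revPt_val _
  · exact revPt_val _

variable {κ : ι → Type} {d : ∀ i, κ i → Col} {T : Tangle c c₀} {S : ∀ i, Tangle (d i) (c i)}
  [Finite ι] [∀ i, Finite (κ i)] {hS : ∀ i, (S i).IsTight} {hT : T.IsTight}
  {hc : ∀ i, 0 < (c i).size}

theorem comp_joinIn_same {i : ι} {k k' : κ i} {j j' : ℕ} (h : (S i).JoinIn k j k' j') :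
    (comp hS hT hc).JoinIn ⟨i, k⟩ j ⟨i, k'⟩ j' := by
  obtain ⟨h1, h2, h3⟩ := h
  exact ⟨h1, h2, congrArg (compCurve T S i) h3⟩

theorem comp_joinIn {i i' : ι} {k : κ i} {k' : κ i'} {j j' u u' : ℕ} (h : (S i).JoinOut k j u)
    (h' : T.JoinIn i u i' u') (h'' : (S i').JoinOut k' j' u') :
    (comp hS hT hc).JoinIn ⟨i, k⟩ j ⟨i', k'⟩ j' := by
  obtain ⟨h1, h2, h3⟩ := h
  obtain ⟨_, _, h4⟩ := h'
  obtain ⟨h5, h6, h7⟩ := h''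
  refine ⟨h1, h5, ?_⟩
  refine (congrArg (compCurve T S i) h3).trans ?_
  refine Eq.trans ?_ (congrArg (compCurve T S i') h7).symm
  rw [compCurve_out hS, compCurve_out hS, h4]

theorem comp_joinOut {i : ι} {k : κ i} {j u v : ℕ} (h : (S i).JoinOut k j u)
    (h' : T.JoinOut i u v) : (comp hS hT hc).JoinOut ⟨i, k⟩ j v := by
  obtain ⟨h1, h2, h3⟩ := h
  obtain ⟨_, h5, h4⟩ := h'
  refine ⟨h1, h5, ?_⟩
  refine (congrArg (compCurve T S i) h3).trans ?_
  rw [compCurve_out hS, h4]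
  rfl

end Joins

section Rotation

theorem rotation_isTight {c : Col} (s : ℕ) (hs : s ≤ c.size) :
    (rotation c s hs).IsTight where
  curve x := ⟨⟨(), x⟩, rfl⟩
  region r := ⟨⟨(), r⟩, rfl⟩
  circuit := by
    rintro ⟨⟨⟩, a⟩ ⟨⟨⟩, b⟩ hab
    have hab : a = b := hab
    subst hab
    exact .refl _
  outCurve_inj := (rotPt_bijective hs).1
  outRegion_inj := (rotArc_bijective hs).1

theorem rotation_joinOut {c : Col} {s : ℕ} (hs : s ≤ c.size) {j u : ℕ} (hj : j < 2 * c.size)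
    (hu : u < 2 * c.size) (h : j = u + 2 * s ∨ j + 2 * c.size = u + 2 * s) :
    (rotation c s hs).JoinOut () j u := by
  refine ⟨hj, hu, Fin.ext ?_⟩
  change j = (rotPt c s ⟨u, hu⟩).val
  rw [rotPt_val hs]
  change j = if u + 2 * s < 2 * c.size then u + 2 * s else u + 2 * s - 2 * c.size
  split_ifs <;> omega

theorem identity_joinOut {c : Col} {j : ℕ} (hj : j < 2 * c.size) :
    (rotation c 0 (Nat.zero_le _)).JoinOut () j j :=
  rotation_joinOut _ hj hj (.inl rfl)

end Rotation

section Trace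

theorem trace_isTight (n : ℕ) : (trace n).IsTight where
  curve x := ⟨⟨(), ⟨x.val, by have := x.isLt; omega⟩⟩, Fin.ext (by
    have := x.isLt
    change min x.val (2 * (Col.nat n).size - 1 - x.val) = x.val
    omega)⟩
  region r := ⟨⟨(), capRep _ r⟩, capArc_capRep r⟩
  circuit := by
    have key : ∀ a : (Col.nat n).Arc, Relation.EqvGen (InStep (trace n).curveAt)
        ⟨(), a⟩ ⟨(), capRep _ (capArc a)⟩ := by
      intro a
      rcases cap_step a with h | ⟨p, q, h, h'⟩
      · rw [← h]
        exact .refl _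
      · refine .rel _ _ ⟨⟨(), p⟩, ⟨(), q⟩, h, ?_⟩
        rcases h' with ⟨h1, h2⟩ | ⟨h1, h2⟩
        · left
          rw [← h1, ← h2]
          exact ⟨rfl, rfl⟩
        · right
          rw [← h1, ← h2]
          exact ⟨rfl, rfl⟩
    rintro ⟨⟨⟩, a⟩ ⟨⟨⟩, b⟩ hab
    have hab : capArc a = capArc b := hab
    have h := key b
    rw [← hab] at h
    exact .trans _ _ _ (key a) (.symm _ _ h)
  outCurve_inj j := j.elim0
  outRegion_inj a b _ := by
    have ha : a.val < 1 := a.isLt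
    have hb : b.val < 1 := b.isLt
    exact Fin.ext (by omega)

theorem trace_joinIn {n j j' : ℕ} (h : j + j' + 1 = 2 * n) : (trace n).JoinIn () j () j' := by
  have h1 : j < 2 * n := by omega
  have h2 : j' < 2 * n := by omega
  refine ⟨h1, h2, Fin.ext ?_⟩
  change min j (2 * n - 1 - j) = min j' (2 * n - 1 - j')
  omega

end Trace

section Prod

variable {k m n t : ℕ}

/-- Arcs on the two discs of a multiplication tangle which lie in the same region are adjacent to a
string that joins the two discs. -/
theorem prodArc_eq (h : ProdRange k m n t) {a b : ℕ} (ha : a < 2 * m) (hb : b < 2 * n)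
    (e : prodArcA k m n t a = prodArcB k m n t b) :
    ∃ y < 2 * m, ∃ j < 2 * n, prodA k m n t y = prodB k m n t j ∧
      ((a = wv m y ∧ b = wv n j) ∨ (a = bv y ∧ b = bv j)) := by
  obtain ⟨h1, h2, h3, h4, h5, h6⟩ := h
  obtain ⟨y, j, hy, hj, h7, h8⟩ : ∃ y j, (m + t - n - k ≤ y ∧ y < 2 * m - k) ∧
      ((j < m + n - k - t ∧ y + j + 1 = 2 * m - 2 * k) ∨
        (2 * n - k ≤ j ∧ j < 2 * n ∧ y + j + 1 = 2 * m - 2 * k + 2 * n)) ∧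
      y % 2 ≠ j % 2 ∧
      ((a = y + 1 ∧ b = j) ∨ (a = y ∧ j + 1 < 2 * n ∧ b = j + 1) ∨
        (a = y ∧ j + 1 = 2 * n ∧ b = 0)) := by
    unfold prodArcA prodArcB at e
    by_cases ha1 : a ≤ m + t - n - k
    · by_cases hp : m + n - k - t = 0
      · refine ⟨a, 2 * n - 1, ?_⟩
        split_ifs at e <;> omega
      · refine ⟨a, m + n - k - t - 1, ?_⟩
        split_ifs at e <;> omega
    · refine ⟨a - 1, b, ?_⟩
      split_ifs at e <;> omega
  refine ⟨y, by omega, j, by omega, ?_, ?_⟩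
  · unfold prodA prodB
    rw [if_neg (by omega), if_pos (by omega)]
    split_ifs <;> omega
  · unfold wv bv
    split_ifs <;> omega

theorem prodArcA_inj (h : ProdRange k m n t) {a b : ℕ} (ha : a < 2 * m) (hb : b < 2 * m)
    (e : prodArcA k m n t a = prodArcA k m n t b) : a = b := by
  obtain ⟨h1, h2, h3, h4, h5, h6⟩ := h
  unfold prodArcA at e
  split_ifs at e <;> omega

theorem prodArcB_inj (h : ProdRange k m n t) {a b : ℕ} (ha : a < 2 * n) (hb : b < 2 * n)
    (e : prodArcB k m n t a = prodArcB k m n t b) : a = b := by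
  obtain ⟨h1, h2, h3, h4, h5, h6⟩ := h
  unfold prodArcB at e
  split_ifs at e <;> omega

theorem prod_isTight (h : ProdRange k m n t) : (prod k m n t h).IsTight := by
  have curve : ∀ x, ∃ p, (prod k m n t h).curveAt p = x := by
    intro x
    obtain ⟨p, q, hpq, hp, hq⟩ := prodEnd_ex h x
    rcases p with p | p
    · exact ⟨p, hp⟩
    · rcases q with q | q
      · exact ⟨q, hq⟩
      · have e := congrArg Fin.val (hp.trans hq.symm)
        have e : p.val = q.val := e
        exact (hpq (congrArg Sum.inr (Fin.ext e))).elim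
  have step : ∀ (a : (Col.nat m).Arc) (b : (Col.nat n).Arc),
      prodReg h (.inl ⟨false, a⟩) = prodReg h (.inl ⟨true, b⟩) →
      Relation.EqvGen (InStep (prod k m n t h).curveAt) ⟨false, a⟩ ⟨true, b⟩ := by
    intro a b hab
    obtain ⟨y, hy, j, hj, e, h'⟩ := prodArc_eq h (h.arc_lt_left a) (h.arc_lt_right b)
      (congrArg Fin.val hab)
    have key : ∀ a' b', a'.val = a.val → b'.val = b.val →
        (⟨false, a⟩ : Σ i, (pairCol m n i).Arc) = ⟨false, a'⟩ ∧
          (⟨true, b⟩ : Σ i, (pairCol m n i).Arc) = ⟨true, b'⟩ := by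
      intro a' b' ha hb
      have ha : a' = a := Fin.ext ha
      have hb : b' = b := Fin.ext hb
      rw [ha, hb]
      exact ⟨rfl, rfl⟩
    refine .rel _ _ ⟨⟨false, ⟨y, hy⟩⟩, ⟨true, ⟨j, hj⟩⟩, Fin.ext e, ?_⟩
    rcases h' with ⟨h1, h2⟩ | ⟨h1, h2⟩
    · exact .inl (key _ _ ((whiteArc_wv _).trans h1.symm) ((whiteArc_wv _).trans h2.symm))
    · exact .inr (key _ _ ((blackArc_bv _).trans h1.symm) ((blackArc_bv _).trans h2.symm))
  have ht : 0 < t := by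
    obtain ⟨h1, h2, h3, h4, h5, h6⟩ := h
    omega
  refine ⟨curve, ?_, ?_, ?_, ?_⟩
  · intro r
    have hr := prodReg_rep h r
    rcases hq : prodArcRep h r with a | a <;> rw [hq] at hr
    · exact ⟨a, hr⟩
    · have hr : (prod k m n t h).outRegion a = r := hr
      obtain ⟨j, hj⟩ := exists_eq_whiteArc_or_blackArc (c := .nat t) ht a
      obtain ⟨p, hp⟩ := curve ((prod k m n t h).outCurve j)
      rcases hj with rfl | rfl
      · refine ⟨⟨p.1, Col.whiteArc p.2⟩, ?_⟩
        rw [regionAt_whiteArc, hp, white_out, hr]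
      · refine ⟨⟨p.1, Col.blackArc p.2⟩, ?_⟩
        rw [regionAt_blackArc, hp, black_out, hr]
  · rintro ⟨_ | _, a⟩ ⟨_ | _, b⟩ hab
    · have : a = b := Fin.ext (prodArcA_inj h (h.arc_lt_left a) (h.arc_lt_left b)
        (congrArg Fin.val hab))
      rw [this]
      exact .refl _
    · exact step a b hab
    · exact .symm _ _ (step b a hab.symm)
    · have : a = b := Fin.ext (prodArcB_inj h (h.arc_lt_right a) (h.arc_lt_right b)
        (congrArg Fin.val hab))
      rw [this]
      exact .refl _
  · intro i j (hij : prodEnd h (.inr i) = prodEnd h (.inr j))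
    have e := congrArg Fin.val hij
    have e : i.val = j.val := e
    exact Fin.ext e
  · intro i j (hij : prodReg h (.inr i) = prodReg h (.inr j))
    have e := congrArg Fin.val hij
    have e : i.val = j.val := e
    exact Fin.ext e

/-- In a product, the first top strings of the left box go to the first top strings of the
result. -/
theorem prod_joinOut_low (h : ProdRange k m n t) {j : ℕ} (hj : j + n + k < m + t) :
    (prod k m n t h).JoinOut false j j := by
  have h' := h
  obtain ⟨h1, h2, h3, h4, h5, h6⟩ := h'
  have e : j < 2 * m := by omega
  have e' : j < 2 * t := by omega
  refine ⟨e, e', Fin.ext ?_⟩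
  change prodA k m n t j = j
  unfold prodA
  rw [if_pos (by omega)]

/-- In a product, the `k` strings on the left of the left box, which are its last `k` marked points,
go to the left of the result. -/
theorem prod_joinOut_left (h : ProdRange k m n t) {j u : ℕ} (hj : 2 * m ≤ j + k) (hj' : j < 2 * m)
    (hu : u + 2 * m = j + 2 * t) : (prod k m n t h).JoinOut false j u := by
  have h' := h
  obtain ⟨h1, h2, h3, h4, h5, h6⟩ := h'
  have e' : u < 2 * t := by omega
  refine ⟨hj', e', Fin.ext ?_⟩
  change prodA k m n t j = u
  unfold prodA
  rw [if_neg (by omega), if_neg (by omega)]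
  omega

/-- In a product, the last top strings of the right box and the `k` strings on its right go to the
result. -/
theorem prod_joinOut_right (h : ProdRange k m n t) {j u : ℕ} (hj : m + n ≤ j + k + t)
    (hj' : j + k < 2 * n) (hu : u + 2 * n = j + 2 * t) :
    (prod k m n t h).JoinOut true j u := by
  have h' := h
  obtain ⟨h1, h2, h3, h4, h5, h6⟩ := h'
  have e : j < 2 * n := by omega
  have e' : u < 2 * t := by omega
  refine ⟨e, e', Fin.ext ?_⟩
  change prodB k m n t j = u
  unfold prodB
  rw [if_neg (by omega), if_pos (by omega)]
  omega

/-- In a product, `m + n - k - t` nested arcs join the last top strings of the left box to the first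
top strings of the right box, and the `k` strings on the right of the left box are joined to the `k`
strings on the left of the right box, which are its last `k` marked points. -/
theorem prod_joinIn (h : ProdRange k m n t) {y j : ℕ} (hy : m + t ≤ y + n + k) (hy' : y + k < 2 * m)
    (hj : (j + k + t < m + n ∧ y + j + 1 + 2 * k = 2 * m) ∨
      (2 * n ≤ j + k ∧ j < 2 * n ∧ y + j + 1 + 2 * k = 2 * m + 2 * n)) :
    (prod k m n t h).JoinIn false y true j := by
  have h' := h
  obtain ⟨h1, h2, h3, h4, h5, h6⟩ := h'
  have e : y < 2 * m := by omega
  have e' : j < 2 * n := by omega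
  refine ⟨e, e', Fin.ext ?_⟩
  change prodA k m n t y = prodB k m n t j
  unfold prodA prodB
  rw [if_neg (by omega), if_pos (by omega)]
  split_ifs <;> omega

end Prod

/-! ### Associativity of the products -/

section TwoDiscs

/-- The internal discs of a composite with a tangle with two internal discs. -/
def Idx (κ₁ κ₂ : Type) : Bool → Type
  | false => κ₁
  | true => κ₂

variable {κ₁ κ₂ : Type}

instance [Finite κ₁] [Finite κ₂] (i : Bool) : Finite (Idx κ₁ κ₂ i) := by
  cases i
  · exact inferInstanceAs (Finite κ₁)
  · exact inferInstanceAs (Finite κ₂)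

/-- The colours of the internal discs of two tangles, as one family. -/
def idxCol (d₁ : κ₁ → Col) (d₂ : κ₂ → Col) : ∀ i, Idx κ₁ κ₂ i → Col
  | false => d₁
  | true => d₂

variable {d₁ : κ₁ → Col} {d₂ : κ₂ → Col} {p q : ℕ} {c₀ : Col}

/-- Two tangles, as the family of tangles to be inserted into a tangle with two internal discs. -/
def idxTangle (S₁ : Tangle d₁ (.nat p)) (S₂ : Tangle d₂ (.nat q)) :
    ∀ i, Tangle (idxCol d₁ d₂ i) (pairCol p q i)
  | false => S₁
  | true => S₂

theorem idxTangle_isTight {S₁ : Tangle d₁ (.nat p)} {S₂ : Tangle d₂ (.nat q)} (h₁ : S₁.IsTight)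
    (h₂ : S₂.IsTight) : ∀ i, (idxTangle S₁ S₂ i).IsTight
  | false => h₁
  | true => h₂

theorem pairCol_pos (hp : 0 < p) (hq : 0 < q) : ∀ i, 0 < (pairCol p q i).size
  | false => hp
  | true => hq

/-- The tangle obtained by inserting two tight tangles into a tight tangle with two internal
discs. -/
def comp₂ [Finite κ₁] [Finite κ₂] {T : Tangle (pairCol p q) c₀} (hT : T.IsTight)
    {S₁ : Tangle d₁ (.nat p)} {S₂ : Tangle d₂ (.nat q)} (h₁ : S₁.IsTight) (h₂ : S₂.IsTight)
    (hp : 0 < p) (hq : 0 < q) :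
    Tangle (fun x : Σ i, Idx κ₁ κ₂ i => idxCol d₁ d₂ x.1 x.2) c₀ :=
  comp (idxTangle_isTight h₁ h₂) hT (pairCol_pos hp hq)

variable [Finite κ₁] [Finite κ₂] {T : Tangle (pairCol p q) c₀} {hT : T.IsTight}
    {S₁ : Tangle d₁ (.nat p)} {S₂ : Tangle d₂ (.nat q)} {h₁ : S₁.IsTight} {h₂ : S₂.IsTight}
    {hp : 0 < p} {hq : 0 < q}

theorem comp₂_isTight : (comp₂ hT h₁ h₂ hp hq).IsTight := comp_isTight _ _ _

theorem comp₂_joinIn_left {k k' : κ₁} {j j' : ℕ} (h : S₁.JoinIn k j k' j') :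
    (comp₂ hT h₁ h₂ hp hq).JoinIn ⟨false, k⟩ j ⟨false, k'⟩ j' :=
  comp_joinIn_same (i := false) h

theorem comp₂_joinIn_right {k k' : κ₂} {j j' : ℕ} (h : S₂.JoinIn k j k' j') :
    (comp₂ hT h₁ h₂ hp hq).JoinIn ⟨true, k⟩ j ⟨true, k'⟩ j' :=
  comp_joinIn_same (i := true) h

theorem comp₂_joinIn {k : κ₁} {k' : κ₂} {j j' u u' : ℕ} (h : S₁.JoinOut k j u)
    (h' : T.JoinIn false u true u') (h'' : S₂.JoinOut k' j' u') :
    (comp₂ hT h₁ h₂ hp hq).JoinIn ⟨false, k⟩ j ⟨true, k'⟩ j' :=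
  comp_joinIn (i := false) (i' := true) h h' h''

theorem comp₂_joinOut_left {k : κ₁} {j u v : ℕ} (h : S₁.JoinOut k j u)
    (h' : T.JoinOut false u v) : (comp₂ hT h₁ h₂ hp hq).JoinOut ⟨false, k⟩ j v :=
  comp_joinOut (i := false) h h'

theorem comp₂_joinOut_right {k : κ₂} {j u v : ℕ} (h : S₂.JoinOut k j u)
    (h' : T.JoinOut true u v) : (comp₂ hT h₁ h₂ hp hq).JoinOut ⟨true, k⟩ j v :=
  comp_joinOut (i := true) h h'

end TwoDiscs

/-- The renaming of the internal discs in the associativity law. -/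
def assocEquiv : (Σ i, Idx Bool Unit i) ≃ Σ i, Idx Unit Bool i where
  toFun
    | ⟨false, b⟩ => Bool.rec ⟨false, ()⟩ ⟨true, false⟩ b
    | ⟨true, _⟩ => ⟨true, true⟩
  invFun
    | ⟨false, _⟩ => ⟨false, false⟩
    | ⟨true, b⟩ => Bool.rec ⟨false, true⟩ ⟨true, ()⟩ b
  left_inv := by rintro ⟨_ | _, _ | _⟩ <;> rfl
  right_inv := by rintro ⟨_ | _, _ | _⟩ <;> rfl

section Assoc

variable {k l m n t s s' : ℕ}

/-- The two ways to multiply three boxes have the same matching. Let `u`, `v`, `w` be the numbers of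
arcs between the tops of the first and second, the second and third, and the first and third box.
Then `s = l + m - k - u`, `s' = m + n - k - v` and `t = l + m + n - 2 * k - u - v - w`. Either
`w = 0` and `s + s' = m + t ≥ l + n`, or the arcs counted by `w` pass over the second box, all of
whose `2 * m - 2 * k` top strings are then used up, and `s + s' = l + n ≥ m + t`. -/
theorem assoc_sameMatching (h₁ : ProdRange k l m s) (h₂ : ProdRange k s n t)
    (h₃ : ProdRange k m n s') (h₄ : ProdRange k l s' t) (hs : s + s' = max (m + t) (l + n))
    (hs0 : 0 < s) (hn0 : 0 < n) (hl0 : 0 < l) (hs0' : 0 < s') :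
    SameMatching assocEquiv
      (comp₂ (prod_isTight h₂) (prod_isTight h₁)
        (rotation_isTight (c := .nat n) 0 (Nat.zero_le _)) hs0 hn0)
      (comp₂ (prod_isTight h₄) (rotation_isTight (c := .nat l) 0 (Nat.zero_le _))
        (prod_isTight h₃) hl0 hs0') := by
  have hk := h₁.pos
  have a1 := h₁.left_le
  have a2 := h₁.right_le
  have a3 := h₁.le_add
  have b1 := h₂.left_le
  have b2 := h₂.right_le
  have b3 := h₂.le_add
  have c1 := h₃.left_le
  have c2 := h₃.right_le
  have c3 := h₃.le_add
  have d1 := h₄.left_le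
  have d2 := h₄.right_le
  have d3 := h₄.le_add
  have e1 := h₁.le_left
  have e2 := h₁.le_right
  have e3 := h₂.le_right
  -- strings between the first and the second disc
  have hab : ∀ j j', l + s ≤ j + m + k → j + k < 2 * l →
      ((j' + k + s < l + m ∧ j + j' + 1 + 2 * k = 2 * l) ∨
        (2 * m ≤ j' + k ∧ j' < 2 * m ∧ j + j' + 1 + 2 * k = 2 * l + 2 * m)) →
      (comp₂ (prod_isTight h₂) (prod_isTight h₁)
        (rotation_isTight (c := .nat n) 0 (Nat.zero_le _)) hs0 hn0).JoinIn
        ⟨false, false⟩ j ⟨false, true⟩ j' ∧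
      (comp₂ (prod_isTight h₄) (rotation_isTight (c := .nat l) 0 (Nat.zero_le _))
        (prod_isTight h₃) hl0 hs0').JoinIn
        ⟨false, ()⟩ j ⟨true, false⟩ j' := by
    intro j j' x1 x2 x3
    refine ⟨comp₂_joinIn_left (prod_joinIn h₁ x1 x2 x3), ?_⟩
    have hj : j < 2 * (Col.nat l).size := by change j < 2 * l; omega
    rcases x3 with ⟨x3, x4⟩ | ⟨x3, x4, x5⟩
    · exact comp₂_joinIn (identity_joinOut hj) (prod_joinIn h₄ (by omega) (by omega) (by omega))
        (prod_joinOut_low h₃ (by omega))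
    · exact comp₂_joinIn (identity_joinOut hj) (prod_joinIn h₄ (by omega) (by omega)
        (j := j' + 2 * s' - 2 * m) (by omega))
        (prod_joinOut_left h₃ (by omega) (by omega) (by omega))
  -- strings between the second and the third disc
  have hbc : ∀ j j', m + s' ≤ j + n + k → j + k < 2 * m →
      ((j' + k + s' < m + n ∧ j + j' + 1 + 2 * k = 2 * m) ∨
        (2 * n ≤ j' + k ∧ j' < 2 * n ∧ j + j' + 1 + 2 * k = 2 * m + 2 * n)) →
      (comp₂ (prod_isTight h₂) (prod_isTight h₁)
        (rotation_isTight (c := .nat n) 0 (Nat.zero_le _)) hs0 hn0).JoinIn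
        ⟨false, true⟩ j ⟨true, ()⟩ j' ∧
      (comp₂ (prod_isTight h₄) (rotation_isTight (c := .nat l) 0 (Nat.zero_le _))
        (prod_isTight h₃) hl0 hs0').JoinIn
        ⟨true, false⟩ j ⟨true, true⟩ j' := by
    intro j j' x1 x2 x3
    refine ⟨?_, comp₂_joinIn_right (prod_joinIn h₃ x1 x2 x3)⟩
    have hj : j' < 2 * (Col.nat n).size := by change j' < 2 * n; omega
    exact comp₂_joinIn (prod_joinOut_right h₁ (u := j + 2 * s - 2 * m) (by omega) (by omega)
      (by omega)) (prod_joinIn h₂ (by omega) (by omega) (by omega)) (identity_joinOut hj)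
  -- strings between the first and the third disc
  have hac : ∀ j j', j + m + k < l + s → s + t ≤ j + n + k → j + j' + 1 + 2 * k = 2 * s →
      (comp₂ (prod_isTight h₂) (prod_isTight h₁)
        (rotation_isTight (c := .nat n) 0 (Nat.zero_le _)) hs0 hn0).JoinIn
        ⟨false, false⟩ j ⟨true, ()⟩ j' ∧
      (comp₂ (prod_isTight h₄) (rotation_isTight (c := .nat l) 0 (Nat.zero_le _))
        (prod_isTight h₃) hl0 hs0').JoinIn
        ⟨false, ()⟩ j ⟨true, true⟩ j' := by
    intro j j' x1 x2 x3
    have hj : j < 2 * (Col.nat l).size := by change j < 2 * l; omega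
    have hj' : j' < 2 * (Col.nat n).size := by change j' < 2 * n; omega
    refine ⟨comp₂_joinIn (prod_joinOut_low h₁ (by omega)) (prod_joinIn h₂ (by omega) (by omega)
      (by omega)) (identity_joinOut hj'), comp₂_joinIn (identity_joinOut hj)
      (prod_joinIn h₄ (j := j' + 2 * s' - 2 * n) (by omega) (by omega) (by omega))
      (prod_joinOut_right h₃ (by omega) (by omega) (by omega))⟩
  rintro ⟨_ | _, x⟩ j hj
  · cases x
    · have hj : j < 2 * l := hj
      have hj1 : j < 2 * (Col.nat l).size := hj
      by_cases x1 : 2 * l ≤ j + k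
      · refine .inr ⟨j + 2 * t - 2 * l, ?_, ?_⟩
        · exact comp₂_joinOut_left (prod_joinOut_left h₁ x1 hj (u := j + 2 * s - 2 * l) (by omega))
            (prod_joinOut_left h₂ (by omega) (by omega) (by omega))
        · exact comp₂_joinOut_left (identity_joinOut hj1)
            (prod_joinOut_left h₄ (by omega) (by omega) (by omega))
      by_cases x2 : l + s ≤ j + m + k
      · left
        by_cases x3 : j + 2 * k < 2 * l
        · exact ⟨⟨false, true⟩, 2 * l - 2 * k - 1 - j, (fun h => nomatch h),
            hab j _ x2 (by omega) (.inl (by omega))⟩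
        · exact ⟨⟨false, true⟩, 2 * l + 2 * m - 2 * k - 1 - j, (fun h => nomatch h),
            hab j _ x2 (by omega) (.inr (by omega))⟩
      by_cases x3 : j + n + k < s + t
      · refine .inr ⟨j, ?_, ?_⟩
        · exact comp₂_joinOut_left (prod_joinOut_low h₁ (by omega)) (prod_joinOut_low h₂ x3)
        · exact comp₂_joinOut_left (identity_joinOut hj1) (prod_joinOut_low h₄ (by omega))
      · exact .inl ⟨⟨true, ()⟩, 2 * s - 2 * k - 1 - j, (fun h => nomatch h),
          hac j _ (by omega) (by omega) (by omega)⟩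
    · have hj : j < 2 * m := hj
      by_cases x1 : j + k + s < l + m
      · obtain ⟨y1, y2⟩ := hab (2 * l - 2 * k - 1 - j) j (by omega) (by omega) (.inl (by omega))
        exact .inl ⟨⟨false, false⟩, _, (fun h => nomatch h), y1.symm, y2.symm⟩
      by_cases x2 : 2 * m ≤ j + k
      · obtain ⟨y1, y2⟩ := hab (2 * l + 2 * m - 2 * k - 1 - j) j (by omega) (by omega)
          (.inr (by omega))
        exact .inl ⟨⟨false, false⟩, _, (fun h => nomatch h), y1.symm, y2.symm⟩
      by_cases x3 : m + s' ≤ j + n + k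
      · left
        by_cases x4 : j + 2 * k < 2 * m
        · exact ⟨⟨true, ()⟩, 2 * m - 2 * k - 1 - j, (fun h => nomatch h),
            hbc j _ x3 (by omega) (.inl (by omega))⟩
        · exact ⟨⟨true, ()⟩, 2 * m + 2 * n - 2 * k - 1 - j, (fun h => nomatch h),
            hbc j _ x3 (by omega) (.inr (by omega))⟩
      · refine .inr ⟨j + 2 * s - 2 * m, ?_, ?_⟩
        · exact comp₂_joinOut_left (prod_joinOut_right h₁ (by omega) (by omega) (by omega))
            (prod_joinOut_low h₂ (by omega))
        · exact comp₂_joinOut_right (prod_joinOut_low h₃ (by omega))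
            (prod_joinOut_right h₄ (by omega) (by omega) (by omega))
  · cases x
    have hj : j < 2 * n := hj
    have hj1 : j < 2 * (Col.nat n).size := hj
    by_cases x1 : j + k + s' < m + n
    · obtain ⟨y1, y2⟩ := hbc (2 * m - 2 * k - 1 - j) j (by omega) (by omega) (.inl (by omega))
      exact .inl ⟨⟨false, true⟩, _, (fun h => nomatch h), y1.symm, y2.symm⟩
    by_cases x2 : 2 * n ≤ j + k
    · obtain ⟨y1, y2⟩ := hbc (2 * m + 2 * n - 2 * k - 1 - j) j (by omega) (by omega)
        (.inr (by omega))
      exact .inl ⟨⟨false, true⟩, _, (fun h => nomatch h), y1.symm, y2.symm⟩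
    by_cases x3 : j + k + t < s + n
    · obtain ⟨y1, y2⟩ := hac (2 * s - 2 * k - 1 - j) j (by omega) (by omega) (by omega)
      exact .inl ⟨⟨false, false⟩, _, (fun h => nomatch h), y1.symm, y2.symm⟩
    · refine .inr ⟨j + 2 * t - 2 * n, ?_, ?_⟩
      · exact comp₂_joinOut_right (identity_joinOut hj1)
          (prod_joinOut_right h₂ (by omega) (by omega) (by omega))
      · exact comp₂_joinOut_right (prod_joinOut_right h₃ (u := j + 2 * s' - 2 * n) (by omega)
          (by omega) (by omega)) (prod_joinOut_right h₄ (by omega) (by omega) (by omega))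

end Assoc

end Tangle

namespace PlanarAlgebra

open Tangle

variable (P : PlanarAlgebra.{u})

/-- Inputs of a composite with a tangle with two internal discs. -/
def idxVec {κ₁ κ₂ : Type} {d₁ : κ₁ → Col} {d₂ : κ₂ → Col} (x₁ : ∀ k, P.V (d₁ k))
    (x₂ : ∀ k, P.V (d₂ k)) : ∀ p : Σ i, Idx κ₁ κ₂ i, P.V (idxCol d₁ d₂ p.1 p.2)
  | ⟨false, k⟩ => x₁ k
  | ⟨true, k⟩ => x₂ k

theorem Z_comp₂ {κ₁ κ₂ : Type} [Finite κ₁] [Finite κ₂] {d₁ : κ₁ → Col} {d₂ : κ₂ → Col} {p q : ℕ}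
    {c₀ : Col} {T : Tangle (pairCol p q) c₀} (hT : T.IsTight)
    {S₁ : Tangle d₁ (.nat p)} {S₂ : Tangle d₂ (.nat q)} (h₁ : S₁.IsTight) (h₂ : S₂.IsTight)
    (hp : 0 < p) (hq : 0 < q) (x₁ : ∀ k, P.V (d₁ k)) (x₂ : ∀ k, P.V (d₂ k)) :
    P.Z (comp₂ hT h₁ h₂ hp hq) (P.idxVec x₁ x₂) = P.Z T (P.pair (P.Z S₁ x₁) (P.Z S₂ x₂)) := by
  refine (P.Z_comp (idxTangle_isTight h₁ h₂) hT (pairCol_pos hp hq) _).trans ?_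
  refine congrArg (P.Z T) (funext fun i => ?_)
  cases i <;> rfl

/-- Associativity of the components of the product: the product through `P_s` of three elements,
bracketed to the left, is the one through `P_s'` bracketed to the right. -/
theorem prodMap_assoc {k l m n t s s' : ℕ} (h₁ : ProdRange k l m s) (h₂ : ProdRange k s n t)
    (h₃ : ProdRange k m n s') (h₄ : ProdRange k l s' t) (hs : s + s' = max (m + t) (l + n))
    (a : P.V (.nat l)) (b : P.V (.nat m)) (c : P.V (.nat n)) :
    P.prodMap h₂ (P.prodMap h₁ a b) c = P.prodMap h₄ a (P.prodMap h₃ b c) := by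
  have hs0 : 0 < s := lt_of_lt_of_le h₂.pos h₂.le_left
  have hn0 : 0 < n := lt_of_lt_of_le h₂.pos h₂.le_right
  have hl0 : 0 < l := lt_of_lt_of_le h₄.pos h₄.le_left
  have hs0' : 0 < s' := lt_of_lt_of_le h₄.pos h₄.le_right
  have ht0 : 0 < (Col.nat t).size := by
    have h1 := h₂.pos
    have h2 := h₂.left_le
    have h3 := h₂.right_le
    change 0 < t
    omega
  have e1 := P.Z_comp₂ (prod_isTight h₂) (prod_isTight h₁)
    (rotation_isTight (c := .nat n) 0 (Nat.zero_le _)) hs0 hn0 (P.pair a b) (fun _ => c)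
  have e2 := P.Z_comp₂ (prod_isTight h₄) (rotation_isTight (c := .nat l) 0 (Nat.zero_le _))
    (prod_isTight h₃) hl0 hs0' (fun _ => a) (P.pair b c)
  rw [P.Z_identity] at e1 e2
  refine e1.symm.trans (Eq.trans ?_ e2)
  refine P.Z_congr assocEquiv comp₂_isTight comp₂_isTight ht0 ?_
    (assoc_sameMatching h₁ h₂ h₃ h₄ hs hs0 hn0 hl0 hs0') ?_
  · rintro ⟨_ | _, _ | _⟩ <;> rfl
  · rintro ⟨_ | _, _ | _⟩ <;> rfl

end PlanarAlgebra

/-! ### Matchings for the involution and the trace -/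

namespace Tangle

section OneDisc

variable {κ : Type} [Finite κ] {d : κ → Col} {c c₀ : Col}

/-- The tangle obtained by inserting a tight tangle into a tight tangle with one internal disc. -/
def comp₁ {T : Tangle (fun _ : Unit => c) c₀} (hT : T.IsTight) {S : Tangle d c} (hS : S.IsTight)
    (hc : 0 < c.size) : Tangle (fun p : Σ _ : Unit, κ => d p.2) c₀ :=
  comp (ι := Unit) (κ := fun _ => κ) (d := fun _ => d) (S := fun _ => S) (fun _ => hS) hT
    (fun _ => hc)

variable {T : Tangle (fun _ : Unit => c) c₀} {hT : T.IsTight} {S : Tangle d c} {hS : S.IsTight}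
    {hc : 0 < c.size}

theorem comp₁_isTight : (comp₁ hT hS hc).IsTight := comp_isTight _ _ _

theorem comp₁_joinIn_same {k k' : κ} {j j' : ℕ} (h : S.JoinIn k j k' j') :
    (comp₁ hT hS hc).JoinIn ⟨(), k⟩ j ⟨(), k'⟩ j' :=
  comp_joinIn_same (i := ()) (S := fun _ => S) h

theorem comp₁_joinIn {k k' : κ} {j j' u u' : ℕ} (h : S.JoinOut k j u)
    (h' : T.JoinIn () u () u') (h'' : S.JoinOut k' j' u') :
    (comp₁ hT hS hc).JoinIn ⟨(), k⟩ j ⟨(), k'⟩ j' :=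
  comp_joinIn (i := ()) (i' := ()) (S := fun _ => S) h h' h''

theorem comp₁_joinOut {k : κ} {j u v : ℕ} (h : S.JoinOut k j u)
    (h' : T.JoinOut () u v) : (comp₁ hT hS hc).JoinOut ⟨(), k⟩ j v :=
  comp_joinOut (i := ()) (S := fun _ => S) h h'

end OneDisc

theorem mirror_rotation_joinOut {c : Col} {s : ℕ} (hs : s ≤ c.size) {j u : ℕ} (hj : j < 2 * c.size)
    (hu : u < 2 * c.size) (h : u = j + 2 * s ∨ u + 2 * c.size = j + 2 * s) :
    (rotation c s hs).mirror.JoinOut () j u :=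
  mirror_joinOut hj hu (rotation_joinOut hs (by omega) (by omega) (by omega))

/-- The internal disc of a composite of two tangles with one internal disc each. -/
def unitEquiv : (Σ _ : Unit, Unit) ≃ Unit where
  toFun _ := ()
  invFun _ := ⟨(), ()⟩
  left_inv _ := rfl
  right_inv _ := rfl

/-- The reflection of a rotation is the inverse rotation. -/
theorem rotation_mirror_sameMatching {c : Col} {s : ℕ} (hs : s ≤ c.size) (h : 0 < c.size) :
    SameMatching unitEquiv
      (comp₁ (rotation_isTight s hs) (mirror_isTight (rotation_isTight s hs)) h)
      (rotation c 0 (Nat.zero_le _)) := by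
  rintro ⟨⟨⟩, ⟨⟩⟩ j hj
  have hj : j < 2 * c.size := hj
  refine .inr ⟨j, ?_, identity_joinOut hj⟩
  by_cases h1 : j + 2 * s < 2 * c.size
  · exact comp₁_joinOut (mirror_rotation_joinOut hs hj h1 (.inl rfl))
      (rotation_joinOut hs h1 hj (.inl rfl))
  · exact comp₁_joinOut
      (mirror_rotation_joinOut hs hj (u := j + 2 * s - 2 * c.size) (by omega) (by omega))
      (rotation_joinOut hs (by omega) hj (by omega))

theorem rotation_full_sameMatching (c : Col) :
    SameMatching (Equiv.refl Unit) (rotation c c.size le_rfl) (rotation c 0 (Nat.zero_le _)) := by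
  rintro ⟨⟩ j hj
  exact .inr ⟨j, rotation_joinOut _ hj hj (.inr rfl), identity_joinOut hj⟩

section Dagger

variable {k m n t : ℕ}

/-- The exchange of the two discs in a product. -/
def swapEquiv : (Σ _ : Unit, Bool) ≃ Σ i, Idx Unit Unit i where
  toFun
    | ⟨_, b⟩ => Bool.rec ⟨true, ()⟩ ⟨false, ()⟩ b
  invFun
    | ⟨false, _⟩ => ⟨(), true⟩
    | ⟨true, _⟩ => ⟨(), false⟩
  left_inv := by rintro ⟨_, _ | _⟩ <;> rfl
  right_inv := by rintro ⟨_ | _, _⟩ <;> rfl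

theorem ProdRange.symm (h : ProdRange k m n t) : ProdRange k n m t := by
  obtain ⟨h1, h2, h3, h4, h5, h6⟩ := h
  exact ⟨h1, h3, h2, h5, h4, by omega⟩

theorem ProdRange.le_out (h : ProdRange k m n t) : k ≤ t := by
  obtain ⟨h1, h2, h3, h4, h5, h6⟩ := h
  omega

/-- The reflected and rotated product is the product, in the other order, of the rotated boxes. -/
theorem dagger_sameMatching (h : ProdRange k m n t) (ht : 0 < t) (hm : 0 < m) (hn : 0 < n) :
    SameMatching swapEquiv
      (comp₁ (rotation_isTight (c := .nat t) k h.le_out) (mirror_isTight (prod_isTight h)) ht)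
      (comp₂ (prod_isTight h.symm) (rotation_isTight (c := .nat n) k h.le_right)
        (rotation_isTight (c := .nat m) k h.le_left) hn hm) := by
  have h1 := h.pos
  have h2 := h.le_left
  have h3 := h.le_right
  have h4 := h.left_le
  have h5 := h.right_le
  have h6 := h.le_add
  have h7 := h.le_out
  -- the rotations, as subtraction of `2 * k`
  have rot : ∀ (N : ℕ) (hN : k ≤ N) j, j < 2 * N → (rotation (.nat N) k hN).JoinOut () j
      (if 2 * k ≤ j then j - 2 * k else j + 2 * N - 2 * k) := by
    intro N hN j hj
    have e : (Col.nat N).size = N := rfl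
    refine rotation_joinOut _ hj ?_ ?_
    · rw [e]
      split_ifs <;> omega
    · rw [e]
      split_ifs <;> omega
  have join : ∀ j j', j < 2 * m → j' < 2 * n →
      ((n + t + k ≤ m + j' ∧ j + j' + 1 = 2 * n + 2 * k) ∨ (j' < k ∧ j + j' + 1 = 2 * k)) →
      (comp₁ (rotation_isTight (c := .nat t) k h.le_out) (mirror_isTight (prod_isTight h))
        ht).JoinIn ⟨(), false⟩ j ⟨(), true⟩ j' ∧
      (comp₂ (prod_isTight h.symm) (rotation_isTight (c := .nat n) k h.le_right)
        (rotation_isTight (c := .nat m) k h.le_left) hn hm).JoinIn ⟨false, ()⟩ j' ⟨true, ()⟩ j := by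
    intro j j' hj hj' hjj
    constructor
    · refine comp₁_joinIn_same (mirror_joinIn hj hj' ?_)
      change (prod k m n t h).JoinIn false (2 * m - 1 - j) true (2 * n - 1 - j')
      exact prod_joinIn h (by omega) (by omega) (by omega)
    · refine comp₂_joinIn (rot n h3 j' hj') (prod_joinIn h.symm ?_ ?_ ?_) (rot m h2 j hj)
      all_goals split_ifs <;> omega
  rintro ⟨⟨⟩, _ | _⟩ j hj
  · have hj : j < 2 * m := hj
    by_cases x1 : j < k ∨ m + n + k ≤ j + t
    · refine .inr ⟨if j < k then j + 2 * t - 2 * k else j + 2 * t - 2 * m - 2 * k, ?_, ?_⟩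
      · rcases x1 with x1 | x1
        · rw [if_pos x1]
          refine comp₁_joinOut (u := j) (mirror_joinOut hj (by change j < 2 * t; omega) ?_)
            (rotation_joinOut _ (by change j < 2 * t; omega) ?_ ?_)
          · change (prod k m n t h).JoinOut false (2 * m - 1 - j) (2 * t - 1 - j)
            exact prod_joinOut_left h (by omega) (by omega) (by omega)
          · change _ < 2 * t
            omega
          · change _ ∨ _ + 2 * t = _
            omega
        · rw [if_neg (by omega)]
          refine comp₁_joinOut (u := j + 2 * t - 2 * m)
            (mirror_joinOut hj (by change _ < 2 * t; omega) ?_)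
            (rotation_joinOut _ (by change _ < 2 * t; omega) ?_ ?_)
          · change (prod k m n t h).JoinOut false (2 * m - 1 - j) (2 * t - 1 - (j + 2 * t - 2 * m))
            rw [show 2 * t - 1 - (j + 2 * t - 2 * m) = 2 * m - 1 - j by omega]
            exact prod_joinOut_low h (by omega)
          · change _ < 2 * t
            omega
          · change _ ∨ _ + 2 * t = _
            omega
      · refine comp₂_joinOut_right (rot m h2 j hj) (prod_joinOut_right h.symm ?_ ?_ ?_)
        all_goals split_ifs <;> omega
    · left
      by_cases x2 : j < 2 * k
      · obtain ⟨y1, y2⟩ := join j (2 * k - 1 - j) hj (by omega) (by omega)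
        exact ⟨⟨(), true⟩, _, (fun h => nomatch h), y1, y2.symm⟩
      · obtain ⟨y1, y2⟩ := join j (2 * n + 2 * k - 1 - j) hj (by omega) (by omega)
        exact ⟨⟨(), true⟩, _, (fun h => nomatch h), y1, y2.symm⟩
  · have hj : j < 2 * n := hj
    by_cases x1 : k ≤ j ∧ j + m + 1 ≤ n + k + t
    · refine .inr ⟨if 2 * k ≤ j then j - 2 * k else j + 2 * t - 2 * k, ?_, ?_⟩
      · refine comp₁_joinOut (u := j) (mirror_joinOut hj (by change j < 2 * t; omega) ?_)
          (rot t h7 j (by omega))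
        change (prod k m n t h).JoinOut true (2 * n - 1 - j) (2 * t - 1 - j)
        exact prod_joinOut_right h (by omega) (by omega) (by omega)
      · by_cases x2 : 2 * k ≤ j
        · rw [if_pos x2]
          have := rot n h3 j hj
          rw [if_pos x2] at this
          exact comp₂_joinOut_left this (prod_joinOut_low h.symm (by omega))
        · rw [if_neg x2]
          have := rot n h3 j hj
          rw [if_neg x2] at this
          exact comp₂_joinOut_left this
            (prod_joinOut_left h.symm (by omega) (by omega) (by omega))
    · left
      by_cases x2 : j < k
      · obtain ⟨y1, y2⟩ := join (2 * k - 1 - j) j (by omega) hj (by omega)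
        exact ⟨⟨(), false⟩, _, (fun h => nomatch h), y1.symm, y2⟩
      · obtain ⟨y1, y2⟩ := join (2 * n + 2 * k - 1 - j) j (by omega) hj (by omega)
        exact ⟨⟨(), false⟩, _, (fun h => nomatch h), y1.symm, y2⟩

end Dagger

section Closed

variable {k m : ℕ}

/-- In the trace of a product, point `j` of the first disc is connected with point
`- 1 - 2 * k - j` of the second disc, modulo `2 * m`. -/
theorem trace_prod_joinIn (h : ProdRange k m m k) (hk : 0 < k) {j j' : ℕ} (hj : j < 2 * m)
    (hj' : j' < 2 * m) (hjj : j + j' + 1 + 2 * k = 2 * m ∨ j + j' + 1 + 2 * k = 4 * m) :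
    (comp₁ (trace_isTight k) (prod_isTight h) hk).JoinIn ⟨(), false⟩ j ⟨(), true⟩ j' := by
  have h2 := h.le_left
  by_cases x : j + k < 2 * m
  · exact comp₁_joinIn_same (prod_joinIn h (by omega) x (by omega))
  · exact comp₁_joinIn (prod_joinOut_left h (u := j + 2 * k - 2 * m) (by omega) hj (by omega))
      (trace_joinIn (j' := j' + 2 * k - 2 * m) (by omega))
      (prod_joinOut_right h (by omega) (by omega) (by omega))

/-- The exchange of the two discs in the trace of a product. -/
def flipEquiv : (Σ _ : Unit, Bool) ≃ Σ _ : Unit, Bool where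
  toFun p := ⟨(), !p.2⟩
  invFun p := ⟨(), !p.2⟩
  left_inv := by rintro ⟨_, _ | _⟩ <;> rfl
  right_inv := by rintro ⟨_, _ | _⟩ <;> rfl

/-- In the trace of a product, the condition on two points to be joined is symmetric in the two
discs. -/
theorem trace_comm_sameMatching (h : ProdRange k m m k) (hk : 0 < k) :
    SameMatching flipEquiv (comp₁ (trace_isTight k) (prod_isTight h) hk)
      (comp₁ (trace_isTight k) (prod_isTight h) hk) := by
  have h2 := h.le_left
  have key : ∀ j, j < 2 * m → ∃ j', j' < 2 * m ∧
      (j + j' + 1 + 2 * k = 2 * m ∨ j + j' + 1 + 2 * k = 4 * m) := by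
    intro j hj
    by_cases x : j + 2 * k < 2 * m
    · exact ⟨2 * m - 1 - 2 * k - j, by omega, by omega⟩
    · exact ⟨4 * m - 1 - 2 * k - j, by omega, by omega⟩
  rintro ⟨⟨⟩, _ | _⟩ j hj
  · obtain ⟨j', hj', hjj⟩ := key j hj
    exact .inl ⟨⟨(), true⟩, j', (fun h => nomatch h), trace_prod_joinIn h hk hj hj' hjj,
      (trace_prod_joinIn h hk hj' hj (by omega)).symm⟩
  · obtain ⟨j', hj', hjj⟩ := key j hj
    exact .inl ⟨⟨(), false⟩, j', (fun h => nomatch h),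
      (trace_prod_joinIn h hk hj' hj (by omega)).symm, trace_prod_joinIn h hk hj hj' hjj⟩

/-- The discs of the trace of a product of two rotated boxes, as those of the trace of a product. -/
def nestEquiv : (Σ _ : Unit, Σ i, Idx Unit Unit i) ≃ Σ _ : Unit, Bool where
  toFun
    | ⟨_, b, _⟩ => ⟨(), b⟩
  invFun
    | ⟨_, b⟩ => ⟨(), Bool.rec ⟨false, ()⟩ ⟨true, ()⟩ b⟩
  left_inv := by rintro ⟨_, _ | _, _⟩ <;> rfl
  right_inv := by rintro ⟨_, _ | _⟩ <;> rfl

/-- If the first disc is turned by `2 * k` points, then the trace of the product through `P_k` joins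
point `j` to point `2 * m - 1 - j`, as does the trace of the product of `P_m`. -/
theorem inner_sameMatching (h : ProdRange k m m k) (h' : ProdRange m m m m) (hk : 0 < k)
    (hm : 0 < m) :
    SameMatching nestEquiv (comp₁ (trace_isTight k) (comp₂_isTight (hT := prod_isTight h)
        (h₁ := rotation_isTight (c := .nat m) k h.le_left)
        (h₂ := rotation_isTight (c := .nat m) 0 (Nat.zero_le _)) (hp := hm) (hq := hm)) hk)
      (comp₁ (trace_isTight m) (prod_isTight h') hm) := by
  have h2 := h.le_left
  have key : ∀ j j', j + j' + 1 = 2 * m →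
      (comp₁ (trace_isTight k) (comp₂_isTight (hT := prod_isTight h)
        (h₁ := rotation_isTight (c := .nat m) k h.le_left)
        (h₂ := rotation_isTight (c := .nat m) 0 (Nat.zero_le _)) (hp := hm) (hq := hm)) hk).JoinIn
          ⟨(), ⟨false, ()⟩⟩ j ⟨(), ⟨true, ()⟩⟩ j' ∧
      (comp₁ (trace_isTight m) (prod_isTight h') hm).JoinIn ⟨(), false⟩ j ⟨(), true⟩ j' := by
    intro j j' hjj
    have e : (Col.nat m).size = m := rfl
    refine ⟨?_, trace_prod_joinIn h' hm (by omega) (by omega) (by omega)⟩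
    by_cases x1 : 2 * k ≤ j
    · exact comp₁_joinIn_same (comp₂_joinIn (rotation_joinOut (u := j - 2 * k) _ (by omega)
        (by omega) (by omega)) (prod_joinIn h (by omega) (by omega) (by omega))
        (identity_joinOut (by omega)))
    · have rot : (rotation (.nat m) k h.le_left).JoinOut () j (j + 2 * m - 2 * k) :=
        rotation_joinOut _ (by omega) (by omega) (by omega)
      by_cases x2 : j < k
      · exact comp₁_joinIn_same (comp₂_joinIn rot (prod_joinIn h (by omega) (by omega) (by omega))
          (identity_joinOut (by omega)))
      · exact comp₁_joinIn (comp₂_joinOut_left rot (prod_joinOut_left h (u := j) (by omega)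
          (by omega) (by omega))) (trace_joinIn (j' := j' + 2 * k - 2 * m) (by omega))
          (comp₂_joinOut_right (identity_joinOut (by omega)) (prod_joinOut_right h (by omega)
          (by omega) (by omega)))
  rintro ⟨⟨⟩, _ | _, ⟨⟩⟩ j hj
  · have hj : j < 2 * m := hj
    obtain ⟨y1, y2⟩ := key j (2 * m - 1 - j) (by omega)
    exact .inl ⟨⟨(), ⟨true, ()⟩⟩, _, (fun h => nomatch h), y1, y2⟩
  · have hj : j < 2 * m := hj
    obtain ⟨y1, y2⟩ := key (2 * m - 1 - j) j (by omega)
    exact .inl ⟨⟨(), ⟨false, ()⟩⟩, _, (fun h => nomatch h), y1.symm, y2.symm⟩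

end Closed

theorem capPt_revPt {c : Col} (j : c.Pt) : capPt (Col.revPt j) = capPt j := by
  have hj := j.isLt
  refine Fin.ext ?_
  change min (Col.revPt j).val (2 * c.size - 1 - (Col.revPt j).val) =
    min j.val (2 * c.size - 1 - j.val)
  rw [revPt_val]
  omega

theorem capArc_revArc {c : Col} (a : c.Arc) : capArc (Col.revArc a) = capArc a := by
  have ha := a.isLt
  refine Fin.ext ?_
  change min (Col.revArc a).val (2 * c.size - (Col.revArc a).val) =
    min a.val (2 * c.size - a.val)
  rw [revArc_val]
  split_ifs <;> omega

theorem trace_isMirror (n : ℕ) : IsMirror (trace n) (trace n) :=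
  ⟨Equiv.refl _, Equiv.refl _, fun _ j => (capPt_revPt (c := .nat n) j).symm, fun j => j.elim0,
    fun _ a => (capArc_revArc (c := .nat n) a).symm, fun _ => rfl, fun _ => rfl, fun _ => rfl⟩

theorem unit_isMirror (c : Col) : IsMirror (unit c) (unit c) :=
  ⟨Equiv.refl _, Equiv.refl _, fun i => i.elim, fun j => (capPt_revPt j).symm,
    fun i => i.elim, fun a => (capArc_revArc a).symm, fun _ => rfl, fun _ => rfl⟩

/-! ### Unit laws -/

/-- A tangle whose internal discs are renamed along `e`, where the colours agree only up to a
propositional equality. -/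
theorem exists_recolour {ι ι' : Type} [Finite ι] [Finite ι'] {c : ι → Col} {c' : ι' → Col}
    {c₀ : Col} (e : ι ≃ ι') (hc : ∀ i, c i = c' (e i)) (T : Tangle c' c₀) :
    ∃ (T' : Tangle c c₀) (f : T.Curve ≃ T'.Curve) (g : T.Region ≃ T'.Region),
      (∀ i j, T'.inCurve i j = f (T.inCurve (e i) (Fin.cast (by rw [hc]) j))) ∧
      (∀ j, T'.outCurve j = f (T.outCurve j)) ∧
      (∀ i a, T'.inRegion i a = g (T.inRegion (e i) (Fin.cast (by rw [hc]) a))) ∧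
      (∀ a, T'.outRegion a = g (T.outRegion a)) ∧
      (∀ x, T'.white (f x) = g (T.white x)) ∧ (∀ x, T'.black (f x) = g (T.black x)) ∧
      ∀ (P : PlanarAlgebra.{u}) (x : ∀ i, P.V (c i)) (x' : ∀ i, P.V (c' i)),
        (∀ i, HEq (x i) (x' (e i))) → P.Z T' x = P.Z T x' := by
  obtain rfl : c = fun i => c' (e i) := funext hc
  refine ⟨T.reindex e, Equiv.refl _, Equiv.refl _, fun _ _ => rfl, fun _ => rfl, fun _ _ => rfl,
    fun _ => rfl, fun _ => rfl, fun _ => rfl, fun P x x' hx => ?_⟩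
  obtain rfl : x = fun i => x' (e i) := funext fun i => eq_of_heq (hx i)
  exact P.Z_relabel e _ T (reindex_isRelabelling e T) x'

/-- A quotient is described by a map which respects the relation, with a section up to the
relation. -/
theorem exists_quotEquiv {X Y : Type} {r : X → X → Prop} (f : X → Y) (g : Y → X)
    (hf : ∀ x y, r x y → f x = f y) (hfg : ∀ y, f (g y) = y)
    (h : ∀ x, Quot.mk r x = Quot.mk r (g (f x))) :
    ∃ φ : Quot r ≃ Y, ∀ x, φ (Quot.mk r x) = f x :=
  ⟨{ toFun := Quot.lift f hf
     invFun := fun y => Quot.mk r (g y)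
     left_inv := by
       intro q
       induction q using Quot.ind with
       | _ x => exact (h x).symm
     right_inv := hfg }, fun _ => rfl⟩

section Unit

variable {k n : ℕ}

/-- The only internal disc left if the unit is inserted into the first disc. -/
def trueEquiv : (Σ i, Idx Empty Unit i) ≃ Unit where
  toFun _ := ()
  invFun _ := ⟨true, ()⟩
  left_inv := by rintro ⟨_ | _, ⟨⟩⟩; rfl
  right_inv _ := rfl

/-- The curve of the identity tangle to which a curve in the product of the unit and the identity
belongs. -/
def unitCurve (h : ProdRange k k n n) : (prod k k n n h).Curve ⊕
    (Σ i, (idxTangle (unit (.nat k)) (rotation (.nat n) 0 (Nat.zero_le _)) i).Curve) →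
    (Col.nat n).Pt
  | .inl x => ⟨if x.val < 2 * n then x.val else 4 * n - 1 - x.val, by
      have hx : x.val < k + n + n := x.isLt
      have h1 := h.le_right
      have h2 := h.pos
      change _ < 2 * n
      split_ifs <;> omega⟩
  | .inr ⟨false, x⟩ => ⟨2 * n - 1 - x.val, by
      have h1 := h.le_right
      have h2 := h.pos
      change _ < 2 * n
      omega⟩
  | .inr ⟨true, x⟩ => x

/-- The region of the identity tangle to which a region in the product of the unit and the identity
belongs. -/
def unitRegion (h : ProdRange k k n n) : (prod k k n n h).Region ⊕
    (Σ i, (idxTangle (unit (.nat k)) (rotation (.nat n) 0 (Nat.zero_le _)) i).Region) →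
    (Col.nat n).Arc
  | .inl x => ⟨if x.val < 2 * n then x.val else 4 * n - 1 - x.val, by
      have hx : x.val < k + n + n - 1 := x.isLt
      have h1 := h.le_right
      have h2 := h.pos
      change _ < max 1 (2 * n)
      split_ifs <;> omega⟩
  | .inr ⟨false, x⟩ => ⟨if x.val = 0 then 0 else 2 * n - x.val, by
      have h1 := h.le_right
      have h2 := h.pos
      change _ < max 1 (2 * n)
      split_ifs <;> omega⟩
  | .inr ⟨true, x⟩ => x

theorem unitCurve_glue (h : ProdRange k k n n) (x y) (hxy : GlueCurves (prod k k n n h)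
    (idxTangle (unit (.nat k)) (rotation (.nat n) 0 (Nat.zero_le _))) x y) :
    unitCurve h x = unitCurve h y := by
  have h1 := h.le_right
  have h2 := h.pos
  obtain ⟨_ | _, j, rfl, rfl⟩ := hxy
  · have hj : j.val < 2 * k := j.isLt
    refine Fin.ext ?_
    change (if prodA k k n n j.val < 2 * n then prodA k k n n j.val
      else 4 * n - 1 - prodA k k n n j.val) = 2 * n - 1 - min j.val (2 * k - 1 - j.val)
    unfold prodA
    split_ifs <;> omega
  · have hj : j.val < 2 * n := j.isLt
    refine Fin.ext ?_
    change (if prodB k k n n j.val < 2 * n then prodB k k n n j.val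
      else 4 * n - 1 - prodB k k n n j.val) = (j.val + 2 * 0) % (2 * n)
    rw [mul_zero, add_zero, Nat.mod_eq_of_lt hj]
    unfold prodB
    split_ifs <;> omega

theorem unitRegion_glue (h : ProdRange k k n n) (x y) (hxy : GlueRegions (prod k k n n h)
    (idxTangle (unit (.nat k)) (rotation (.nat n) 0 (Nat.zero_le _))) x y) :
    unitRegion h x = unitRegion h y := by
  have h1 := h.le_right
  have h2 := h.pos
  obtain ⟨_ | _, j, rfl, rfl⟩ := hxy
  · have hj : j.val < max 1 (2 * k) := j.isLt
    refine Fin.ext ?_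
    change (if prodArcA k k n n j.val < 2 * n then prodArcA k k n n j.val
      else 4 * n - 1 - prodArcA k k n n j.val) =
      if min j.val (2 * k - j.val) = 0 then 0 else 2 * n - min j.val (2 * k - j.val)
    unfold prodArcA
    split_ifs <;> omega
  · have hj : j.val < max 1 (2 * n) := j.isLt
    refine Fin.ext ?_
    change (if prodArcB k k n n j.val < 2 * n then prodArcB k k n n j.val
      else 4 * n - 1 - prodArcB k k n n j.val) = (j.val + 2 * 0) % (max 1 (2 * n))
    rw [mul_zero, add_zero, Nat.mod_eq_of_lt hj]
    unfold prodArcB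
    split_ifs <;> omega

theorem unitCurve_white (h : ProdRange k k n n) (x : (prod k k n n h).Curve) :
    unitRegion h (.inl ((prod k k n n h).white x)) = Col.whiteArc (unitCurve h (.inl x)) := by
  have h1 := h.le_right
  have h2 := h.pos
  have hx : x.val < k + n + n := x.isLt
  refine Fin.ext ?_
  rw [Col.whiteArc_val]
  change (if prodWhite k k n n x.val < 2 * n then prodWhite k k n n x.val
      else 4 * n - 1 - prodWhite k k n n x.val) =
    if (if x.val < 2 * n then x.val else 4 * n - 1 - x.val) % 2 = 0
    then (if x.val < 2 * n then x.val else 4 * n - 1 - x.val)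
    else if (if x.val < 2 * n then x.val else 4 * n - 1 - x.val) + 1 < 2 * n
      then (if x.val < 2 * n then x.val else 4 * n - 1 - x.val) + 1 else 0
  by_cases h3 : x.val < 2 * n
  · simp only [prodWhite, if_pos h3]
    split_ifs <;> omega
  · simp only [prodWhite, prodArcA, if_neg h3]
    split_ifs <;> omega

theorem unitCurve_black (h : ProdRange k k n n) (x : (prod k k n n h).Curve) :
    unitRegion h (.inl ((prod k k n n h).black x)) = Col.blackArc (unitCurve h (.inl x)) := by
  have h1 := h.le_right
  have h2 := h.pos
  have hx : x.val < k + n + n := x.isLt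
  refine Fin.ext ?_
  rw [Col.blackArc_val]
  change (if prodBlack k k n n x.val < 2 * n then prodBlack k k n n x.val
      else 4 * n - 1 - prodBlack k k n n x.val) =
    if (if x.val < 2 * n then x.val else 4 * n - 1 - x.val) % 2 = 0
    then (if x.val < 2 * n then x.val else 4 * n - 1 - x.val) + 1
    else (if x.val < 2 * n then x.val else 4 * n - 1 - x.val)
  by_cases h3 : x.val < 2 * n
  · simp only [prodBlack, if_pos h3]
    split_ifs <;> omega
  · simp only [prodBlack, prodArcA, if_neg h3]
    split_ifs <;> omega

theorem unitCurve_white_unit (h : ProdRange k k n n) (x : Fin k) :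
    unitRegion h (.inr ⟨false, (unit (.nat k)).white x⟩) =
      Col.whiteArc (unitCurve h (.inr ⟨false, x⟩)) := by
  have h1 := h.le_right
  have hx := x.isLt
  refine Fin.ext ?_
  rw [Col.whiteArc_val]
  change (if (if x.val % 2 = 0 then x.val else x.val + 1) = 0 then 0
    else 2 * n - (if x.val % 2 = 0 then x.val else x.val + 1)) =
    if (2 * n - 1 - x.val) % 2 = 0 then 2 * n - 1 - x.val
    else if 2 * n - 1 - x.val + 1 < 2 * n then 2 * n - 1 - x.val + 1 else 0
  split_ifs <;> first | contradiction | omega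

theorem unitCurve_black_unit (h : ProdRange k k n n) (x : Fin k) :
    unitRegion h (.inr ⟨false, (unit (.nat k)).black x⟩) =
      Col.blackArc (unitCurve h (.inr ⟨false, x⟩)) := by
  have h1 := h.le_right
  have hx := x.isLt
  refine Fin.ext ?_
  rw [Col.blackArc_val]
  change (if (if x.val % 2 = 0 then x.val + 1 else x.val) = 0 then 0
    else 2 * n - (if x.val % 2 = 0 then x.val + 1 else x.val)) =
    if (2 * n - 1 - x.val) % 2 = 0 then 2 * n - 1 - x.val + 1 else 2 * n - 1 - x.val
  split_ifs <;> first | contradiction | omega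

/-- The curves of the product of the unit and the identity are those of the identity tangle. -/
theorem exists_unitCurve (h : ProdRange k k n n) : ∃ φ : Quot (GlueCurves (prod k k n n h)
    (idxTangle (unit (.nat k)) (rotation (.nat n) 0 (Nat.zero_le _)))) ≃ (Col.nat n).Pt,
    ∀ x, φ (Quot.mk _ x) = unitCurve h x := by
  have h1 := h.le_right
  have h2 := h.pos
  refine exists_quotEquiv (unitCurve h) (fun y => .inr ⟨true, y⟩) (unitCurve_glue h)
    (fun _ => rfl) ?_
  set r := GlueCurves (prod k k n n h)
    (idxTangle (unit (.nat k)) (rotation (.nat n) 0 (Nat.zero_le _))) with hr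
  have right : ∀ j : (Col.nat n).Pt, Quot.mk r (.inl ((prod k k n n h).inCurve true j)) =
      Quot.mk r (.inr ⟨true, j⟩) := by
    intro j
    have hj : j.val < 2 * n := j.isLt
    refine (Quot.sound ⟨true, j, rfl, rfl⟩).trans
      (congrArg (fun z => Quot.mk r (.inr ⟨true, z⟩)) ?_)
    refine Fin.ext ?_
    change (j.val + 2 * 0) % (2 * n) = j.val
    rw [mul_zero, add_zero, Nat.mod_eq_of_lt hj]
  have left : ∀ j : (Col.nat k).Pt, Quot.mk r (.inl ((prod k k n n h).inCurve false j)) =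
      Quot.mk r (.inr ⟨false, capPt j⟩) := fun j => Quot.sound ⟨false, j, rfl, rfl⟩
  -- the curves that meet the second disc; the others lead to it through the unit
  have high : ∀ x : (prod k k n n h).Curve, (x.val < 2 * n - k ∨ 2 * n ≤ x.val) →
      Quot.mk r (.inl x) = Quot.mk r (.inr ⟨true, unitCurve h (.inl x)⟩) := by
    intro x hx
    rw [← right]
    refine congrArg (fun z => Quot.mk r (.inl z)) (Fin.ext ?_)
    have hx' : x.val < k + n + n := x.isLt
    change x.val = prodB k k n n (if x.val < 2 * n then x.val else 4 * n - 1 - x.val)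
    unfold prodB
    split_ifs <;> omega
  have unit : ∀ i : Fin k, Quot.mk r (.inr ⟨false, i⟩) =
      Quot.mk r (.inr ⟨true, unitCurve h (.inr ⟨false, i⟩)⟩) := by
    intro i
    have hi := i.isLt
    have e := (left ⟨i.val, by change _ < 2 * k; omega⟩).symm.trans ((high _ (by
      right
      change 2 * n ≤ prodA k k n n i.val
      unfold prodA
      split_ifs <;> omega)).trans (congrArg (fun z => Quot.mk r (.inr ⟨true, z⟩))
        (unitCurve_glue h _ _ ⟨false, _, rfl, rfl⟩)))
    have e' : (capPt ⟨i.val, by change _ < 2 * k; omega⟩ : Fin (Col.nat k).size) = i := by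
      refine Fin.ext ?_
      change min i.val (2 * k - 1 - i.val) = i.val
      omega
    exact (congrArg (fun z => Quot.mk r (.inr ⟨false, z⟩)) e').symm.trans (e.trans
      (congrArg (fun z => Quot.mk r (.inr ⟨true, unitCurve h (.inr ⟨false, z⟩)⟩)) e'))
  rintro (x | ⟨_ | _, x⟩)
  · have hx' : x.val < k + n + n := x.isLt
    by_cases hx : x.val < 2 * n - k ∨ 2 * n ≤ x.val
    · exact high x hx
    · have e := left ⟨x.val + 2 * k - 2 * n, by change _ < 2 * k; omega⟩
      have e' : (prod k k n n h).inCurve false ⟨x.val + 2 * k - 2 * n, by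
          change _ < 2 * k; omega⟩ = x := by
        refine Fin.ext ?_
        change prodA k k n n (x.val + 2 * k - 2 * n) = x.val
        unfold prodA
        split_ifs <;> omega
      rw [← e']
      exact (e.trans (unit _)).trans (congrArg (fun z => Quot.mk r (.inr ⟨true, z⟩))
        (unitCurve_glue h _ _ ⟨false, _, rfl, rfl⟩).symm)
  · exact unit x
  · rfl

/-- The regions of the product of the unit and the identity are those of the identity tangle. -/
theorem exists_unitRegion (h : ProdRange k k n n) : ∃ ψ : Quot (GlueRegions (prod k k n n h)
    (idxTangle (unit (.nat k)) (rotation (.nat n) 0 (Nat.zero_le _)))) ≃ (Col.nat n).Arc,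
    ∀ x, ψ (Quot.mk _ x) = unitRegion h x := by
  have h1 := h.le_right
  have h2 := h.pos
  refine exists_quotEquiv (unitRegion h) (fun y => .inr ⟨true, y⟩) (unitRegion_glue h)
    (fun _ => rfl) ?_
  set r := GlueRegions (prod k k n n h)
    (idxTangle (unit (.nat k)) (rotation (.nat n) 0 (Nat.zero_le _))) with hr
  have right : ∀ j : (Col.nat n).Arc, Quot.mk r (.inl ((prod k k n n h).inRegion true j)) =
      Quot.mk r (.inr ⟨true, j⟩) := by
    intro j
    have hj : j.val < max 1 (2 * n) := j.isLt
    refine (Quot.sound ⟨true, j, rfl, rfl⟩).trans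
      (congrArg (fun z => Quot.mk r (.inr ⟨true, z⟩)) ?_)
    refine Fin.ext ?_
    change (j.val + 2 * 0) % (max 1 (2 * n)) = j.val
    rw [mul_zero, add_zero, Nat.mod_eq_of_lt hj]
  have left : ∀ j : (Col.nat k).Arc, Quot.mk r (.inl ((prod k k n n h).inRegion false j)) =
      Quot.mk r (.inr ⟨false, capArc j⟩) := fun j => Quot.sound ⟨false, j, rfl, rfl⟩
  -- the regions that meet the second disc; the others lead to it through the unit
  have high : ∀ x : (prod k k n n h).Region, (x.val ≤ 2 * n - k ∨ 2 * n ≤ x.val) →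
      Quot.mk r (.inl x) = Quot.mk r (.inr ⟨true, unitRegion h (.inl x)⟩) := by
    intro x hx
    rw [← right]
    refine congrArg (fun z => Quot.mk r (.inl z)) (Fin.ext ?_)
    have hx' : x.val < k + n + n - 1 := x.isLt
    change x.val = prodArcB k k n n (if x.val < 2 * n then x.val else 4 * n - 1 - x.val)
    unfold prodArcB
    split_ifs <;> omega
  have unit : ∀ i : Fin (k + 1), Quot.mk r (.inr ⟨false, i⟩) =
      Quot.mk r (.inr ⟨true, unitRegion h (.inr ⟨false, i⟩)⟩) := by
    intro i
    have hi := i.isLt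
    have e := (left ⟨i.val, by change _ < max 1 (2 * k); omega⟩).symm.trans ((high _ (by
      change prodArcA k k n n i.val ≤ 2 * n - k ∨ 2 * n ≤ prodArcA k k n n i.val
      unfold prodArcA
      split_ifs <;> omega)).trans (congrArg (fun z => Quot.mk r (.inr ⟨true, z⟩))
        (unitRegion_glue h _ _ ⟨false, _, rfl, rfl⟩)))
    have e' : (capArc ⟨i.val, by change _ < max 1 (2 * k); omega⟩ :
        Fin ((Col.nat k).size + 1)) = i := by
      refine Fin.ext ?_
      change min i.val (2 * k - i.val) = i.val
      omega
    exact (congrArg (fun z => Quot.mk r (.inr ⟨false, z⟩)) e').symm.trans (e.trans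
      (congrArg (fun z => Quot.mk r (.inr ⟨true, unitRegion h (.inr ⟨false, z⟩)⟩)) e'))
  rintro (x | ⟨_ | _, x⟩)
  · have hx' : x.val < k + n + n - 1 := x.isLt
    by_cases hx : x.val ≤ 2 * n - k ∨ 2 * n ≤ x.val
    · exact high x hx
    · have e := left ⟨x.val + 2 * k - 2 * n, by change _ < max 1 (2 * k); omega⟩
      have e' : (prod k k n n h).inRegion false ⟨x.val + 2 * k - 2 * n, by
          change _ < max 1 (2 * k); omega⟩ = x := by
        refine Fin.ext ?_
        change prodArcA k k n n (x.val + 2 * k - 2 * n) = x.val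
        unfold prodArcA
        split_ifs <;> omega
      rw [← e']
      exact (e.trans (unit _)).trans (congrArg (fun z => Quot.mk r (.inr ⟨true, z⟩))
        (unitRegion_glue h _ _ ⟨false, _, rfl, rfl⟩).symm)
  · exact unit x
  · rfl

end Unit

/-- There is no internal disc left if the unit is inserted into the trace tangle. -/
def emptyEquiv : (Σ _ : Unit, Empty) ≃ Empty where
  toFun p := p.2
  invFun i := i.elim
  left_inv p := p.2.elim
  right_inv i := i.elim

end Tangle

namespace PlanarAlgebra

open Tangle

variable (P : PlanarAlgebra.{u})

/-- The left unit law. The unit tangle is not tight, as it has no internal discs; therefore the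
composite is compared with the identity tangle directly. -/
theorem prodMap_unitElem_left {k n : ℕ} (h : ProdRange k k n n) (b : P.V (.nat n)) :
    P.prodMap h (P.unitElem (.nat k)) b = b := by
  obtain ⟨φ, hφ⟩ := exists_unitCurve h
  obtain ⟨ψ, hψ⟩ := exists_unitRegion h
  obtain ⟨T, f, g, h1, h2, h3, h4, h5, h6, h7⟩ := exists_recolour.{u}
    (c := fun p : Σ i, Idx Empty Unit i =>
      idxCol (fun i : Empty => (i.elim : Col)) (fun _ : Unit => Col.nat n) p.1 p.2)
    (c' := fun _ => .nat n) trueEquiv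
    (by rintro ⟨_ | _, ⟨⟩⟩; rfl) (rotation (.nat n) 0 (Nat.zero_le _))
  have rot : ∀ j : (Col.nat n).Pt, rotPt (.nat n) 0 j = j := fun j => Fin.ext (by
    have hj := j.isLt
    change (j.val + 2 * 0) % (2 * (Col.nat n).size) = j.val
    rw [mul_zero, add_zero, Nat.mod_eq_of_lt hj])
  have rot' : ∀ j : (Col.nat n).Arc, rotArc (.nat n) 0 j = j := fun j => Fin.ext (by
    have hj := j.isLt
    change (j.val + 2 * 0) % (max 1 (2 * (Col.nat n).size)) = j.val
    rw [mul_zero, add_zero, Nat.mod_eq_of_lt hj])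
  have hn : 0 < n := lt_of_lt_of_le h.pos h.le_right
  have hcomp : IsComposite (prod k k n n h)
      (idxTangle (unit (.nat k)) (rotation (.nat n) 0 (Nat.zero_le _))) T := by
    refine ⟨φ.trans f, ψ.trans g, ?_, ?_, ?_, ?_, ?_, ?_, ?_, ?_⟩
    · intro j
      refine (congrArg f (hφ _)).trans ((congrArg f ?_).trans (h2 j).symm)
      refine Fin.ext ?_
      refine Eq.trans ?_ (congrArg Fin.val (rot j)).symm
      exact if_pos j.isLt
    · rintro (_ | _) ⟨⟩ j
      exact (congrArg f (hφ _)).trans (h1 ⟨true, ()⟩ j).symm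
    · intro j
      refine (congrArg g (hψ _)).trans ((congrArg g ?_).trans (h4 j).symm)
      refine Fin.ext ?_
      refine Eq.trans ?_ (congrArg Fin.val (rot' j)).symm
      refine if_pos ?_
      have hj : j.val < max 1 (2 * n) := j.isLt
      change j.val < 2 * n
      omega
    · rintro (_ | _) ⟨⟩ j
      exact (congrArg g (hψ _)).trans (h3 ⟨true, ()⟩ j).symm
    · intro x
      refine (congrArg g ((hψ _).trans (unitCurve_white h x))).trans ?_
      exact (h5 _).symm.trans (congrArg (fun z => T.white (f z)) (hφ _).symm)
    · intro x
      refine (congrArg g ((hψ _).trans (unitCurve_black h x))).trans ?_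
      exact (h6 _).symm.trans (congrArg (fun z => T.black (f z)) (hφ _).symm)
    · rintro (_ | _) x
      · refine (congrArg g ((hψ _).trans (unitCurve_white_unit h x))).trans ?_
        exact (h5 _).symm.trans (congrArg (fun z => T.white (f z)) (hφ _).symm)
      · refine (congrArg g (hψ _)).trans ?_
        exact (h5 _).symm.trans (congrArg (fun z => T.white (f z)) (hφ (.inr ⟨true, x⟩)).symm)
    · rintro (_ | _) x
      · refine (congrArg g ((hψ _).trans (unitCurve_black_unit h x))).trans ?_
        exact (h6 _).symm.trans (congrArg (fun z => T.black (f z)) (hφ _).symm)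
      · refine (congrArg g (hψ _)).trans ?_
        exact (h6 _).symm.trans (congrArg (fun z => T.black (f z)) (hφ (.inr ⟨true, x⟩)).symm)
  have e := P.Z_composite _ _ _ hcomp
    (P.idxVec (d₁ := fun i : Empty => (i.elim : Col)) (fun i => i.elim) (fun _ => b))
  rw [h7 P _ (fun _ => b) (by rintro ⟨_ | _, ⟨⟩⟩; rfl), P.Z_identity] at e
  refine Eq.trans ?_ e.symm
  refine congrArg (P.Z (prod k k n n h)) (funext fun i => ?_)
  cases i
  · rfl
  · exact (P.Z_identity (.nat n) b).symm

/-- The trace of the unit of `P_1` is one loop. -/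
theorem trace_unitElem :
    P.unaryMap (trace 1) (P.unitElem (.nat 1)) = P.loopElem false := by
  obtain ⟨T, f, g, -, -, -, h4, h5, h6, h7⟩ := exists_recolour.{u}
    (c := fun p : Σ _ : Unit, Empty => (p.2.elim : Col)) emptyEquiv (fun p => p.2.elim)
    (loop false)
  let S : ∀ _ : Unit, Tangle (fun i : Empty => (i.elim : Col)) (.nat 1) := fun _ => unit (.nat 1)
  have hc : ∀ x y : Fin 1, x = y := fun x y => Subsingleton.elim _ _
  obtain ⟨φ, -⟩ : ∃ φ : Quot (GlueCurves (trace 1) S) ≃ Unit, ∀ x, φ (Quot.mk _ x) = () := by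
    refine exists_quotEquiv (fun _ => ()) (fun _ => .inl (show Fin 1 from 0)) (fun _ _ _ => rfl)
      (fun _ => rfl) ?_
    have glue : ∀ x y : Fin 1, Quot.mk (GlueCurves (trace 1) S) (.inl x) =
        Quot.mk (GlueCurves (trace 1) S) (.inr ⟨(), y⟩) := fun x y =>
      Quot.sound ⟨(), ⟨0, by decide⟩, congrArg _ (hc _ _),
        congrArg (fun z : Fin 1 => Sum.inr (⟨(), z⟩ : Σ i, (S i).Curve)) (hc _ _)⟩
    rintro (x | ⟨⟨⟩, x⟩)
    · exact (glue x 0).trans (glue _ 0).symm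
    · exact (glue _ x).symm
  obtain ⟨ψ, hψ, hψ'⟩ : ∃ ψ : Quot (GlueRegions (trace 1) S) ≃ Bool,
      (∀ x : Fin 2, ψ (Quot.mk _ (.inl x)) = (x.val == 1)) ∧
      ∀ x : Fin 2, ψ (Quot.mk _ (.inr ⟨(), x⟩)) = (x.val == 1) := by
    have key : ∀ x : Fin 2, (if (x.val == 1) = true then (1 : Fin 2) else 0) = x := by decide
    have glue : ∀ x : Fin 2, Quot.mk (GlueRegions (trace 1) S) (.inl x) =
        Quot.mk (GlueRegions (trace 1) S) (.inr ⟨(), x⟩) := by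
      intro x
      have e : ∀ y : Fin 2, (⟨min y.val (2 * 1 - y.val), by omega⟩ : Fin 2) = y := by decide
      exact Quot.sound ⟨(), x, congrArg _ (e x).symm,
        congrArg (fun z : Fin 2 => Sum.inr (⟨(), z⟩ : Σ i, (S i).Region)) (e x).symm⟩
    obtain ⟨ψ, h⟩ := exists_quotEquiv (r := GlueRegions (trace 1) S)
      (Sum.elim (fun x : Fin 2 => (x.val == 1)) (fun x => ((show Fin 2 from x.2).val == 1)))
      (fun b => .inl (show Fin 2 from if b then 1 else 0))
      (by rintro _ _ ⟨⟨⟩, a, rfl, rfl⟩; rfl) (by rintro (_ | _) <;> rfl) (by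
        rintro (x | ⟨⟨⟩, x⟩)
        · exact congrArg (fun z : Fin 2 => Quot.mk (GlueRegions (trace 1) S) (.inl z)) (key x).symm
        · exact (glue x).symm.trans
            (congrArg (fun z : Fin 2 => Quot.mk (GlueRegions (trace 1) S) (.inl z)) (key x).symm))
    exact ⟨ψ, fun x => h _, fun x => h _⟩
  have hw : ∀ z : Unit, T.white (f z) = g false := fun z => h5 z
  have hb : ∀ z : Unit, T.black (f z) = g true := fun z => h6 z
  have hcomp : IsComposite (trace 1) S T := by
    refine ⟨φ.trans f, ψ.trans g, fun j => j.elim0, ?_, ?_, ?_, ?_, ?_, ?_, ?_⟩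
    · rintro _ ⟨⟩
    · intro a
      exact (congrArg g (hψ _)).trans (h4 a).symm
    · rintro _ ⟨⟩
    · intro x
      obtain rfl : x = (0 : Fin 1) := hc _ _
      exact (congrArg g (hψ _)).trans (hw _).symm
    · intro x
      obtain rfl : x = (0 : Fin 1) := hc _ _
      exact (congrArg g (hψ _)).trans (hb _).symm
    · rintro ⟨⟩ x
      obtain rfl : x = (0 : Fin 1) := hc _ _
      exact (congrArg g (hψ' _)).trans (hw _).symm
    · rintro ⟨⟩ x
      obtain rfl : x = (0 : Fin 1) := hc _ _
      exact (congrArg g (hψ' _)).trans (hb _).symm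
  have e := P.Z_composite _ _ _ hcomp (fun p => p.2.elim)
  refine Eq.trans ?_ (e.symm.trans (h7 P _ (fun i => i.elim) (fun p => p.2.elim)))
  exact congrArg (P.Z (trace 1)) (funext fun _ => congrArg (P.Z (unit (.nat 1)))
    (funext fun i => i.elim))

end PlanarAlgebra

/-! ### Involution and trace on the components -/

open Tangle

theorem PlanarAlgebra.Z_comp₁ (P : PlanarAlgebra.{u}) {κ : Type} [Finite κ] {d : κ → Col}
    {c c₀ : Col} {T : Tangle (fun _ : Unit => c) c₀} (hT : T.IsTight) {S : Tangle d c}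
    (hS : S.IsTight) (hc : 0 < c.size) (x : ∀ p : Σ _ : Unit, κ, P.V (d p.2)) :
    P.Z (comp₁ hT hS hc) x = P.unaryMap T (P.Z S fun k => x ⟨(), k⟩) :=
  P.Z_comp (ι := Unit) (κ := fun _ => κ) (d := fun _ => d) (S := fun _ => S) (fun _ => hS) hT
    (fun _ => hc) x

namespace StarPlanarAlgebra

variable (P : StarPlanarAlgebra.{u})

/-- The involution of `F_k(P)` on the component `P_n`: the reflection of boxes with `k` strings on
either side. For `k = n` it is the involution of `P_n`. -/
def dagMap {k n : ℕ} (hk : k ≤ n) : P.V (.nat n) →ₛₗ[starRingEnd ℂ] P.V (.nat n) :=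
  (P.unaryMap (Tangle.rotation (.nat n) k hk)).comp (P.conj (.nat n))

variable {P} {k m n t : ℕ}

theorem dagMap_apply (hk : k ≤ n) (x : P.V (.nat n)) :
    P.dagMap hk x = P.unaryMap (Tangle.rotation (.nat n) k hk) (P.conj _ x) := rfl

theorem dagMap_dagMap (hk : k ≤ n) (hn : 0 < n) (x : P.V (.nat n)) :
    P.dagMap hk (P.dagMap hk x) = x := by
  have e : P.conj (.nat n) (P.dagMap hk x) =
      P.Z (Tangle.rotation (.nat n) k hk).mirror (fun _ => x) := by
    refine (P.conj_Z _ _ (mirror_isMirror _) _).trans ?_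
    exact congrArg _ (funext fun _ => P.conj_conj _ x)
  rw [dagMap_apply, e]
  refine (P.Z_comp₁ (rotation_isTight (c := .nat n) k hk)
    (mirror_isTight (rotation_isTight (c := .nat n) k hk)) hn (fun _ => x)).symm.trans ?_
  refine Eq.trans ?_ (P.Z_identity (.nat n) x)
  exact P.Z_congr unitEquiv comp₁_isTight (rotation_isTight 0 _)
    (show 0 < (Col.nat n).size from hn) (fun _ => rfl)
    (rotation_mirror_sameMatching (c := .nat n) hk hn) (fun _ => HEq.rfl)

/-- For `k = n` the rotation is a full turn. -/
theorem dagMap_self (hn : 0 < n) (x : P.V (.nat n)) : P.dagMap (le_refl n) x = P.conj _ x := by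
  refine Eq.trans ?_ (P.Z_identity (.nat n) _)
  exact P.Z_congr (Equiv.refl Unit) (rotation_isTight n _) (rotation_isTight 0 _)
    (show 0 < (Col.nat n).size from hn)
    (fun _ => rfl) (rotation_full_sameMatching (.nat n)) (fun _ => HEq.rfl)

theorem dagMap_prodMap (h : ProdRange k m n t) (a : P.V (.nat m)) (b : P.V (.nat n)) :
    P.dagMap h.le_out (P.prodMap h a b) =
      P.prodMap h.symm (P.dagMap h.le_right b) (P.dagMap h.le_left a) := by
  have ht : 0 < t := lt_of_lt_of_le h.pos h.le_out
  have hm : 0 < m := lt_of_lt_of_le h.pos h.le_left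
  have hn : 0 < n := lt_of_lt_of_le h.pos h.le_right
  have e : P.conj (.nat t) (P.prodMap h a b) =
      P.Z (Tangle.prod k m n t h).mirror (P.pair (P.conj _ a) (P.conj _ b)) := by
    refine (P.conj_Z _ _ (mirror_isMirror _) _).trans ?_
    refine congrArg _ (funext fun i => ?_)
    cases i <;> rfl
  rw [dagMap_apply, e]
  refine (P.Z_comp₁ (rotation_isTight (c := .nat t) k h.le_out)
    (mirror_isTight (prod_isTight h)) ht
    (fun p => P.pair (P.conj _ a) (P.conj _ b) p.2)).symm.trans ?_
  refine Eq.trans ?_ (P.Z_comp₂ (prod_isTight h.symm)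
    (rotation_isTight (c := .nat n) k h.le_right) (rotation_isTight (c := .nat m) k h.le_left)
    hn hm (fun _ => P.conj _ b) (fun _ => P.conj _ a))
  refine P.Z_congr swapEquiv comp₁_isTight comp₂_isTight
    (show 0 < (Col.nat t).size from ht) ?_
    (dagger_sameMatching h ht hm hn) ?_
  · rintro ⟨⟨⟩, _ | _⟩ <;> rfl
  · rintro ⟨⟨⟩, _ | _⟩ <;> rfl

theorem conj_unitElem (c : Col) : P.conj c (P.unitElem c) = P.unitElem c :=
  (P.conj_Z _ _ (unit_isMirror c) _).trans (congrArg _ (funext fun i => i.elim))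

theorem conj_trace (x : P.V (.nat n)) :
    P.conj (.nat 0) (P.unaryMap (trace n) x) = P.unaryMap (trace n) (P.conj _ x) :=
  P.conj_Z _ _ (trace_isMirror n) _

/-- The right unit law is the reflection of the left one. -/
theorem prodMap_unitElem_right (h : ProdRange k n k n) (b : P.V (.nat n)) :
    P.prodMap h b (P.unitElem (.nat k)) = b := by
  have hn : 0 < n := lt_of_lt_of_le h.pos h.le_left
  have hk : 0 < k := h.pos
  have hself : P.dagMap (le_refl k) (P.unitElem (.nat k)) = P.unitElem (.nat k) :=
    (dagMap_self hk _).trans (conj_unitElem _)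
  have e := dagMap_prodMap h.symm (P.unitElem (.nat k)) (P.dagMap h.le_left b)
  rw [hself, dagMap_dagMap _ hn, P.prodMap_unitElem_left, dagMap_dagMap _ hn] at e
  exact e.symm

end StarPlanarAlgebra

namespace SubfactorPlanarAlgebra

open StarPlanarAlgebra

variable {δ : ℝ} {P : SubfactorPlanarAlgebra.{u} δ} {k m n : ℕ}

theorem scalar_smul_unitElem (r : ℂ) : P.scalar (r • P.unitElem (.nat 0)) = r :=
  (LinearEquiv.ofBijective (LinearMap.toSpanSingleton ℂ _ (P.unitElem (.nat 0)))
    (P.connected false)).symm_apply_apply r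

theorem exists_eq_smul_unitElem (x : P.V (.nat 0)) : ∃ r : ℂ, x = r • P.unitElem (.nat 0) := by
  obtain ⟨r, hr⟩ := (P.connected false).2 x
  exact ⟨r, hr.symm⟩

theorem scalar_conj (x : P.V (.nat 0)) :
    P.scalar (P.conj _ x) = starRingEnd ℂ (P.scalar x) := by
  obtain ⟨r, rfl⟩ := exists_eq_smul_unitElem x
  rw [map_smulₛₗ, conj_unitElem, scalar_smul_unitElem, scalar_smul_unitElem]

theorem tau_apply (x : P.V (.nat n)) :
    P.tau n x = ((δ : ℂ) ^ n)⁻¹ * P.scalar (P.unaryMap (trace n) x) := rfl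

theorem tau_conj (x : P.V (.nat n)) : P.tau n (P.conj _ x) = starRingEnd ℂ (P.tau n x) := by
  rw [tau_apply, tau_apply, ← conj_trace, scalar_conj, map_mul, map_inv₀, map_pow,
    Complex.conj_ofReal]

theorem tau_one_unitElem (hδ : δ ≠ 0) : P.tau 1 (P.unitElem (.nat 1)) = 1 := by
  have e : P.loopElem false = (δ : ℂ) • P.unitElem (.nat 0) := P.modulus false
  rw [tau_apply, P.trace_unitElem, e]
  refine (congrArg _ (scalar_smul_unitElem _)).trans ?_
  rw [pow_one, inv_mul_cancel₀ (Complex.ofReal_ne_zero.2 hδ)]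

theorem trace_prodMap (h : ProdRange k m m k) (a b : P.V (.nat m)) :
    P.unaryMap (trace k) (P.prodMap h a b) =
      P.Z (comp₁ (trace_isTight k) (prod_isTight h) h.pos) (fun p => P.pair a b p.2) :=
  (P.Z_comp₁ (trace_isTight k) (prod_isTight h) h.pos (fun p => P.pair a b p.2)).symm

theorem tau_prodMap_comm (h : ProdRange k m m k) (a b : P.V (.nat m)) :
    P.tau k (P.prodMap h a b) = P.tau k (P.prodMap h b a) := by
  rw [tau_apply, tau_apply, trace_prodMap, trace_prodMap]
  refine congrArg (fun z => _ * P.scalar z) ?_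
  refine P.Z_congr_closed flipEquiv comp₁_isTight comp₁_isTight ?_
    (trace_comm_sameMatching h h.pos) ?_
  · rintro ⟨⟨⟩, _ | _⟩ <;> rfl
  · rintro ⟨⟨⟩, _ | _⟩ <;> rfl

/-- The inner product of `F_k(P)` on the component `P_m` is, up to a constant, that of `P_m`. -/
theorem trace_dagMap_prodMap (h : ProdRange k m m k) (hm : 1 ≤ m) (a b : P.V (.nat m)) :
    P.unaryMap (trace k) (P.prodMap h (P.dagMap h.le_left a) b) =
      P.unaryMap (trace m) (P.mulMap m hm (P.conj _ a) b) := by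
  have h' : ProdRange m m m m := ⟨hm, le_rfl, le_rfl, le_rfl, le_rfl, le_rfl⟩
  have e := P.Z_comp₂ (prod_isTight h) (rotation_isTight (c := .nat m) k h.le_left)
    (rotation_isTight (c := .nat m) 0 (Nat.zero_le _)) hm hm (fun _ => P.conj _ a) (fun _ => b)
  rw [P.Z_identity] at e
  have e' := P.Z_comp₁ (trace_isTight k) (comp₂_isTight (hT := prod_isTight h)
    (h₁ := rotation_isTight (c := .nat m) k h.le_left)
    (h₂ := rotation_isTight (c := .nat m) 0 (Nat.zero_le _)) (hp := hm) (hq := hm)) h.pos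
    (fun p => P.idxVec (d₁ := fun _ => .nat m) (d₂ := fun _ => .nat m) (fun _ : Unit => P.conj _ a)
      (fun _ : Unit => b) p.2)
  refine Eq.trans (congrArg (P.unaryMap (trace k)) e.symm) (e'.symm.trans ?_)
  refine Eq.trans ?_ (trace_prodMap h' _ _).symm
  refine P.Z_congr_closed nestEquiv comp₁_isTight comp₁_isTight ?_
    (inner_sameMatching h h' h.pos hm) ?_
  · rintro ⟨⟨⟩, _ | _, ⟨⟩⟩ <;> rfl
  · rintro ⟨⟨⟩, _ | _, ⟨⟩⟩ <;> rfl

/-- The inner product of `F_k(P)` on `P_m` is positive definite, as it is proportional to that of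
`P_m`. -/
theorem tau_dagMap_prodMap_pos (hδ : 0 < δ) (h : ProdRange k m m k) (a : P.V (.nat m))
    (ha : a ≠ 0) : 0 < (P.tau k (P.prodMap h (P.dagMap h.le_left a) a)).re := by
  have hm : 1 ≤ m := h.pos.trans h.le_left
  obtain ⟨r, hr, e⟩ := P.positive m hm a ha
  rw [tau_apply, trace_dagMap_prodMap h hm, e, scalar_smul_unitElem, ← Complex.ofReal_pow,
    ← Complex.ofReal_inv, ← Complex.ofReal_mul, Complex.ofReal_re]
  positivity

end SubfactorPlanarAlgebra

/-! ### Growth estimates -/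

/-- If `g j ^ 2 ≤ β * g (j + 1)` and if `g j` grows at most like `N ^ (2 ^ j)`, then `g 0 ≤ β * N`:
iterating the first inequality gives `g j ≥ β * (g 0 / β) ^ (2 ^ j)`. -/
theorem le_mul_of_sq_le_mul_succ {g : ℕ → ℝ} {β N K : ℝ} (hβ : 0 < β) (hN : 0 ≤ N)
    (h : ∀ j, g j ^ 2 ≤ β * g (j + 1)) (hK : ∀ j, g j ≤ K * N ^ 2 ^ j) : g 0 ≤ β * N := by
  by_contra! hlt
  set r := g 0 / β with hr
  have hrN : N < r := by rw [hr, lt_div_iff₀ hβ]; linarith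
  have hr0 : 0 < r := hN.trans_lt hrN
  have low : ∀ j, β * r ^ 2 ^ j ≤ g j := by
    intro j
    induction j with
    | zero => rw [pow_zero, pow_one, hr, mul_div_cancel₀ _ hβ.ne']
    | succ j ih =>
      have h1 : (β * r ^ 2 ^ j) ^ 2 ≤ β * g (j + 1) :=
        (pow_le_pow_left₀ (by positivity) ih 2).trans (h j)
      rw [pow_succ 2 j, pow_mul]
      refine le_of_mul_le_mul_left ?_ hβ
      nlinarith
  rcases hN.eq_or_lt with rfl | hN
  · have h0 := (low 0).trans (hK 0)
    have : 0 < β * r ^ 2 ^ 0 := by positivity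
    simp at h0 this
    linarith
  · have h1 : 1 < r / N := (one_lt_div hN).2 hrN
    obtain ⟨j, hj⟩ := pow_unbounded_of_one_lt (K / β) h1
    have h2 : (r / N) ^ j ≤ (r / N) ^ 2 ^ j := pow_le_pow_right₀ h1.le Nat.lt_two_pow_self.le
    have h3 := (low j).trans (hK j)
    have h4 : K / β < (r / N) ^ 2 ^ j := hj.trans_le h2
    rw [div_pow, div_lt_div_iff₀ hβ (by positivity)] at h4
    linarith

/-- In a finite dimensional algebra, linear functionals grow at most geometrically along the
powers of an element, at a rate that does not depend on the functional. -/
theorem exists_growth_bound {A : Type u} [AddCommGroup A] [Module ℂ A] [FiniteDimensional ℂ A]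
    (mul : A →ₗ[ℂ] A →ₗ[ℂ] A) (x : ℕ → A) (hx : ∀ j, x (j + 1) = mul (x j) (x j)) :
    ∃ N : ℝ, 0 ≤ N ∧ ∀ φ : A →ₗ[ℂ] ℂ, ∃ K : ℝ, ∀ j, ‖φ (x j)‖ ≤ K * N ^ 2 ^ j := by
  let e := Module.finBasis ℂ A
  let ν : A → ℝ := fun a => ∑ i, ‖e.repr a i‖
  have ν0 : ∀ a, 0 ≤ ν a := fun a => Finset.sum_nonneg fun _ _ => norm_nonneg _
  have lin : ∀ φ : A →ₗ[ℂ] ℂ, ∀ a, ‖φ a‖ ≤ (∑ i, ‖φ (e i)‖) * ν a := by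
    intro φ a
    conv_lhs => rw [← e.sum_repr a, map_sum]
    refine (norm_sum_le _ _).trans ?_
    rw [Finset.mul_sum]
    refine Finset.sum_le_sum fun i _ => ?_
    rw [map_smul, smul_eq_mul, norm_mul, mul_comm]
    exact mul_le_mul_of_nonneg_right
      (Finset.single_le_sum (f := fun i => ‖φ (e i)‖) (fun _ _ => norm_nonneg _)
        (Finset.mem_univ i)) (norm_nonneg _)
  -- `M` bounds the multiplication, so `M * ν` is submultiplicative
  obtain ⟨M, hM, hmul⟩ : ∃ M : ℝ, 1 ≤ M ∧ ∀ a b, ν (mul a b) ≤ M * (ν a * ν b) := by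
    refine ⟨1 + ∑ l, ∑ i, ∑ j, ‖e.repr (mul (e j) (e i)) l‖, ?_, fun a b => ?_⟩
    · linarith [Finset.sum_nonneg fun l (_ : l ∈ Finset.univ) => Finset.sum_nonneg fun i
        (_ : i ∈ Finset.univ) => Finset.sum_nonneg fun j (_ : j ∈ Finset.univ) =>
        norm_nonneg (e.repr (mul (e j) (e i)) l)]
    · have key : ∀ l, ‖e.repr (mul a b) l‖ ≤
          (∑ i, ∑ j, ‖e.repr (mul (e j) (e i)) l‖) * (ν a * ν b) := by
        intro l
        have h1 := lin (e.coord l ∘ₗ mul a) b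
        refine h1.trans ?_
        rw [← mul_assoc]
        refine mul_le_mul_of_nonneg_right ?_ (ν0 b)
        rw [Finset.sum_mul]
        exact Finset.sum_le_sum fun i _ => lin (e.coord l ∘ₗ mul.flip (e i)) a
      calc ν (mul a b) ≤ ∑ l, (∑ i, ∑ j, ‖e.repr (mul (e j) (e i)) l‖) * (ν a * ν b) :=
            Finset.sum_le_sum fun l _ => key l
        _ = (∑ l, ∑ i, ∑ j, ‖e.repr (mul (e j) (e i)) l‖) * (ν a * ν b) :=
            (Finset.sum_mul _ _ _).symm
        _ ≤ _ := mul_le_mul_of_nonneg_right (by linarith) (mul_nonneg (ν0 a) (ν0 b))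
  have grow : ∀ j, M * ν (x j) ≤ (M * ν (x 0)) ^ 2 ^ j := by
    intro j
    induction j with
    | zero => simp
    | succ j ih =>
      rw [hx, pow_succ 2 j, pow_mul]
      have h1 : 0 ≤ M * ν (x j) := mul_nonneg (by linarith) (ν0 _)
      calc M * ν (mul (x j) (x j)) ≤ M * (M * (ν (x j) * ν (x j))) :=
            mul_le_mul_of_nonneg_left (hmul _ _) (by linarith)
        _ = (M * ν (x j)) ^ 2 := by ring
        _ ≤ _ := pow_le_pow_left₀ h1 ih 2
  refine ⟨M * ν (x 0), mul_nonneg (by linarith) (ν0 _), fun φ => ⟨∑ i, ‖φ (e i)‖, fun j => ?_⟩⟩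
  refine (lin φ (x j)).trans (mul_le_mul_of_nonneg_left ?_
    (Finset.sum_nonneg fun _ _ => norm_nonneg _))
  exact (le_mul_of_one_le_left (ν0 _) hM).trans (grow j)

/-! ### Tracial star algebras and conditional expectations -/

namespace TracialData

variable {A B : Type u} [AddCommGroup A] [Module ℂ A] [AddCommGroup B] [Module ℂ B]

/-- The operations form a unital `*`-algebra with a faithful positive hermitian trace: the
purely algebraic part of the definition of a finite pre-von Neumann algebra. -/
structure IsTracialStarAlgebra (D : TracialData A) : Prop where
  mul_assoc : ∀ a b c, D.mul (D.mul a b) c = D.mul a (D.mul b c)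
  one_mul : ∀ a, D.mul D.one a = a
  mul_one : ∀ a, D.mul a D.one = a
  dag_dag : ∀ a, D.dag (D.dag a) = a
  dag_mul : ∀ a b, D.dag (D.mul a b) = D.mul (D.dag b) (D.dag a)
  tr_comm : ∀ a b, D.tr (D.mul a b) = D.tr (D.mul b a)
  tr_dag : ∀ a, D.tr (D.dag a) = starRingEnd ℂ (D.tr a)
  inner_pos : ∀ a, a ≠ 0 → 0 < (D.tr (D.mul (D.dag a) a)).re

/-- The square of the norm of the inner product `⟨a, b⟩ = t (b* a)`. -/
def normSq (D : TracialData A) (a : A) : ℝ := (D.tr (D.mul (D.dag a) a)).re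

theorem normSq_smul (D : TracialData A) (r : ℝ) (a : A) :
    D.normSq ((r : ℂ) • a) = r ^ 2 * D.normSq a := by
  simp only [normSq, map_smul, map_smulₛₗ, LinearMap.smul_apply, Complex.conj_ofReal, smul_eq_mul,
    Complex.re_ofReal_mul]
  ring

namespace IsTracialStarAlgebra

variable {D : TracialData A}

theorem inner_symm (hD : D.IsTracialStarAlgebra) (a b : A) :
    D.tr (D.mul (D.dag b) a) = starRingEnd ℂ (D.tr (D.mul (D.dag a) b)) := by
  rw [← hD.tr_dag, hD.dag_mul, hD.dag_dag]

theorem normSq_nonneg (hD : D.IsTracialStarAlgebra) (a : A) : 0 ≤ D.normSq a := by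
  by_cases h : a = 0
  · simp [h, normSq]
  · exact (hD.inner_pos a h).le

theorem normSq_add (hD : D.IsTracialStarAlgebra) (a b : A) : D.normSq (a + b) =
    D.normSq a + 2 * (D.tr (D.mul (D.dag a) b)).re + D.normSq b := by
  have h := congrArg Complex.re (hD.inner_symm a b)
  rw [Complex.conj_re] at h
  simp only [normSq, map_add, LinearMap.add_apply, Complex.add_re] at h ⊢
  linarith

theorem cauchySchwarz (hD : D.IsTracialStarAlgebra) (a b : A) :
    (D.tr (D.mul (D.dag a) b)).re ^ 2 ≤ D.normSq a * D.normSq b := by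
  have h : ∀ r : ℝ, 0 ≤ D.normSq b * (r * r) + 2 * (D.tr (D.mul (D.dag a) b)).re * r +
      D.normSq a := by
    intro r
    have h1 := hD.normSq_nonneg (a + (r : ℂ) • b)
    rw [hD.normSq_add, D.normSq_smul, map_smul, map_smul, smul_eq_mul,
      Complex.re_ofReal_mul] at h1
    linarith
  have h2 := discrim_le_zero h
  rw [discrim] at h2
  linarith

theorem normSq_add_le (hD : D.IsTracialStarAlgebra) (a b : A) :
    D.normSq (a + b) ≤ 2 * D.normSq a + 2 * D.normSq b := by
  -- the parallelogram law, with `a - b` written as a sum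
  have h := hD.normSq_nonneg (a + ((-1 : ℝ) : ℂ) • b)
  rw [hD.normSq_add, D.normSq_smul, map_smul, map_smul, smul_eq_mul, Complex.re_ofReal_mul] at h
  rw [hD.normSq_add]
  linarith

theorem normSq_sum_le (hD : D.IsTracialStarAlgebra) {ι : Type*} (s : Finset ι) (f : ι → A) :
    D.normSq (∑ i ∈ s, f i) ≤ 2 ^ s.card * ∑ i ∈ s, D.normSq (f i) := by
  classical
  induction s using Finset.induction_on with
  | empty => simp [normSq]
  | insert i s hi ih =>
    rw [Finset.sum_insert hi, Finset.sum_insert hi, Finset.card_insert_of_notMem hi, pow_succ]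
    have h1 : (1 : ℝ) ≤ 2 ^ s.card := one_le_pow₀ (by norm_num)
    have h2 := hD.normSq_add_le (f i) (∑ i ∈ s, f i)
    have h3 : D.normSq (f i) ≤ 2 ^ s.card * D.normSq (f i) :=
      le_mul_of_one_le_left (hD.normSq_nonneg _) h1
    linarith

end IsTracialStarAlgebra

section Expectation

variable {D : TracialData A} {D' : TracialData B} {i : A →ₗ[ℂ] B}

/-- An orthogonal projection onto a subalgebra is a trace-preserving conditional expectation. -/
theorem isBimoduleRetraction (hD : D.IsTracialStarAlgebra) (hD' : D'.IsTracialStarAlgebra)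
    (map_mul : ∀ a b, i (D.mul a b) = D'.mul (i a) (i b)) (map_one : i D.one = D'.one)
    (map_dag : ∀ a, i (D.dag a) = D'.dag (i a)) (map_tr : ∀ a, D'.tr (i a) = D.tr a)
    {E : B →ₗ[ℂ] A} (hE : ∀ y b, D'.tr (D'.mul (i y) (i (E b))) = D'.tr (D'.mul (i y) b)) :
    IsBimoduleRetraction D D' i E := by
  -- elements of the subalgebra are determined by their products under the trace
  have cancel : ∀ a a', (∀ y, D'.tr (D'.mul (i y) (i a)) = D'.tr (D'.mul (i y) (i a'))) →
      a = a' := by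
    intro a a' h
    by_contra hne
    refine (hD.inner_pos (a - a') (sub_ne_zero.2 hne)).ne' ?_
    rw [← map_tr, map_mul, map_sub i, map_sub, map_sub, h, sub_self, Complex.zero_re]
  refine ⟨fun a => ?_, fun a b => ?_, fun b a => ?_, fun b => ?_, fun b => ?_⟩
  · exact cancel _ _ fun y => hE y _
  · refine cancel _ _ fun y => ?_
    rw [hE, map_mul, ← hD'.mul_assoc, ← hD'.mul_assoc, ← map_mul, hE]
  · refine cancel _ _ fun y => ?_
    rw [hE, map_mul, ← hD'.mul_assoc, ← hD'.mul_assoc, hD'.tr_comm, hD'.tr_comm _ (i a),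
      ← hD'.mul_assoc, ← hD'.mul_assoc, ← map_mul, hE]
  · refine cancel _ _ fun y => ?_
    have e : ∀ z, D'.tr (D'.mul (i y) (D'.dag z)) =
        starRingEnd ℂ (D'.tr (D'.mul (i (D.dag y)) z)) := by
      intro z
      rw [← hD'.tr_dag, hD'.dag_mul, map_dag, hD'.dag_dag, hD'.tr_comm]
    rw [hE, map_dag, e, e, hE]
  · have h := hE D.one b
    rwa [map_one, hD'.one_mul, hD'.one_mul, map_tr] at h

/-- The orthogonal projection onto a finite dimensional subalgebra exists. -/
theorem exists_projection [FiniteDimensional ℂ A] (hD : D.IsTracialStarAlgebra)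
    (map_mul : ∀ a b, i (D.mul a b) = D'.mul (i a) (i b)) (map_tr : ∀ a, D'.tr (i a) = D.tr a) :
    ∃ E : B →ₗ[ℂ] A, ∀ y b, D'.tr (D'.mul (i y) (i (E b))) = D'.tr (D'.mul (i y) b) := by
  -- the restriction of the trace form to the subalgebra is nondegenerate
  let Φ : B →ₗ[ℂ] Module.Dual ℂ A := (D'.mul.compr₂ D'.tr ∘ₗ i).flip
  have hinj : Function.Injective (Φ ∘ₗ i) := by
    rw [← LinearMap.ker_eq_bot, LinearMap.ker_eq_bot']
    intro a ha
    by_contra hne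
    refine (hD.inner_pos a hne).ne' ?_
    rw [← map_tr, map_mul]
    exact congrArg Complex.re (LinearMap.congr_fun ha (D.dag a))
  have hdim : Module.finrank ℂ A = Module.finrank ℂ (Module.Dual ℂ A) :=
    Subspace.dual_finrank_eq.symm
  let e : A ≃ₗ[ℂ] Module.Dual ℂ A := LinearEquiv.ofInjectiveOfFinrankEq (Φ ∘ₗ i) hinj hdim
  refine ⟨e.symm.toLinearMap ∘ₗ Φ, fun y b => ?_⟩
  exact LinearMap.congr_fun (e.apply_symm_apply (Φ b)) y

end Expectation

end TracialData

/-! ### The algebra of a planar algebra -/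

namespace SubfactorPlanarAlgebra

open Tangle StarPlanarAlgebra

variable {δ : ℝ} (P : SubfactorPlanarAlgebra.{u} δ)

/-- The algebra `P_n` with its normalised trace. -/
def algV (n : ℕ) (hn : 1 ≤ n) : TracialData (P.V (.nat n)) where
  mul := P.mulMap n hn
  one := P.unitElem (.nat n)
  dag := P.conj (.nat n)
  tr := P.tau n

theorem algV_isTracialStarAlgebra (hδ : 0 < δ) (n : ℕ) (hn : 1 ≤ n) :
    (P.algV n hn).IsTracialStarAlgebra := by
  have h : ProdRange n n n n := ⟨hn, le_rfl, le_rfl, le_rfl, le_rfl, le_rfl⟩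
  have hself : ∀ x : P.V (.nat n), P.dagMap (le_refl n) x = P.conj _ x := dagMap_self hn
  refine ⟨P.prodMap_assoc h h h h (by omega), P.prodMap_unitElem_left h, prodMap_unitElem_right h,
    P.conj_conj _, fun a b => ?_, tau_prodMap_comm h, tau_conj, fun a ha => ?_⟩
  · have e := dagMap_prodMap h a b
    rwa [hself, hself, hself] at e
  · have e := tau_dagMap_prodMap_pos hδ h a ha
    rwa [hself] at e

variable (k : ℕ)

/-- The component in `P_t` of the product of elements of `P_m` and `P_n`, for all `t`. -/
def component (m n t : ℕ) : P.V (.nat m) →ₗ[ℂ] P.V (.nat n) →ₗ[ℂ] P.V (.nat t) :=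
  open Classical in if h : ProdRange k m n t then P.prodMap h else 0

variable {P k}

theorem component_of {m n t : ℕ} (h : ProdRange k m n t) : P.component k m n t = P.prodMap h :=
  dif_pos h

theorem component_of_not {m n t : ℕ} (h : ¬ ProdRange k m n t) : P.component k m n t = 0 :=
  dif_neg h

/-- The product of three components through `P_s` is their product through `P_s'`. -/
theorem component_assoc {l m n t s s' : ℕ} (hs : s + s' = max (m + t) (l + n))
    (h : ProdRange k l m s ∧ ProdRange k s n t) (a : P.V (.nat l)) (b : P.V (.nat m))
    (c : P.V (.nat n)) : P.component k s n t (P.component k l m s a b) c =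
      P.component k l s' t a (P.component k m n s' b c) := by
  obtain ⟨⟨p1, p2, p3, p4, p5, p6⟩, ⟨q1, q2, q3, q4, q5, q6⟩⟩ := h
  have h3 : ProdRange k m n s' := ⟨p1, p3, q3, by omega, by omega, by omega⟩
  have h4 : ProdRange k l s' t := ⟨p1, p2, by omega, by omega, by omega, by omega⟩
  rw [component_of ⟨p1, p2, p3, p4, p5, p6⟩, component_of ⟨q1, q2, q3, q4, q5, q6⟩,
    component_of h3, component_of h4]
  exact P.prodMap_assoc _ _ h3 h4 hs a b c

variable (P k) in
/-- The inclusion of the component `P_n`. -/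
abbrev ofF (n : {n : ℕ // k ≤ n}) : P.V (.nat n.1) →ₗ[ℂ] P.F k :=
  DirectSum.lof ℂ {n : ℕ // k ≤ n} (fun n => P.V (.nat n.1)) n

theorem ofF_same (n : {n : ℕ // k ≤ n}) (b : P.V (.nat n.1)) : P.ofF k n b n = b :=
  DirectSum.lof_apply (M := fun n : {n : ℕ // k ≤ n} => P.V (.nat n.1)) ℂ n b

theorem ofF_ne {n t : {n : ℕ // k ≤ n}} (h : n ≠ t) (b : P.V (.nat n.1)) : P.ofF k n b t = 0 :=
  DirectSum.of_eq_of_ne _ _ _ h.symm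

theorem F_induction {p : P.F k → Prop} (x : P.F k) (zero : p 0)
    (of : ∀ n b, p (P.ofF k n b)) (add : ∀ x y, p x → p y → p (x + y)) : p x :=
  DirectSum.induction_on x zero of add

theorem sum_ofF {x : P.F k} {s : Finset {n : ℕ // k ≤ n}} (hs : ∀ n, n ∉ s → x n = 0) :
    x = ∑ n ∈ s, P.ofF k n (x n) := by
  classical
  refine DFinsupp.ext fun n => ?_
  rw [DFinsupp.finsetSum_apply]
  by_cases hn : n ∈ s
  · rw [Finset.sum_eq_single n]
    · exact (ofF_same n _).symm
    · exact fun t _ ht => ofF_ne ht _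
    · exact fun h => absurd hn h
  · rw [hs n hn]
    refine (Finset.sum_eq_zero fun t ht => ofF_ne ?_ _).symm
    rintro rfl
    exact hn ht

variable {hk : 1 ≤ k}

theorem mulComponents_eq (m n : {n : ℕ // k ≤ n}) (a : P.V (.nat m.1)) (b : P.V (.nat n.1)) :
    P.mulComponents k hk m n a b =
      ∑ t ∈ (Finset.Icc ((m.1 - n.1) + (n.1 - m.1) + k) (m.1 + n.1 - k)).attach,
        P.ofF k ⟨t.1, le_trans (Nat.le_add_left _ _) (Finset.mem_Icc.1 t.2).1⟩
          (P.component k m.1 n.1 t.1 a b) := by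
  rw [mulComponents, LinearMap.sum_apply, LinearMap.sum_apply]
  refine Finset.sum_congr rfl fun t _ => ?_
  rw [component_of (prodRange hk m.2 n.2 t.2)]
  rfl

theorem mem_Icc_of_prodRange {m n t : ℕ} (h : ProdRange k m n t) :
    t ∈ Finset.Icc ((m - n) + (n - m) + k) (m + n - k) := by
  obtain ⟨h1, h2, h3, h4, h5, h6⟩ := h
  rw [Finset.mem_Icc]
  omega

theorem mulF_ofF (m n : {n : ℕ // k ≤ n}) (a : P.V (.nat m.1)) (b : P.V (.nat n.1)) :
    P.mulF k hk (P.ofF k m a) (P.ofF k n b) = P.mulComponents k hk m n a b := by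
  rw [mulF, ofF, ofF, DirectSum.toModule_lof, LinearMap.flip_apply, DirectSum.toModule_lof,
    LinearMap.flip_apply]

theorem mulF_ofF_apply (m n t : {n : ℕ // k ≤ n}) (a : P.V (.nat m.1)) (b : P.V (.nat n.1)) :
    P.mulF k hk (P.ofF k m a) (P.ofF k n b) t = P.component k m.1 n.1 t.1 a b := by
  rw [mulF_ofF, mulComponents_eq, DFinsupp.finsetSum_apply]
  by_cases h : t.1 ∈ Finset.Icc ((m.1 - n.1) + (n.1 - m.1) + k) (m.1 + n.1 - k)
  · rw [Finset.sum_eq_single ⟨t.1, h⟩]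
    · exact ofF_same t _
    · intro s _ hs
      exact ofF_ne (fun e => hs (Subtype.ext (congrArg (fun z : {n : ℕ // k ≤ n} => z.1) e))) _
    · exact fun h' => absurd (Finset.mem_attach _ _) h'
  · rw [component_of_not fun h' => h (mem_Icc_of_prodRange h'), LinearMap.zero_apply,
      LinearMap.zero_apply]
    refine Finset.sum_eq_zero fun s _ => ofF_ne (fun e => h ?_) _
    rw [← congrArg (fun z : {n : ℕ // k ≤ n} => z.1) e]
    exact s.2

theorem mulF_assoc_ofF (l m n : {n : ℕ // k ≤ n}) (a : P.V (.nat l.1)) (b : P.V (.nat m.1))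
    (c : P.V (.nat n.1)) :
    P.mulF k hk (P.mulF k hk (P.ofF k l a) (P.ofF k m b)) (P.ofF k n c) =
      P.mulF k hk (P.ofF k l a) (P.mulF k hk (P.ofF k m b) (P.ofF k n c)) := by
  classical
  refine DFinsupp.ext fun t => ?_
  have e1 : P.mulF k hk (P.mulF k hk (P.ofF k l a) (P.ofF k m b)) (P.ofF k n c) t =
      ∑ s ∈ Finset.Icc ((l.1 - m.1) + (m.1 - l.1) + k) (l.1 + m.1 - k),
        P.component k s n.1 t.1 (P.component k l.1 m.1 s a b) c := by
    rw [mulF_ofF, mulComponents_eq, map_sum, LinearMap.sum_apply, DFinsupp.finsetSum_apply]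
    refine Eq.trans ?_ (Finset.sum_attach _ _)
    exact Finset.sum_congr rfl fun s _ => mulF_ofF_apply _ _ _ _ _
  have e2 : P.mulF k hk (P.ofF k l a) (P.mulF k hk (P.ofF k m b) (P.ofF k n c)) t =
      ∑ s ∈ Finset.Icc ((m.1 - n.1) + (n.1 - m.1) + k) (m.1 + n.1 - k),
        P.component k l.1 s t.1 a (P.component k m.1 n.1 s b c) := by
    rw [mulF_ofF, mulComponents_eq, map_sum, DFinsupp.finsetSum_apply]
    refine Eq.trans ?_ (Finset.sum_attach _ _)
    exact Finset.sum_congr rfl fun s _ => mulF_ofF_apply _ _ _ _ _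
  rw [e1, e2]
  have f1 : ∀ s, P.component k s n.1 t.1 (P.component k l.1 m.1 s a b) c ≠ 0 →
      ProdRange k l.1 m.1 s ∧ ProdRange k s n.1 t.1 := by
    intro s hs
    by_contra h
    rw [not_and_or] at h
    rcases h with h | h
    · exact hs (by rw [component_of_not h, LinearMap.zero_apply, LinearMap.zero_apply, map_zero,
        LinearMap.zero_apply])
    · exact hs (by rw [component_of_not h, LinearMap.zero_apply, LinearMap.zero_apply])
  have f2 : ∀ s, P.component k l.1 s t.1 a (P.component k m.1 n.1 s b c) ≠ 0 →
      ProdRange k m.1 n.1 s ∧ ProdRange k l.1 s t.1 := by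
    intro s hs
    by_contra h
    rw [not_and_or] at h
    rcases h with h | h
    · exact hs (by rw [component_of_not h, LinearMap.zero_apply, LinearMap.zero_apply, map_zero])
    · exact hs (by rw [component_of_not h, LinearMap.zero_apply, LinearMap.zero_apply])
  -- the terms of the two sums correspond to each other under `s ↦ max (m + t) (l + n) - s`
  refine Finset.sum_bij_ne_zero (fun s _ _ => max (m.1 + t.1) (l.1 + n.1) - s) ?_ ?_ ?_ ?_
  · intro s _ hs
    obtain ⟨⟨p1, p2, p3, p4, p5, p6⟩, ⟨q1, q2, q3, q4, q5, q6⟩⟩ := f1 s hs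
    rw [Finset.mem_Icc]
    omega
  · intro s _ hs s' _ hs' e
    obtain ⟨⟨p1, p2, p3, p4, p5, p6⟩, ⟨q1, q2, q3, q4, q5, q6⟩⟩ := f1 s hs
    obtain ⟨⟨p1', p2', p3', p4', p5', p6'⟩, ⟨q1', q2', q3', q4', q5', q6'⟩⟩ := f1 s' hs'
    omega
  · intro s _ hs
    obtain ⟨⟨p1, p2, p3, p4, p5, p6⟩, ⟨q1, q2, q3, q4, q5, q6⟩⟩ := f2 s hs
    have h1 : ProdRange k l.1 m.1 (max (m.1 + t.1) (l.1 + n.1) - s) :=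
      ⟨p1, q2, p2, by omega, by omega, by omega⟩
    have h2 : ProdRange k (max (m.1 + t.1) (l.1 + n.1) - s) n.1 t.1 :=
      ⟨p1, by omega, p3, by omega, by omega, by omega⟩
    refine ⟨_, mem_Icc_of_prodRange h1, ?_, by omega⟩
    rw [component_assoc (s' := s) (by omega) ⟨h1, h2⟩]
    exact hs
  · intro s _ hs
    have h := f1 s hs
    obtain ⟨⟨p1, p2, p3, p4, p5, p6⟩, ⟨q1, q2, q3, q4, q5, q6⟩⟩ := id h
    exact component_assoc (by omega) h a b c

theorem dagF_apply (x : P.F k) (n : {n : ℕ // k ≤ n}) : P.dagF k x n = P.dagMap n.2 (x n) := rfl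

theorem dagF_ofF (n : {n : ℕ // k ≤ n}) (b : P.V (.nat n.1)) :
    P.dagF k (P.ofF k n b) = P.ofF k n (P.dagMap n.2 b) := by
  refine DFinsupp.ext fun t => ?_
  rw [dagF_apply]
  by_cases h : n = t
  · subst h
    rw [ofF_same, ofF_same]
  · rw [ofF_ne h, ofF_ne h, map_zero]

theorem tr_algF (x : P.F k) : (P.algF k hk).tr x = P.tau k (x ⟨k, le_rfl⟩) := rfl

theorem eq_of_prodRange {m n : ℕ} (h : ProdRange k m n k) : m = n := by
  obtain ⟨h1, h2, h3, h4, h5, h6⟩ := h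
  omega

theorem prodRange_self {n : ℕ} (hk : 1 ≤ k) (hn : k ≤ n) : ProdRange k n n k :=
  ⟨hk, hn, hn, by omega, by omega, by omega⟩

/-- The form `t_k(x # y)` is the sum of its restrictions to the components. -/
theorem tr_mulF {x y : P.F k} {s : Finset {n : ℕ // k ≤ n}} (hs : ∀ n, n ∉ s → y n = 0) :
    (P.algF k hk).tr (P.mulF k hk x y) =
      ∑ n ∈ s, P.tau k (P.prodMap (prodRange_self hk n.2) (x n) (y n)) := by
  have key : ∀ n (b : P.V (.nat n.1)), (P.algF k hk).tr (P.mulF k hk x (P.ofF k n b)) =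
      P.tau k (P.prodMap (prodRange_self hk n.2) (x n) b) := by
    intro n b
    induction x using F_induction with
    | zero => rw [map_zero, LinearMap.zero_apply, map_zero, DirectSum.zero_apply, map_zero,
        LinearMap.zero_apply, map_zero]
    | of m a =>
      rw [tr_algF, mulF_ofF_apply]
      by_cases h : m = n
      · subst h
        rw [component_of (prodRange_self hk m.2), ofF_same]
      · rw [component_of_not fun h' => h (Subtype.ext (eq_of_prodRange h')), ofF_ne h]
        simp only [LinearMap.zero_apply, map_zero]
    | add x y hx hy =>
      simp only [map_add, LinearMap.add_apply, DirectSum.add_apply, hx, hy]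
  conv_lhs => rw [sum_ofF hs, map_sum, map_sum]
  exact Finset.sum_congr rfl fun n _ => key n _

end SubfactorPlanarAlgebra

namespace SubfactorPlanarAlgebra

open Tangle StarPlanarAlgebra

variable {δ : ℝ} {P : SubfactorPlanarAlgebra.{u} δ} {k : ℕ} {hk : 1 ≤ k}

theorem exists_support (x : P.F k) : ∃ s : Finset {n : ℕ // k ≤ n}, ∀ n, n ∉ s → x n = 0 := by
  classical
  exact ⟨DFinsupp.support x, fun n hn => DFinsupp.notMem_support_iff.1 hn⟩

theorem mulF_assoc (a b c : P.F k) :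
    P.mulF k hk (P.mulF k hk a b) c = P.mulF k hk a (P.mulF k hk b c) := by
  induction a using F_induction with
  | zero => simp only [map_zero, LinearMap.zero_apply]
  | add x y hx hy => simp only [map_add, LinearMap.add_apply, hx, hy]
  | of l a =>
    induction b using F_induction with
    | zero => simp only [map_zero, LinearMap.zero_apply]
    | add x y hx hy => simp only [map_add, LinearMap.add_apply, hx, hy]
    | of m b =>
      induction c using F_induction with
      | zero => simp only [map_zero]
      | add x y hx hy => simp only [map_add, hx, hy]
      | of n c => exact mulF_assoc_ofF l m n a b c

/-- The unit of `P_k` is a left unit: its product with `b ∈ P_n` has a component in `P_n` only. -/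
theorem one_mulF (b : P.F k) :
    P.mulF k hk (P.ofF k ⟨k, le_rfl⟩ (P.unitElem (.nat k))) b = b := by
  induction b using F_induction with
  | zero => rw [map_zero]
  | add x y hx hy => rw [map_add, hx, hy]
  | of n b =>
    refine DFinsupp.ext fun t => ?_
    rw [mulF_ofF_apply]
    by_cases h : n = t
    · subst h
      have h' : ProdRange k k n.1 n.1 := ⟨hk, le_rfl, n.2, by omega, by omega, by omega⟩
      rw [component_of h', P.prodMap_unitElem_left, ofF_same]
    · rw [ofF_ne h, component_of_not, LinearMap.zero_apply, LinearMap.zero_apply]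
      rintro ⟨h1, h2, h3, h4, h5, h6⟩
      exact h (Subtype.ext (by dsimp only at *; omega))

theorem dagF_dagF (hk : 1 ≤ k) (x : P.F k) : P.dagF k (P.dagF k x) = x :=
  DFinsupp.ext fun n => dagMap_dagMap n.2 (lt_of_lt_of_le hk n.2) (x n)

theorem dagF_mulF (a b : P.F k) :
    P.dagF k (P.mulF k hk a b) = P.mulF k hk (P.dagF k b) (P.dagF k a) := by
  induction a using F_induction with
  | zero => simp only [map_zero, LinearMap.zero_apply]
  | add x y hx hy => simp only [map_add, LinearMap.add_apply, hx, hy]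
  | of m a =>
    induction b using F_induction with
    | zero => simp only [map_zero, LinearMap.zero_apply]
    | add x y hx hy => simp only [map_add, LinearMap.add_apply, hx, hy]
    | of n b =>
      refine DFinsupp.ext fun t => ?_
      rw [dagF_ofF, dagF_ofF, mulF_ofF_apply, dagF_apply, mulF_ofF_apply]
      by_cases h : ProdRange k m.1 n.1 t.1
      · rw [component_of h, component_of h.symm]
        exact dagMap_prodMap h a b
      · rw [component_of_not h, component_of_not fun h' => h h'.symm]
        simp only [LinearMap.zero_apply, map_zero]

theorem mulF_one (b : P.F k) :
    P.mulF k hk b (P.ofF k ⟨k, le_rfl⟩ (P.unitElem (.nat k))) = b := by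
  have hself : P.dagF k (P.ofF k ⟨k, le_rfl⟩ (P.unitElem (.nat k))) =
      P.ofF k ⟨k, le_rfl⟩ (P.unitElem (.nat k)) := by
    rw [dagF_ofF]
    exact congrArg _ ((dagMap_self hk _).trans (conj_unitElem _))
  rw [← dagF_dagF hk (P.mulF k hk b _), dagF_mulF, hself, one_mulF, dagF_dagF hk]

theorem algF_isTracialStarAlgebra (hδ : 0 < δ) : (P.algF k hk).IsTracialStarAlgebra where
  mul_assoc := mulF_assoc
  one_mul := one_mulF
  mul_one := mulF_one
  dag_dag := dagF_dagF hk
  dag_mul := dagF_mulF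
  tr_comm a b := by
    classical
    obtain ⟨s, hs⟩ := exists_support a
    obtain ⟨s', hs'⟩ := exists_support b
    refine (tr_mulF (s := s ∪ s') fun n hn => hs' n ?_).trans (Eq.trans ?_
      (tr_mulF (s := s ∪ s') fun n hn => hs n ?_).symm)
    · exact fun h => hn (Finset.mem_union_right _ h)
    · exact Finset.sum_congr rfl fun n _ => tau_prodMap_comm _ _ _
    · exact fun h => hn (Finset.mem_union_left _ h)
  tr_dag a := (congrArg (P.tau k) (dagMap_self hk (a ⟨k, le_rfl⟩))).trans (tau_conj _)
  inner_pos a ha := by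
    obtain ⟨s, hs⟩ := exists_support a
    have e : (P.algF k hk).tr (P.mulF k hk (P.dagF k a) a) = _ := tr_mulF hs
    change 0 < ((P.algF k hk).tr (P.mulF k hk (P.dagF k a) a)).re
    rw [e, Complex.re_sum]
    have pos : ∀ n, a n ≠ 0 → 0 <
        (P.tau k (P.prodMap (prodRange_self hk n.2) (P.dagF k a n) (a n))).re :=
      fun n hn => tau_dagMap_prodMap_pos hδ (prodRange_self hk n.2) _ hn
    refine Finset.sum_pos' (fun n _ => ?_) ?_
    · by_cases hn : a n = 0
      · rw [hn, map_zero, map_zero, Complex.zero_re]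
      · exact (pos n hn).le
    · by_contra! h
      refine ha (DFinsupp.ext fun n => ?_)
      by_cases hn : n ∈ s
      · by_contra hne
        exact absurd (pos n hne) (h n hn).not_gt
      · exact hs n hn

/-! ### Boundedness of left multiplications -/

theorem normSq_eq_sum {x : P.F k} {s : Finset {n : ℕ // k ≤ n}} (hs : ∀ n, n ∉ s → x n = 0) :
    (P.algF k hk).normSq x = ∑ n ∈ s, (P.tau k (P.prodMap (prodRange_self hk n.2)
      (P.dagMap n.2 (x n)) (x n))).re := by
  have e : (P.algF k hk).tr (P.mulF k hk (P.dagF k x) x) = _ := tr_mulF hs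
  change ((P.algF k hk).tr (P.mulF k hk (P.dagF k x) x)).re = _
  rw [e, Complex.re_sum]
  rfl

theorem tr_dagF_ofF (n : {n : ℕ // k ≤ n}) (x y : P.V (.nat n.1)) :
    (P.algF k hk).tr (P.mulF k hk (P.dagF k (P.ofF k n x)) (P.ofF k n y)) =
      P.tau k (P.prodMap (prodRange_self hk n.2) (P.dagMap n.2 x) y) := by
  rw [tr_mulF (s := {n}) fun t ht => ofF_ne (fun h => ht (Finset.mem_singleton.2 h.symm)) _,
    Finset.sum_singleton, dagF_ofF, ofF_same, ofF_same]

theorem normSq_ofF (n : {n : ℕ // k ≤ n}) (x : P.V (.nat n.1)) :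
    (P.algF k hk).normSq (P.ofF k n x) =
      (P.tau k (P.prodMap (prodRange_self hk n.2) (P.dagMap n.2 x) x)).re :=
  congrArg Complex.re (tr_dagF_ofF n x x)

/-- The square of the norm of a component of a product `a # b` is the matrix coefficient at `b`
of the left multiplication by an element of the finite dimensional space `P_s` that depends only
on `a`. -/
theorem tau_prodMap_self {m n t s : ℕ} (h : ProdRange k m n t) (hs : ProdRange k m m s)
    (h' : ProdRange k s n n) (hst : s + t = m + n) (a : P.V (.nat m)) (b : P.V (.nat n)) :
    P.tau k (P.prodMap (prodRange_self h.pos h.le_out) (P.dagMap h.le_out (P.prodMap h a b))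
      (P.prodMap h a b)) =
    P.tau k (P.prodMap (prodRange_self h.pos h.le_right) (P.dagMap h.le_right b)
      (P.prodMap h' (P.prodMap hs (P.dagMap h.le_left a) a) b)) := by
  obtain ⟨h1, h2, h3, h4, h5, h6⟩ := id h
  have h7 := h.le_out
  have g : ProdRange k m t n := ⟨h1, h2, h7, by omega, by omega, by omega⟩
  rw [dagMap_prodMap, P.prodMap_assoc h.symm (prodRange_self h1 h7) g (prodRange_self h1 h3)
    (by omega), P.prodMap_assoc hs h' h g (by omega)]

/-- The left multiplication by a self-adjoint element `X` of `(P_s, #_s)` on `P_n` is bounded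
uniformly in `n`: by the Cauchy–Schwarz inequality, iterated along the powers `X ^ (2 ^ j)`, its
bound is the growth rate of these powers in the finite dimensional space `P_s`. -/
theorem exists_bound_of_dagMap_eq (hδ : 0 < δ) {s : ℕ} (hs : ProdRange k s s s)
    (X : P.V (.nat s)) (hX : P.dagMap hs.le_left X = X) :
    ∃ C : ℝ, 0 ≤ C ∧ ∀ (n : {n : ℕ // k ≤ n}) (h : ProdRange k s n.1 n.1) (b : P.V (.nat n.1)),
      (P.tau k (P.prodMap (prodRange_self hk n.2) (P.dagMap n.2 b) (P.prodMap h X b))).re ≤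
        C * (P.algF k hk).normSq (P.ofF k n b) := by
  have hD := algF_isTracialStarAlgebra (P := P) (hk := hk) hδ
  have := P.finiteDimensional (.nat s)
  let x : ℕ → P.V (.nat s) := fun j => Nat.rec X (fun _ y => P.prodMap hs y y) j
  obtain ⟨N, hN, hgrow⟩ := exists_growth_bound (P.prodMap hs) x fun _ => rfl
  have hself : ∀ j, P.dagMap hs.le_left (x j) = x j := by
    intro j
    induction j with
    | zero => exact hX
    | succ j ih => exact (dagMap_prodMap hs _ _).trans (by rw [ih])
  refine ⟨N, hN, fun n h b => ?_⟩
  by_cases hb : b = 0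
  · rw [hb]
    simp [TracialData.normSq]
  have hβ : 0 < (P.algF k hk).normSq (P.ofF k n b) := by
    rw [normSq_ofF]
    exact tau_dagMap_prodMap_pos hδ (prodRange_self hk n.2) b hb
  let φ : P.V (.nat s) →ₗ[ℂ] ℂ := P.tau k ∘ₗ
    P.prodMap (prodRange_self hk n.2) (P.dagMap n.2 b) ∘ₗ (P.prodMap h).flip b
  obtain ⟨K, hK⟩ := hgrow φ
  rw [mul_comm]
  refine le_mul_of_sq_le_mul_succ (g := fun j => (φ (x j)).re) hβ hN (fun j => ?_)
    (fun j => (Complex.re_le_norm _).trans (hK j))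
  have h1 := hD.cauchySchwarz (P.ofF k n b) (P.ofF k n (P.prodMap h (x j) b))
  have h2 := congrArg Complex.re (tau_prodMap_self h hs h rfl (x j) b)
  rw [hself] at h2
  rw [normSq_ofF n (P.prodMap h (x j) b)] at h1
  refine (Eq.trans_le ?_ h1).trans_eq (congrArg _ h2)
  exact congrArg (fun z : ℂ => z.re ^ 2) (tr_dagF_ofF (hk := hk) n b _).symm

/-- A bound for the components of `a # b` with `b ∈ P_n` that is uniform in `n`: the component in
`P_t` is governed by an element of `P_s`, `s = m + n - t`, and only finitely many `s` occur. -/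
theorem exists_bound_component (hδ : 0 < δ) (m : {n : ℕ // k ≤ n}) (a : P.V (.nat m.1)) :
    ∃ C : ℝ, 0 ≤ C ∧ ∀ (n t : {n : ℕ // k ≤ n}) (b : P.V (.nat n.1)),
      (P.algF k hk).normSq (P.ofF k t (P.component k m.1 n.1 t.1 a b)) ≤
        C * (P.algF k hk).normSq (P.ofF k n b) := by
  have hD := algF_isTracialStarAlgebra (P := P) (hk := hk) hδ
  have hs : ∀ s : ℕ, ∃ C : ℝ, 0 ≤ C ∧ ∀ (n t : {n : ℕ // k ≤ n}) (b : P.V (.nat n.1)),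
      s + t.1 = m.1 + n.1 → ProdRange k m.1 n.1 t.1 →
      (P.algF k hk).normSq (P.ofF k t (P.component k m.1 n.1 t.1 a b)) ≤
        C * (P.algF k hk).normSq (P.ofF k n b) := by
    intro s
    by_cases hs : k ≤ s ∧ s + k ≤ 2 * m.1
    · have h1 : ProdRange k m.1 m.1 s := ⟨hk, m.2, m.2, by omega, by omega, by omega⟩
      have h2 : ProdRange k s s s := ⟨hk, hs.1, hs.1, by omega, by omega, by omega⟩
      obtain ⟨C, hC, h⟩ := exists_bound_of_dagMap_eq (hk := hk) hδ h2
        (P.prodMap h1 (P.dagMap m.2 a) a) (by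
          refine (dagMap_prodMap h1 _ _).trans ?_
          rw [dagMap_dagMap _ (lt_of_lt_of_le hk m.2)])
      refine ⟨C, hC, fun n t b hst hr => ?_⟩
      obtain ⟨q1, q2, q3, q4, q5, q6⟩ := id hr
      have h3 : ProdRange k s n.1 n.1 := ⟨hk, hs.1, n.2, by omega, by omega, by omega⟩
      rw [normSq_ofF, component_of hr]
      exact (congrArg Complex.re (tau_prodMap_self hr h1 h3 hst a b)).trans_le (h n h3 b)
    · refine ⟨0, le_rfl, fun n t b hst hr => absurd ?_ hs⟩
      obtain ⟨q1, q2, q3, q4, q5, q6⟩ := hr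
      omega
  choose C hC hC' using hs
  refine ⟨∑ s ∈ Finset.range (2 * m.1), C s, Finset.sum_nonneg fun s _ => hC s, fun n t b => ?_⟩
  by_cases hr : ProdRange k m.1 n.1 t.1
  · obtain ⟨q1, q2, q3, q4, q5, q6⟩ := id hr
    refine (hC' (m.1 + n.1 - t.1) n t b (by omega) hr).trans (mul_le_mul_of_nonneg_right ?_
      (hD.normSq_nonneg _))
    exact Finset.single_le_sum (f := C) (fun s _ => hC s) (Finset.mem_range.2 (by omega))
  · rw [component_of_not hr, LinearMap.zero_apply, LinearMap.zero_apply, map_zero]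
    refine le_trans (le_of_eq ?_)
      (mul_nonneg (Finset.sum_nonneg fun s _ => hC s) (hD.normSq_nonneg _))
    simp [TracialData.normSq]

theorem card_near_le (m n : ℕ) (s : Finset {n : ℕ // k ≤ n}) :
    (s.filter fun t => n ≤ t.1 + m ∧ t.1 ≤ n + m).card ≤ 2 * m + 1 := by
  refine (Finset.card_le_card_of_injOn (t := Finset.Icc (n - m) (n + m)) Subtype.val ?_
    Subtype.val_injective.injOn).trans ?_
  · intro t ht
    have := (Finset.mem_filter.1 ht).2
    rw [Finset.coe_Icc, Set.mem_Icc]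
    omega
  · rw [Nat.card_Icc]
    omega

/-- Left multiplication by an element of `P_m` maps `P_n` to the sum of the spaces `P_t` with
`|t - n| ≤ m`: therefore the bound on components gives a bound on the whole of `F_k(P)`. -/
theorem exists_bound_ofF (hδ : 0 < δ) (m : {n : ℕ // k ≤ n}) (a : P.V (.nat m.1)) :
    ∃ C : ℝ, 0 ≤ C ∧ ∀ b, (P.algF k hk).normSq (P.mulF k hk (P.ofF k m a) b) ≤
      C * (P.algF k hk).normSq b := by
  classical
  have hD := algF_isTracialStarAlgebra (P := P) (hk := hk) hδ
  obtain ⟨C, hC, hbound⟩ := exists_bound_component (hk := hk) hδ m a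
  refine ⟨2 ^ (2 * m.1 + 1) * ((2 * m.1 + 1 : ℕ) * C), by positivity, fun b => ?_⟩
  obtain ⟨s, hs⟩ := exists_support b
  obtain ⟨s', hs'⟩ := exists_support (P.mulF k hk (P.ofF k m a) b)
  let near : ℕ → ℕ → Prop := fun n t => n ≤ t + m.1 ∧ t ≤ n + m.1
  have hsum : ∀ (x : P.F k) (r : Finset {n : ℕ // k ≤ n}), (∀ n, n ∉ r → x n = 0) →
      (P.algF k hk).normSq x = ∑ n ∈ r, (P.algF k hk).normSq (P.ofF k n (x n)) := fun x r hr =>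
    (normSq_eq_sum hr).trans (Finset.sum_congr rfl fun n _ => (normSq_ofF n _).symm)
  have hcomp : ∀ t : {n : ℕ // k ≤ n}, P.mulF k hk (P.ofF k m a) b t =
      ∑ n ∈ s.filter (fun n => near t.1 n.1), P.component k m.1 n.1 t.1 a (b n) := by
    intro t
    conv_lhs => rw [sum_ofF hs, map_sum]
    rw [DFinsupp.finsetSum_apply, Finset.sum_filter]
    refine Finset.sum_congr rfl fun n _ => ?_
    rw [mulF_ofF_apply]
    split_ifs with h
    · rfl
    · rw [component_of_not, LinearMap.zero_apply, LinearMap.zero_apply]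
      rintro ⟨q1, q2, q3, q4, q5, q6⟩
      exact h ⟨by omega, by omega⟩
  have ht : ∀ t : {n : ℕ // k ≤ n},
      (P.algF k hk).normSq (P.ofF k t (P.mulF k hk (P.ofF k m a) b t)) ≤
        2 ^ (2 * m.1 + 1) * ∑ n ∈ s.filter (fun n => near t.1 n.1),
          C * (P.algF k hk).normSq (P.ofF k n (b n)) := by
    intro t
    rw [hcomp, map_sum]
    refine (hD.normSq_sum_le _ _).trans (mul_le_mul ?_ ?_ ?_ ?_)
    · exact pow_le_pow_right₀ one_le_two (card_near_le m.1 t.1 s)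
    · exact Finset.sum_le_sum fun n _ => hbound n t (b n)
    · exact Finset.sum_nonneg fun n _ => hD.normSq_nonneg _
    · positivity
  rw [hsum _ s' hs', hsum b s hs]
  refine (Finset.sum_le_sum fun t _ => ht t).trans ?_
  rw [← Finset.mul_sum, mul_assoc]
  refine mul_le_mul_of_nonneg_left ?_ (by positivity)
  rw [Finset.sum_comm' (t' := s) (s' := fun n => s'.filter (fun t => near n.1 t.1)) (by
    intro t n
    simp only [Finset.mem_filter, near]
    tauto), Finset.mul_sum]
  refine Finset.sum_le_sum fun n _ => ?_
  rw [Finset.sum_const, nsmul_eq_mul, mul_assoc]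
  exact mul_le_mul_of_nonneg_right (Nat.cast_le.2 (card_near_le m.1 n.1 s'))
    (mul_nonneg hC (hD.normSq_nonneg _))

theorem exists_bound (hδ : 0 < δ) (a : P.F k) :
    ∃ C : ℝ, 0 ≤ C ∧ ∀ b, (P.algF k hk).normSq (P.mulF k hk a b) ≤
      C * (P.algF k hk).normSq b := by
  have hD := algF_isTracialStarAlgebra (P := P) (hk := hk) hδ
  induction a using F_induction with
  | zero => exact ⟨0, le_rfl, fun b => by simp [TracialData.normSq]⟩
  | of m a => exact exists_bound_ofF hδ m a
  | add x y hx hy =>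
    obtain ⟨C, hC, h⟩ := hx
    obtain ⟨C', hC', h'⟩ := hy
    refine ⟨2 * C + 2 * C', by positivity, fun b => ?_⟩
    rw [map_add, LinearMap.add_apply]
    refine (hD.normSq_add_le _ _).trans ?_
    linarith [h b, h' b]

/-- `F_1(P)` is a finite pre-von Neumann algebra. -/
theorem algF_isFinitePreVonNeumann (hδ : 0 < δ) :
    (P.algF 1 le_rfl).IsFinitePreVonNeumann := by
  have hD := algF_isTracialStarAlgebra (P := P) (hk := le_refl 1) hδ
  refine ⟨hD.mul_assoc, hD.one_mul, hD.mul_one, hD.dag_dag, hD.dag_mul, ?_, hD.tr_comm,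
    hD.inner_symm, hD.inner_pos, fun a => ?_⟩
  · exact (congrArg (P.tau 1) (ofF_same ⟨1, le_rfl⟩ _)).trans (tau_one_unitElem hδ.ne')
  · obtain ⟨C, hC, h⟩ := exists_bound (hk := le_refl 1) hδ a
    refine ⟨Real.sqrt C, fun b => ?_⟩
    rw [Real.sq_sqrt hC]
    exact h b

end SubfactorPlanarAlgebra

/-! ### The subalgebra and the conditional expectation -/

namespace StarPlanarSubalgebra

open SubfactorPlanarAlgebra StarPlanarAlgebra Tangle

variable {δ : ℝ} {P : SubfactorPlanarAlgebra.{u} δ} (Q : StarPlanarSubalgebra P) {k : ℕ}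

theorem val_prodMap {m n t : ℕ} (h : ProdRange k m n t) (x : Q.toPlanarAlgebra.V (.nat m))
    (y : Q.toPlanarAlgebra.V (.nat n)) : Q.val (.nat t) (Q.toPlanarAlgebra.prodMap h x y) =
      P.prodMap h (Q.val _ x) (Q.val _ y) := by
  refine (Q.val_Z _ _).trans (congrArg (P.Z (prod k m n t h)) (funext fun i => ?_))
  cases i <;> rfl

theorem scalar_val (x : Q.toPlanarAlgebra.V (.nat 0)) :
    P.scalar (Q.val (.nat 0) x) = Q.toSubfactorPlanarAlgebra.scalar x := by
  obtain ⟨r, rfl⟩ := exists_eq_smul_unitElem (P := Q.toSubfactorPlanarAlgebra) x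
  rw [scalar_smul_unitElem]
  have e : Q.val (.nat 0) (r • Q.toPlanarAlgebra.unitElem (.nat 0)) =
      r • P.unitElem (.nat 0) := by rw [map_smul, val_unitElem]
  exact (congrArg P.scalar e).trans (scalar_smul_unitElem r)

theorem tau_val {n : ℕ} (x : Q.toPlanarAlgebra.V (.nat n)) :
    P.tau n (Q.val (.nat n) x) = Q.toSubfactorPlanarAlgebra.tau n x := by
  refine (tau_apply _).trans (Eq.trans ?_ (tau_apply (P := Q.toSubfactorPlanarAlgebra) x).symm)
  exact congrArg _ (Q.scalar_val (Q.toPlanarAlgebra.unaryMap (trace n) x))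

theorem inclF_apply (x : Q.toSubfactorPlanarAlgebra.F k) (n : {n : ℕ // k ≤ n}) :
    Q.inclF k x n = Q.val (.nat n.1) (x n) := rfl

theorem inclF_ofF (n : {n : ℕ // k ≤ n}) (x : Q.toSubfactorPlanarAlgebra.V (.nat n.1)) :
    Q.inclF k (Q.toSubfactorPlanarAlgebra.ofF k n x) = P.ofF k n (Q.val _ x) :=
  DirectSum.lmap_lof (fun n : {n : ℕ // k ≤ n} => Q.val (.nat n.1)) n x

theorem inclF_mulF (hk : 1 ≤ k) (a b : Q.toSubfactorPlanarAlgebra.F k) :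
    Q.inclF k (Q.toSubfactorPlanarAlgebra.mulF k hk a b) =
      P.mulF k hk (Q.inclF k a) (Q.inclF k b) := by
  induction a using F_induction with
  | zero => simp only [map_zero, LinearMap.zero_apply]
  | add x y hx hy => simp only [map_add, LinearMap.add_apply, hx, hy]
  | of m a =>
    induction b using F_induction with
    | zero => simp only [map_zero]
    | add x y hx hy => simp only [map_add, hx, hy]
    | of n b =>
      refine DFinsupp.ext fun t => ?_
      have e := mulF_ofF_apply (P := P) (hk := hk) m n t (Q.val _ a) (Q.val _ b)
      rw [← inclF_ofF, ← inclF_ofF] at e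
      rw [e, inclF_apply, mulF_ofF_apply]
      by_cases h : ProdRange k m.1 n.1 t.1
      · rw [component_of h, component_of h]
        exact Q.val_prodMap h a b
      · rw [component_of_not h, component_of_not h]
        rfl

theorem inclF_one (hk : 1 ≤ k) :
    Q.inclF k (Q.toSubfactorPlanarAlgebra.algF k hk).one = (P.algF k hk).one :=
  (Q.inclF_ofF ⟨k, le_rfl⟩ _).trans (congrArg _ (Q.val_unitElem (.nat k)))

theorem inclF_isCompatiblePair (hδ : 0 < δ) :
    IsCompatiblePair (Q.toSubfactorPlanarAlgebra.algF 1 le_rfl) (P.algF 1 le_rfl) (Q.inclF 1) where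
  left := algF_isFinitePreVonNeumann hδ
  right := algF_isFinitePreVonNeumann hδ
  injective _ _ h := DFinsupp.ext fun n => Q.val_injective _ (DFunLike.congr_fun h n)
  map_mul := Q.inclF_mulF le_rfl
  map_one := Q.inclF_one le_rfl
  map_dag _ := DFinsupp.ext fun _ => rfl
  map_tr _ := Q.tau_val _

/-- The orthogonal projection of `P_n` onto `Q_n`. -/
theorem exists_projection (hδ : 0 < δ) (n : ℕ) (hn : 1 ≤ n) :
    ∃ e : P.V (.nat n) →ₗ[ℂ] Q.toSubfactorPlanarAlgebra.V (.nat n),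
      ∀ y x, P.tau n (P.mulMap n hn (Q.val _ y) (Q.val _ (e x))) =
        P.tau n (P.mulMap n hn (Q.val _ y) x) := by
  have : FiniteDimensional ℂ (Q.toPlanarAlgebra.V (.nat n)) :=
    Q.toSubfactorPlanarAlgebra.finiteDimensional (.nat n)
  exact TracialData.exists_projection (D' := P.algV n hn) (i := Q.val (.nat n))
    (Q.toSubfactorPlanarAlgebra.algV_isTracialStarAlgebra hδ n hn)
    (Q.val_prodMap _) Q.tau_val

theorem isConditionalExpectation (hδ : 0 < δ) {n : ℕ} (hn : 1 ≤ n)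
    {e : P.V (.nat n) →ₗ[ℂ] Q.toSubfactorPlanarAlgebra.V (.nat n)}
    (he : ∀ y x, P.tau n (P.mulMap n hn (Q.val _ y) (Q.val _ (e x))) =
        P.tau n (P.mulMap n hn (Q.val _ y) x)) : Q.IsConditionalExpectation n hn e := by
  have h := TracialData.isBimoduleRetraction (i := Q.val (.nat n)) (E := e)
    (Q.toSubfactorPlanarAlgebra.algV_isTracialStarAlgebra hδ n hn)
    (P.algV_isTracialStarAlgebra hδ n hn)
    (Q.val_prodMap _) (Q.val_unitElem _) (fun _ => rfl) Q.tau_val he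
  exact ⟨h.retraction, h.map_mul_left, h.map_mul_right, h.map_dag,
    fun x => (Q.tau_val _).trans (h.map_tr x)⟩

/-- Pairing with `y ∈ Q_n` in `F_k(P)` is, before normalisation, pairing with some `z ∈ Q_n` in
`P_n`. -/
theorem trace_prodMap_eq (hk : 1 ≤ k) {n : ℕ} (hn : k ≤ n) (hn' : 1 ≤ n)
    (y : Q.toPlanarAlgebra.V (.nat n)) :
    ∃ z : Q.toPlanarAlgebra.V (.nat n), ∀ x : P.V (.nat n),
      P.unaryMap (trace k) (P.prodMap (prodRange_self hk hn) (Q.val _ y) x) =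
        P.unaryMap (trace n) (P.mulMap n hn' (Q.val _ z) x) := by
  refine ⟨Q.toSubfactorPlanarAlgebra.conj _ (Q.toSubfactorPlanarAlgebra.dagMap hn y), fun x => ?_⟩
  have e : P.dagMap hn (P.dagMap hn (Q.val _ y)) = Q.val _ y := dagMap_dagMap hn hn' _
  have h := trace_dagMap_prodMap (prodRange_self hk hn) hn' (P.dagMap hn (Q.val _ y)) x
  rw [e] at h
  exact h

/-- The direct sum of the orthogonal projections of `P_n` onto `Q_n` is an orthogonal projection of
`F_k(P)` onto `F_k(Q)`, since the inner products on `P_n` are proportional. -/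
theorem tr_lmap (hk : 1 ≤ k) {e : ∀ n : {n : ℕ // k ≤ n},
      P.V (.nat n.1) →ₗ[ℂ] Q.toSubfactorPlanarAlgebra.V (.nat n.1)}
    (hδ : 0 < δ)
    (he : ∀ n y x, P.tau n.1 (P.mulMap n.1 (hk.trans n.2) (Q.val _ y) (Q.val _ (e n x))) =
      P.tau n.1 (P.mulMap n.1 (hk.trans n.2) (Q.val _ y) x))
    (y : Q.toSubfactorPlanarAlgebra.F k) (x : P.F k) :
    (P.algF k hk).tr (P.mulF k hk (Q.inclF k y) (Q.inclF k (DirectSum.lmap e x))) =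
      (P.algF k hk).tr (P.mulF k hk (Q.inclF k y) x) := by
  obtain ⟨s, hs⟩ := exists_support x
  rw [tr_mulF hs, tr_mulF (s := s)]
  · refine Finset.sum_congr rfl fun n _ => ?_
    obtain ⟨z, hz⟩ := Q.trace_prodMap_eq hk n.2 (hk.trans n.2) (y n)
    have h := he n z (x n)
    have h0 : ((δ : ℂ) ^ n.1)⁻¹ ≠ 0 := inv_ne_zero (pow_ne_zero _ (Complex.ofReal_ne_zero.2 hδ.ne'))
    rw [tau_apply, tau_apply] at h ⊢
    have h1 := mul_left_cancel₀ h0 h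
    refine congrArg _ ?_
    refine (congrArg P.scalar (hz _)).trans (Eq.trans ?_ (congrArg P.scalar (hz _)).symm)
    exact h1
  · intro n hn
    rw [inclF_apply]
    change Q.val _ (e n (x n)) = 0
    rw [hs n hn, map_zero]
    exact map_zero (Q.val (.nat n.1))

end StarPlanarSubalgebra

end

theorem mainTheorem6 {δ : ℝ} (hδ : 1 < δ) (P : SubfactorPlanarAlgebra.{u} δ)
    (Q : StarPlanarSubalgebra P) :
    IsCompatiblePair (Q.toSubfactorPlanarAlgebra.algF 1 le_rfl) (P.algF 1 le_rfl) (Q.inclF 1) ∧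
    ∃ E : P.F 1 →ₗ[ℂ] Q.toSubfactorPlanarAlgebra.F 1,
      IsBimoduleRetraction (Q.toSubfactorPlanarAlgebra.algF 1 le_rfl) (P.algF 1 le_rfl)
        (Q.inclF 1) E ∧
      ∃ e : ∀ n : {n : ℕ // 1 ≤ n},
          P.V (.nat n.1) →ₗ[ℂ] Q.toSubfactorPlanarAlgebra.V (.nat n.1),
        (∀ n, Q.IsConditionalExpectation n.1 n.2 (e n)) ∧ ∀ x n, E x n = e n (x n) := by
  have hδ0 : 0 < δ := zero_lt_one.trans hδ
  have hpair := Q.inclF_isCompatiblePair hδ0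
  choose e he using fun n : {n : ℕ // 1 ≤ n} => Q.exists_projection hδ0 n.1 n.2
  refine ⟨hpair, DirectSum.lmap e, ?_, e, fun n => Q.isConditionalExpectation hδ0 n.2 (he n),
    fun _ _ => rfl⟩
  exact TracialData.isBimoduleRetraction
    (SubfactorPlanarAlgebra.algF_isTracialStarAlgebra hδ0)
    (SubfactorPlanarAlgebra.algF_isTracialStarAlgebra hδ0)
    hpair.map_mul hpair.map_one hpair.map_dag hpair.map_tr (Q.tr_lmap le_rfl hδ0 he)
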